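/- Let $p>1$ and $\kappa:=\min\{\tfrac12,\tfrac{p-1}{2}\}$. For $a,b,c\in\mathbb R$ put $$v_{abc}(y):=\Big(\frac{2c}{p-1+by^2}\Big)^{\frac1{p-1}}e^{-\frac a4y^2},\qquad \phi_{0a}(y):=e^{-\frac a4y^2},\qquad \phi_{2a}(y):=(1-ay^2)e^{-\frac a4y^2},\qquad \langle y\rangle:=(1+y^2)^{1/2}.$$ Then there are constants $\varepsilon>0$ and $C>0$ and real-valued functionals $\mathcal R_b(f,b,c)$, $\mathcal R_c(f,b,c)$ of a function $f:\mathbb R\to\mathbb R$ and two real numbers $b,c$, all depending only on $p$, such that the following holds. Let $T>0$, let $b,c\in C^1([0,T])$ be real functions with $0<b(0)\le\varepsilon$ and $\tfrac14\le c(0)\le1$, and put $a:=2c-\tfrac12$. Let $w(y,\tau)$ be a solution on $\mathbb R\times[0,T]$ of the gauged equation $$w_\tau=\Big(\partial_y^2-\tfrac14\omega^2y^2-\big(\tfrac{2}{p-1}-\tfrac12\big)a\Big)w+e^{\frac a4(p-1)y^2}|w|^{p-1}w,\qquad \omega^2:=a^2+a_\tau ,$$ in the following sense: the equation holds pointwise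 for $0<\tau\le T$, $w(\cdot,\tau)$ is $C^2$ for these $\tau$, the functions $w$ and $\partial_y^2w$ are jointly continuous on $\mathbb R\times(0,T]$, and $w(y,\tau)\to w(y,0)$ as $\tau\to0^+$ for almost every $y$. Suppose that for all $\tau\in[0,T]$ $$w(\cdot,\tau)=v_{a(\tau)b(\tau)c(\tau)}+\xi(\cdot,\tau),\qquad \xi(\cdot,\tau)\perp\phi_{0a(\tau)},\ \phi_{2a(\tau)}\ \text{ in }L^2(\mathbb R).$$ Put $\beta(\tau):=\Big(\frac1{b(0)}+\frac{4p}{(p-1)^2}\tau\Big)^{-1}$ and $$M_1(\tau):=\sup_{0\le s\le\tau}\beta(s)^{-2}\big\|\langle y\rangle^{-3}e^{\frac{a(s)}4y^2}\xi(\cdot,s)\big\|_\infty,$$ $$A(\tau):=\sup_{0\le s\le\tau}\beta(s)^{-2}\Big|a(s)-\tfrac12+\tfrac{2b(s)}{p-1}\Big|,\qquad B(\tau):=\sup_{0\le s\le\tau}\beta(s)^{-(1+\kappa)}|b(s)-\beta(s)|,$$ and suppose that $A(\tau),B(\tau),M_1(\tau)\le\beta(\tau)^{-\kappa/2}$ for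 all $\tau\in[0,T]$. Then for all $\tau\in[0,T]$ (with one-sided derivatives at the end points) $$b_\tau=-\frac{2(3p-1)}{(p-1)^2}b^2+2b(c-a)+\mathcal R_b(\xi,b,c),\qquad \frac{c_\tau}{c}=2(c-a)-\frac{2}{p-1}b+\mathcal R_c(\xi,b,c),$$ where $\mathcal R_b,\mathcal R_c$ are evaluated at $(\xi(\cdot,\tau),b(\tau),c(\tau))$ and $$|\mathcal R_b(\xi,b,c)|,\ |\mathcal R_c(\xi,b,c)|\le C\big(\beta^3+\beta^3M_1(1+A)+\beta^4M_1^2+\beta^{2p}M_1^p\big).$$ Moreover $|\mathcal R_b(0,b,c)|,\ |\mathcal R_c(0,b,c)|\le C\,b^3$ for all real numbers $0<b\le\varepsilon$ and $\tfrac14\le c\le1$. -/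

import Mathlib

open Set MeasureTheory Filter Topology
open scoped ENNReal

noncomputable section

namespace GaugedHeat

/-- The exponent `κ = min {1/2, (p-1)/2}`. -/
def kappa (p : ℝ) : ℝ := min (1 / 2) ((p - 1) / 2)

/-- The comparison function `β(τ) = 1 / (1/b(0) + 4pτ/(p-1)²)`; the argument `b₀` is `b(0)`. -/
def beta (p b₀ τ : ℝ) : ℝ := 1 / (1 / b₀ + 4 * p / (p - 1) ^ 2 * τ)

/-- The almost solution
`v_{abc}(y) = (2c / (p - 1 + b y²))^{1/(p-1)} e^{-a y²/4}`. -/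
def vabc (p a b c y : ℝ) : ℝ :=
  (2 * c / (p - 1 + b * y ^ 2)) ^ (1 / (p - 1)) * Real.exp (-(a * y ^ 2 / 4))

/-- `φ_{0a}(y) = e^{-a y²/4}`. -/
def phi0 (a y : ℝ) : ℝ := Real.exp (-(a * y ^ 2 / 4))

/-- `φ_{2a}(y) = (1 - a y²) e^{-a y²/4}`. -/
def phi2 (a y : ℝ) : ℝ := (1 - a * y ^ 2) * Real.exp (-(a * y ^ 2 / 4))

/-- The right-hand side of the gauged equation,
`(∂_y² - ω² y²/4 - (2/(p-1) - 1/2) a) f + e^{(a/4)(p-1) y²} |f|^{p-1} f`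
with `ω² = a² + a'`, at the point `y`; here `a'` stands for the value of `a_τ`. -/
def gaugedRHS (p a a' : ℝ) (f : ℝ → ℝ) (y : ℝ) : ℝ :=
  iteratedDeriv 2 f y - 1 / 4 * (a ^ 2 + a') * y ^ 2 * f y
    - (2 / (p - 1) - 1 / 2) * a * f y
    + Real.exp (a / 4 * (p - 1) * y ^ 2) * |f y| ^ (p - 1) * f y

/-- `w` is a solution on `[0,T] × ℝ` of the gauged equation
`w_τ = (∂_y² - ω² y²/4 - (2/(p-1) - 1/2) a) w + e^{(a/4)(p-1) y²} |w|^{p-1} w`,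
`ω² = a² + a_τ`: it is classical for `0 < τ ≤ T` and attains its values at `τ = 0`
at almost every point `y`. (At `τ = T` the derivative in `τ` is the one-sided one.) -/
structure IsGaugedSolution (p T : ℝ) (a : ℝ → ℝ) (w : ℝ → ℝ → ℝ) : Prop where
  initial : ∀ᵐ y : ℝ, ContinuousWithinAt (fun τ => w τ y) (Icc 0 T) 0
  continuousOn : ContinuousOn (fun q : ℝ × ℝ => w q.1 q.2) (Ioc 0 T ×ˢ univ)
  contDiff : ∀ τ ∈ Ioc 0 T, ContDiff ℝ 2 (w τ)
  continuousOn_yy :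
    ContinuousOn (fun q : ℝ × ℝ => iteratedDeriv 2 (w q.1) q.2) (Ioc 0 T ×ˢ univ)
  equation : ∀ τ ∈ Ioc 0 T, ∀ y : ℝ,
    HasDerivWithinAt (fun s => w s y)
      (gaugedRHS p (a τ) (derivWithin a (Icc 0 T) τ) (w τ) y) (Icc 0 T) τ

/-- The weighted norm `‖⟨y⟩⁻³ e^{a y²/4} f‖_∞`, where `⟨y⟩ = (1 + y²)^{1/2}`, with values
in `[0,∞]`. -/
def weightedNorm (a : ℝ) (f : ℝ → ℝ) : ℝ≥0∞ :=
  eLpNorm (fun y : ℝ => (Real.sqrt (1 + y ^ 2) ^ 3)⁻¹ * Real.exp (a / 4 * y ^ 2) * f y)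
    ∞ volume

/-- `M₁(τ) = max_{0 ≤ s ≤ τ} β(s)⁻² ‖⟨y⟩⁻³ e^{a(s) y²/4} ξ(s)‖_∞`, in `[0,∞]`. -/
def majM1 (p : ℝ) (a b : ℝ → ℝ) (ξ : ℝ → ℝ → ℝ) (τ : ℝ) : ℝ≥0∞ :=
  ⨆ s ∈ Icc 0 τ, ENNReal.ofReal ((beta p (b 0) s ^ 2)⁻¹) * weightedNorm (a s) (ξ s)

/-- `A(τ) = max_{0 ≤ s ≤ τ} β(s)⁻² |a(s) - 1/2 + 2 b(s)/(p-1)|`, in `[0,∞]`. -/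
def majA (p : ℝ) (a b : ℝ → ℝ) (τ : ℝ) : ℝ≥0∞ :=
  ⨆ s ∈ Icc 0 τ,
    ENNReal.ofReal ((beta p (b 0) s ^ 2)⁻¹ * |a s - 1 / 2 + 2 * b s / (p - 1)|)

/-- `B(τ) = max_{0 ≤ s ≤ τ} β(s)^{-(1+κ)} |b(s) - β(s)|`, in `[0,∞]`. -/
def majB (p : ℝ) (b : ℝ → ℝ) (τ : ℝ) : ℝ≥0∞ :=
  ⨆ s ∈ Icc 0 τ,
    ENNReal.ofReal (beta p (b 0) s ^ (-(1 + kappa p)) * |b s - beta p (b 0) s|)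

/-- The order of the remainders, `β³ + β³ M₁ (1 + A) + β⁴ M₁² + β^{2p} M₁^p`, at the
time `τ`. -/
def remainderOrder (p : ℝ) (a b : ℝ → ℝ) (ξ : ℝ → ℝ → ℝ) (τ : ℝ) : ℝ :=
  beta p (b 0) τ ^ 3
    + beta p (b 0) τ ^ 3 * (majM1 p a b ξ τ).toReal * (1 + (majA p a b τ).toReal)
    + beta p (b 0) τ ^ 4 * (majM1 p a b ξ τ).toReal ^ 2
    + beta p (b 0) τ ^ (2 * p) * (majM1 p a b ξ τ).toReal ^ p

end GaugedHeat

end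

/-!
The remainders `R_b`, `R_c` are what the projections of the equation on the two moving directions
`φ_{0a}`, `φ_{2a}` leave over, so they can be read off from the perturbation alone.

Write `a = 2c - 1/2`, `w = e^{-a y²/4} u`, `V = (2c / (p - 1 + b y²))^{1/(p-1)}`,
`Q = y² / (p - 1 + b y²)` and `η = e^{a y²/4} ξ = u - V`. Substituting `V` into the equation and
expanding in powers of `Q` gives exactly (`vabc_residual`) the error
`V/(p-1) (Γ_c - Γ_b Q + 4p b³/(p-1)² Q²)`, where `Γ_b` and `Γ_c` (`defectB`, `defectC`) are the
deviations of `b_τ` and `c_τ/c` from the claimed equations. Testing the equation for `ξ` with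
`e^{-a y²/4}` and `y² e^{-a y²/4}`, to which `ξ` is orthogonal, turns this into two linear equations
for `Γ_c, Γ_b` (`system_of_solution`): their coefficients are Gaussian moments of `V` and a quartic
moment of `ξ`, and their right-hand sides are `O(b³)` plus moments of the nonlinear increment
`|V+η|^{p-1}(V+η) - V^p`. Cramer's rule then defines the functionals `remainderB`, `remainderC`.

Three facts carry the argument.

* The testing is legitimate although nothing is known about the decay of `ξ_y` and `ξ_yy`:
  `integral_eq_zero_of_orthogonal` integrates by parts under a cutoff and removes the cutoff
  uniformly in time, and `projection_identity` reaches the end points by dominated convergence.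
* The determinant is bounded away from zero (`exists_det_lower_bound`), by a Chebyshev type
  identity: `Q` is an increasing function of `y²`.
* The right-hand sides are of the claimed order (`exists_abs_nonlinMoment_le`,
  `exists_abs_remainder_le`). The linear part `p V^{p-1} η` of the increment gains a factor `b`,
  since `V^{p-1} = 2c/(p-1) (1 - b Q)` and `η` is orthogonal to constants. The term coming from the
  motion of `a` gains the factor `2(c-a) - 2b/(p-1) = -(a - 1/2 + 2b/(p-1))`, which `A` controls.

The assumed bounds on `A`, `B`, `M₁` make `b` comparable to `β`, `a` close to `1/2` and `β² M₁`
small, so that all these estimates apply with constants depending only on `p`.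
-/

noncomputable section

namespace GaugedHeat

/-! ### Testing an evolution equation with a moving test function -/

/-- Cutoffs `χ n` exhausting the line, together with their first two derivatives. -/
theorem exists_cutoff :
    ∃ (χ χ₁ χ₂ : ℕ → ℝ → ℝ) (C : ℝ), 0 ≤ C ∧
      (∀ n y, HasDerivAt (χ n) (χ₁ n y) y) ∧ (∀ n y, HasDerivAt (χ₁ n) (χ₂ n y) y) ∧
      (∀ n, Continuous (χ₂ n)) ∧
      (∀ n, ∃ R, ∀ y, R < |y| → χ n y = 0 ∧ χ₁ n y = 0 ∧ χ₂ n y = 0) ∧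
      (∀ n y, 0 ≤ χ n y ∧ χ n y ≤ 1) ∧
      (∀ n y, |χ₁ n y| ≤ C / (n + 1)) ∧ (∀ n y, |χ₂ n y| ≤ C / (n + 1)) ∧
      (∀ y, ∀ᶠ n in atTop, χ n y = 1) := by
  let f : ContDiffBump (0 : ℝ) := ⟨1, 2, one_pos, one_lt_two⟩
  have hf : ContDiff ℝ 2 (f : ℝ → ℝ) := f.contDiff (n := 2)
  have hc : HasCompactSupport (f : ℝ → ℝ) := f.hasCompactSupport
  have hf1 : ContDiff ℝ 1 (deriv f) := by
    have : ContDiff ℝ (1 + 1) (f : ℝ → ℝ) := by simpa [one_add_one_eq_two] using hf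
    exact (contDiff_succ_iff_deriv.1 this).2.2
  have hf2 : Continuous (deriv (deriv f)) := hf1.continuous_deriv (by norm_num)
  obtain ⟨C₁, hC₁⟩ := hc.deriv.exists_bound_of_continuous hf1.continuous
  obtain ⟨C₂, hC₂⟩ := hc.deriv.deriv.exists_bound_of_continuous hf2
  have hz : ∀ g : ℝ → ℝ, tsupport g ⊆ tsupport f → ∀ y, 2 < |y| → g y = 0 := by
    intro g hg y hy
    by_contra h
    have := hg (subset_tsupport _ (Function.mem_support.2 h))
    rw [f.tsupport_eq] at this
    have h2 : |y| ≤ 2 := by simpa [f] using this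
    linarith
  have hN : ∀ n : ℕ, (0 : ℝ) < n + 1 := fun n => by positivity
  have hlin : ∀ (n : ℕ) (y : ℝ), HasDerivAt (fun y : ℝ => y / (n + 1)) (1 / (n + 1)) y :=
    fun n y => (hasDerivAt_id y).div_const _
  refine ⟨fun n y => f (y / (n + 1)), fun n y => deriv f (y / (n + 1)) * (1 / (n + 1)),
    fun n y => deriv (deriv f) (y / (n + 1)) * (1 / (n + 1)) * (1 / (n + 1)),
    max C₁ C₂, ?_, ?_, ?_, ?_, ?_, ?_, ?_, ?_, ?_⟩
  · exact le_trans (norm_nonneg _) ((hC₁ 0).trans (le_max_left _ _))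
  · intro n y
    exact ((hf.differentiable (by norm_num) _).hasDerivAt).comp y (hlin n y)
  · intro n y
    exact (((hf1.differentiable (by norm_num) _).hasDerivAt).comp y (hlin n y)).mul_const _
  · intro n
    fun_prop
  · intro n
    refine ⟨2 * (n + 1), fun y hy => ?_⟩
    have : 2 < |y / (n + 1)| := by
      rw [abs_div, abs_of_pos (hN n), lt_div_iff₀ (hN n)]; exact hy
    refine ⟨hz f subset_rfl _ this, ?_, ?_⟩
    · simp only [hz (deriv f) (tsupport_deriv_subset) _ this, zero_mul]
    · simp only [hz (deriv (deriv f))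
        ((tsupport_deriv_subset).trans tsupport_deriv_subset) _ this, zero_mul]
  · exact fun n y => ⟨f.nonneg, f.le_one⟩
  · intro n y
    rw [abs_mul, abs_of_pos (one_div_pos.2 (hN n)), mul_one_div]
    exact div_le_div_of_nonneg_right ((hC₁ _).trans (le_max_left _ _)) (hN n).le
  · intro n y
    have h1 : (1 : ℝ) / (n + 1) ≤ 1 := by
      rw [div_le_one (hN n)]; linarith [(Nat.cast_nonneg n : (0 : ℝ) ≤ n)]
    rw [abs_mul, abs_mul, abs_of_pos (one_div_pos.2 (hN n))]
    calc |deriv (deriv f) (y / (n + 1))| * (1 / (n + 1)) * (1 / (n + 1))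
        ≤ |deriv (deriv f) (y / (n + 1))| * (1 / (n + 1)) * 1 :=
          mul_le_mul_of_nonneg_left h1
            (mul_nonneg (abs_nonneg _) (one_div_pos.2 (hN n)).le)
      _ ≤ max C₁ C₂ / (n + 1) := by
          rw [mul_one, mul_one_div]
          exact div_le_div_of_nonneg_right ((hC₂ _).trans (le_max_right _ _)) (hN n).le
  · intro y
    obtain ⟨m, hm⟩ := exists_nat_ge |y|
    filter_upwards [eventually_ge_atTop m] with n hn
    refine f.one_of_mem_closedBall ?_
    have : |y| ≤ n + 1 := by
      have : (m : ℝ) ≤ n := Nat.cast_le.2 hn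
      linarith
    simpa [f, abs_div, abs_of_pos (hN n), div_le_one (hN n)] using this

/-- Integrating by parts twice against a compactly supported factor. -/
theorem integral_mul_second_deriv {f f₁ f₂ h h₁ h₂ : ℝ → ℝ} {R : ℝ}
    (hf : ∀ y, HasDerivAt f (f₁ y) y) (hf₁ : ∀ y, HasDerivAt f₁ (f₂ y) y) (hf₂ : Continuous f₂)
    (hh : ∀ y, HasDerivAt h (h₁ y) y) (hh₁ : ∀ y, HasDerivAt h₁ (h₂ y) y) (hh₂ : Continuous h₂)
    (hR : ∀ y, R < |y| → h y = 0 ∧ h₁ y = 0 ∧ h₂ y = 0) :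
    ∫ y, f₂ y * h y = ∫ y, f y * h₂ y := by
  have cf : Continuous f := continuous_iff_continuousAt.2 fun y => (hf y).continuousAt
  have cf₁ : Continuous f₁ := continuous_iff_continuousAt.2 fun y => (hf₁ y).continuousAt
  have ch : Continuous h := continuous_iff_continuousAt.2 fun y => (hh y).continuousAt
  have ch₁ : Continuous h₁ := continuous_iff_continuousAt.2 fun y => (hh₁ y).continuousAt
  have key : ∀ u v : ℝ → ℝ, Continuous u → Continuous v → (∀ y, R < |y| → v y = 0) →
      Integrable (u * v) := by
    intro u v hu hv hz
    refine (hu.mul hv).integrable_of_hasCompactSupport ?_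
    refine HasCompactSupport.intro (isCompact_closedBall (0 : ℝ) R) fun y hy => ?_
    have : R < |y| := by simpa using hy
    simp [hz y this]
  have e1 := integral_mul_deriv_eq_deriv_mul_of_integrable (u := f) (v := h₁) (u' := f₁) (v' := h₂)
    (fun y _ => hf y) (fun y _ => hh₁ y) (key _ _ cf hh₂ fun y hy => (hR y hy).2.2)
    (key _ _ cf₁ ch₁ fun y hy => (hR y hy).2.1) (key _ _ cf ch₁ fun y hy => (hR y hy).2.1)
  have e2 := integral_mul_deriv_eq_deriv_mul_of_integrable (u := f₁) (v := h) (u' := f₂) (v' := h₁)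
    (fun y _ => hf₁ y) (fun y _ => hh y) (key _ _ cf₁ ch₁ fun y hy => (hR y hy).2.1)
    (key _ _ hf₂ ch fun y hy => (hR y hy).1) (key _ _ cf₁ ch fun y hy => (hR y hy).1)
  rw [e1, e2, neg_neg]

/-- If `ξ` stays orthogonal to a moving test function `ψ` and `∂_τ (ξ ψ) = ξ_yy ψ + S`, then
`∫ (ξ ψ_yy + S) = 0`. Nothing is assumed about the size of `ξ_y` and `ξ_yy` at infinity: the
integration by parts is done under a cutoff, and the cut off identities converge uniformly
in time because of the majorant `K`. -/
theorem integral_eq_zero_of_orthogonal {T : ℝ} {ξ ξ₁ ξ₂ ψ ψ₁ ψ₂ S : ℝ → ℝ → ℝ} {K : ℝ → ℝ}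
    (hξ : ∀ τ ∈ Ioo 0 T, ∀ y, HasDerivAt (ξ τ) (ξ₁ τ y) y)
    (hξ₁ : ∀ τ ∈ Ioo 0 T, ∀ y, HasDerivAt (ξ₁ τ) (ξ₂ τ y) y)
    (hξ₂ : ∀ τ ∈ Ioo 0 T, Continuous (ξ₂ τ))
    (hψ : ∀ τ ∈ Ioo 0 T, ∀ y, HasDerivAt (ψ τ) (ψ₁ τ y) y)
    (hψ₁ : ∀ τ ∈ Ioo 0 T, ∀ y, HasDerivAt (ψ₁ τ) (ψ₂ τ y) y)
    (hψ₂ : ∀ τ ∈ Ioo 0 T, Continuous (ψ₂ τ))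
    (hcont : ContinuousOn (fun q : ℝ × ℝ => ξ₂ q.1 q.2 * ψ q.1 q.2 + S q.1 q.2)
      (Ioo 0 T ×ˢ univ))
    (hderiv : ∀ τ ∈ Ioo 0 T, ∀ y,
      HasDerivAt (fun s => ξ s y * ψ s y) (ξ₂ τ y * ψ τ y + S τ y) τ)
    (hK : Integrable K)
    (hb : ∀ τ ∈ Ioo 0 T, ∀ᵐ y, |ξ τ y * ψ τ y| ≤ K y)
    (hb₁ : ∀ τ ∈ Ioo 0 T, ∀ᵐ y, |ξ τ y * ψ₁ τ y| ≤ K y)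
    (hb₂ : ∀ τ ∈ Ioo 0 T, ∀ᵐ y, |ξ τ y * ψ₂ τ y| ≤ K y)
    (hbS : ∀ τ ∈ Ioo 0 T, ∀ᵐ y, |S τ y| ≤ K y)
    (horth : ∀ τ ∈ Ioo 0 T, ∫ y, ξ τ y * ψ τ y = 0) :
    ∀ τ ∈ Ioo 0 T, ∫ y, (ξ τ y * ψ₂ τ y + S τ y) = 0 := by
  obtain ⟨χ, χ₁, χ₂, C, hC0, hχ, hχ₁, hχ₂, hsupp, h01, hC₁, hC₂, hone⟩ := exists_cutoff
  have cχ : ∀ n, Continuous (χ n) := fun n =>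
    continuous_iff_continuousAt.2 fun y => (hχ n y).continuousAt
  have cχ₁ : ∀ n, Continuous (χ₁ n) := fun n =>
    continuous_iff_continuousAt.2 fun y => (hχ₁ n y).continuousAt
  have cξ : ∀ τ ∈ Ioo 0 T, Continuous (ξ τ) := fun τ hτ =>
    continuous_iff_continuousAt.2 fun y => (hξ τ hτ y).continuousAt
  have cψ : ∀ τ ∈ Ioo 0 T, Continuous (ψ τ) := fun τ hτ =>
    continuous_iff_continuousAt.2 fun y => (hψ τ hτ y).continuousAt
  have cψ₁ : ∀ τ ∈ Ioo 0 T, Continuous (ψ₁ τ) := fun τ hτ =>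
    continuous_iff_continuousAt.2 fun y => (hψ₁ τ hτ y).continuousAt
  have cP : ∀ τ ∈ Ioo 0 T, Continuous (fun y => ξ₂ τ y * ψ τ y + S τ y) := fun τ hτ => by
    have : ContinuousOn ((fun q : ℝ × ℝ => ξ₂ q.1 q.2 * ψ q.1 q.2 + S q.1 q.2) ∘
        fun y : ℝ => (τ, y)) univ :=
      hcont.comp (by fun_prop) fun y _ => ⟨hτ, mem_univ _⟩
    simpa [continuousOn_univ, Function.comp_def] using this
  have cS : ∀ τ ∈ Ioo 0 T, Continuous (S τ) := fun τ hτ => by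
    refine ((cP τ hτ).sub ((hξ₂ τ hτ).mul (cψ τ hτ))).congr fun y => ?_
    simp
  have hint : ∀ {g : ℝ → ℝ}, Continuous g → (∀ᵐ y, |g y| ≤ K y) → Integrable g :=
    fun hg hgK => hK.mono' hg.aestronglyMeasurable hgK
  -- the cut off quantities and their time derivatives
  set G : ℕ → ℝ → ℝ := fun n τ => ∫ y, χ n y * (ξ τ y * ψ τ y) with hG
  set H : ℕ → ℝ → ℝ := fun n τ => ∫ y, χ n y * (ξ₂ τ y * ψ τ y + S τ y) with hH
  have hGH : ∀ n, ∀ τ ∈ Ioo 0 T, HasDerivAt (G n) (H n τ) τ := by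
    intro n τ hτ
    obtain ⟨R, hR⟩ := hsupp n
    obtain ⟨δ, hδ, hball⟩ := Metric.nhds_basis_closedBall.mem_iff.1 (isOpen_Ioo.mem_nhds hτ)
    obtain ⟨M, hM⟩ := ((isCompact_closedBall τ δ).prod
      (isCompact_closedBall (0 : ℝ) R)).exists_bound_of_continuousOn
      (hcont.mono (prod_mono hball (subset_univ _)))
    have hM' : ∀ s ∈ Metric.closedBall τ δ, ∀ y,
        ‖χ n y * (ξ₂ s y * ψ s y + S s y)‖ ≤ (Metric.closedBall (0 : ℝ) R).indicator
          (fun _ => M) y := by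
      intro s hs y
      by_cases hy : y ∈ Metric.closedBall (0 : ℝ) R
      · rw [indicator_of_mem hy, norm_mul, Real.norm_of_nonneg (h01 n y).1]
        have := hM (s, y) ⟨hs, hy⟩
        calc _ ≤ 1 * ‖ξ₂ s y * ψ s y + S s y‖ :=
              mul_le_mul_of_nonneg_right (h01 n y).2 (norm_nonneg _)
          _ ≤ M := by rw [one_mul]; exact this
      · rw [indicator_of_notMem hy, (hR y (by simpa using hy)).1]; simp
    refine (hasDerivAt_integral_of_dominated_loc_of_deriv_le
      (bound := (Metric.closedBall (0 : ℝ) R).indicator (fun _ => M))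
      (F := fun s y => χ n y * (ξ s y * ψ s y))
      (F' := fun s y => χ n y * (ξ₂ s y * ψ s y + S s y))
      (Metric.closedBall_mem_nhds τ hδ) ?_ ?_ ?_ ?_ ?_ ?_).2
    · filter_upwards [isOpen_Ioo.mem_nhds hτ] with s hs
      exact ((cχ n).mul ((cξ s hs).mul (cψ s hs))).aestronglyMeasurable
    · refine ((cχ n).mul ((cξ τ hτ).mul (cψ τ hτ))).integrable_of_hasCompactSupport ?_
      refine HasCompactSupport.intro (isCompact_closedBall (0 : ℝ) R) fun y hy => ?_
      simp [(hR y (by simpa using hy)).1]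
    · exact ((cχ n).mul (cP τ hτ)).aestronglyMeasurable
    · exact Eventually.of_forall fun y s hs => hM' s hs y
    · exact (integrable_indicator_iff measurableSet_closedBall).2
        (integrableOn_const measure_closedBall_lt_top.ne)
    · exact Eventually.of_forall fun y s hs => (hderiv s (hball hs) y).const_mul _
  -- moving the two derivatives onto the cut off test function
  have hIBP : ∀ n, ∀ τ ∈ Ioo 0 T, H n τ =
      ∫ y, (χ n y * (ξ τ y * ψ₂ τ y + S τ y) + 2 * χ₁ n y * (ξ τ y * ψ₁ τ y)
        + χ₂ n y * (ξ τ y * ψ τ y)) := by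
    intro n τ hτ
    obtain ⟨R, hR⟩ := hsupp n
    have key : ∀ v : ℝ → ℝ, Continuous v → (∀ y, R < |y| → v y = 0) → Integrable v := by
      intro v hv hz
      refine hv.integrable_of_hasCompactSupport ?_
      exact HasCompactSupport.intro (isCompact_closedBall (0 : ℝ) R) fun y hy =>
        hz y (by simpa using hy)
    have e := integral_mul_second_deriv (h := fun y => χ n y * ψ τ y)
      (h₁ := fun y => χ₁ n y * ψ τ y + χ n y * ψ₁ τ y)
      (h₂ := fun y => (χ₂ n y * ψ τ y + χ₁ n y * ψ₁ τ y) + (χ₁ n y * ψ₁ τ y + χ n y * ψ₂ τ y))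
      (R := R) (hξ τ hτ) (hξ₁ τ hτ) (hξ₂ τ hτ)
      (fun y => (hχ n y).mul (hψ τ hτ y))
      (fun y => ((hχ₁ n y).mul (hψ τ hτ y)).add ((hχ n y).mul (hψ₁ τ hτ y)))
      (((hχ₂ n).mul (cψ τ hτ)).add ((cχ₁ n).mul (cψ₁ τ hτ)) |>.add
        (((cχ₁ n).mul (cψ₁ τ hτ)).add ((cχ n).mul (hψ₂ τ hτ))))
      (fun y hy => by
        obtain ⟨h0, h1, h2⟩ := hR y hy
        simp [h0, h1, h2])
    have i1 : Integrable fun y => ξ₂ τ y * (χ n y * ψ τ y) :=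
      key _ ((hξ₂ τ hτ).mul ((cχ n).mul (cψ τ hτ))) fun y hy => by simp [(hR y hy).1]
    have i2 : Integrable fun y => χ n y * S τ y :=
      key _ ((cχ n).mul (cS τ hτ)) fun y hy => by simp [(hR y hy).1]
    have i3 : Integrable fun y => ξ τ y * ((χ₂ n y * ψ τ y + χ₁ n y * ψ₁ τ y) +
        (χ₁ n y * ψ₁ τ y + χ n y * ψ₂ τ y)) :=
      key _ ((cξ τ hτ).mul (((hχ₂ n).mul (cψ τ hτ)).add ((cχ₁ n).mul (cψ₁ τ hτ)) |>.add
        (((cχ₁ n).mul (cψ₁ τ hτ)).add ((cχ n).mul (hψ₂ τ hτ))))) fun y hy => by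
          obtain ⟨h0, h1, h2⟩ := hR y hy
          simp [h0, h1, h2]
    calc H n τ = ∫ y, (ξ₂ τ y * (χ n y * ψ τ y) + χ n y * S τ y) := by
          simp only [hH]; congr 1; ext y; ring
      _ = _ := by
          rw [integral_add i1 i2, e, ← integral_add i3 i2]
          congr 1; ext y; ring
  -- uniform convergence of the derivatives
  set H' : ℝ → ℝ := fun τ => ∫ y, (ξ τ y * ψ₂ τ y + S τ y) with hH'
  set err : ℕ → ℝ := fun n => ∫ y, (2 * (1 - χ n y) + 3 * (C / (n + 1))) * K y with herr
  have hCn : ∀ n : ℕ, 0 ≤ C / ((n : ℝ) + 1) ∧ C / ((n : ℝ) + 1) ≤ C := by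
    intro n
    refine ⟨by positivity, div_le_self hC0 ?_⟩
    linarith [(Nat.cast_nonneg n : (0 : ℝ) ≤ n)]
  have hcoef : ∀ (n : ℕ) (y : ℝ), ‖2 * (1 - χ n y) + 3 * (C / (n + 1))‖ ≤ 2 + 3 * C := by
    intro n y
    have := h01 n y; have := hCn n
    rw [Real.norm_of_nonneg (by linarith)]; linarith
  have hKerr : ∀ n, Integrable fun y => (2 * (1 - χ n y) + 3 * (C / (n + 1))) * K y := by
    intro n
    refine hK.bdd_mul (c := 2 + 3 * C) ?_ (Eventually.of_forall (hcoef n))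
    have := cχ n
    exact Continuous.aestronglyMeasurable (by fun_prop)
  have herr0 : Tendsto err atTop (𝓝 0) := by
    have := tendsto_integral_of_dominated_convergence
      (F := fun (n : ℕ) y => (2 * (1 - χ n y) + 3 * (C / (n + 1))) * K y) (f := fun _ => (0 : ℝ))
      (μ := volume) (fun y => (2 + 3 * C) * ‖K y‖) (fun n => (hKerr n).aestronglyMeasurable)
      (hK.norm.const_mul _)
      (fun n => Eventually.of_forall fun y => by
        rw [norm_mul]; exact mul_le_mul_of_nonneg_right (hcoef n y) (norm_nonneg _))
      (Eventually.of_forall fun y => by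
        have h1 : Tendsto (fun n : ℕ => 3 * (C / ((n : ℝ) + 1)) * K y) atTop
            (𝓝 (3 * 0 * K y)) := by
          refine Tendsto.mul_const _ (Tendsto.const_mul _ ?_)
          have := (tendsto_one_div_add_atTop_nhds_zero_nat (𝕜 := ℝ)).const_mul C
          simpa only [mul_one_div, mul_zero] using this
        rw [mul_zero, zero_mul] at h1
        refine h1.congr' ?_
        filter_upwards [hone y] with n hn
        rw [hn]; ring)
    simpa [herr] using this
  have hdiff : ∀ n, ∀ τ ∈ Ioo 0 T, |H n τ - H' τ| ≤ err n := by
    intro n τ hτ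
    have j1 : Integrable fun y => ξ τ y * ψ₂ τ y :=
      hint ((cξ τ hτ).mul (hψ₂ τ hτ)) (hb₂ τ hτ)
    have j2 : Integrable (S τ) := hint (cS τ hτ) (hbS τ hτ)
    have j3 : Integrable fun y => ξ τ y * ψ₁ τ y :=
      hint ((cξ τ hτ).mul (cψ₁ τ hτ)) (hb₁ τ hτ)
    have j4 : Integrable fun y => ξ τ y * ψ τ y :=
      hint ((cξ τ hτ).mul (cψ τ hτ)) (hb τ hτ)
    have k1 : Integrable fun y => χ n y * (ξ τ y * ψ₂ τ y + S τ y) :=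
      (j1.add j2).bdd_mul (c := 1) (cχ n).aestronglyMeasurable (Eventually.of_forall fun y => by
        rw [Real.norm_of_nonneg (h01 n y).1]; exact (h01 n y).2)
    have k2 : Integrable fun y => 2 * χ₁ n y * (ξ τ y * ψ₁ τ y) :=
      j3.bdd_mul (c := 2 * (C / (n + 1))) ((cχ₁ n).const_mul 2).aestronglyMeasurable
        (Eventually.of_forall fun y => by
          rw [norm_mul, Real.norm_two]
          exact mul_le_mul_of_nonneg_left (hC₁ n y) (by norm_num))
    have k3 : Integrable fun y => χ₂ n y * (ξ τ y * ψ τ y) :=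
      j4.bdd_mul (c := C / (n + 1)) (hχ₂ n).aestronglyMeasurable
        (Eventually.of_forall fun y => hC₂ n y)
    have e0 : H n τ - H' τ = ∫ y, (χ n y * (ξ τ y * ψ₂ τ y + S τ y)
        + 2 * χ₁ n y * (ξ τ y * ψ₁ τ y) + χ₂ n y * (ξ τ y * ψ τ y)
        - (ξ τ y * ψ₂ τ y + S τ y)) := by
      rw [hIBP n τ hτ]
      exact (integral_sub ((k1.add k2).add k3) (j1.add j2)).symm
    rw [e0, ← Real.norm_eq_abs]
    refine norm_integral_le_of_norm_le (hKerr n) ?_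
    filter_upwards [hb τ hτ, hb₁ τ hτ, hb₂ τ hτ, hbS τ hτ] with y q0 q1 q2 q3
    have h0 := h01 n y
    have e : χ n y * (ξ τ y * ψ₂ τ y + S τ y) + 2 * χ₁ n y * (ξ τ y * ψ₁ τ y)
        + χ₂ n y * (ξ τ y * ψ τ y) - (ξ τ y * ψ₂ τ y + S τ y)
        = -((1 - χ n y) * (ξ τ y * ψ₂ τ y)) - (1 - χ n y) * S τ y
          + 2 * (χ₁ n y * (ξ τ y * ψ₁ τ y)) + χ₂ n y * (ξ τ y * ψ τ y) := by ring
    have hK0 : 0 ≤ K y := (abs_nonneg _).trans q0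
    have a1 : |(1 - χ n y) * (ξ τ y * ψ₂ τ y)| ≤ (1 - χ n y) * K y := by
      rw [abs_mul, abs_of_nonneg (by linarith : 0 ≤ 1 - χ n y)]
      exact mul_le_mul_of_nonneg_left q2 (by linarith)
    have a2 : |(1 - χ n y) * S τ y| ≤ (1 - χ n y) * K y := by
      rw [abs_mul, abs_of_nonneg (by linarith : 0 ≤ 1 - χ n y)]
      exact mul_le_mul_of_nonneg_left q3 (by linarith)
    have a3 : |χ₁ n y * (ξ τ y * ψ₁ τ y)| ≤ C / (n + 1) * K y := by
      rw [abs_mul]; exact mul_le_mul (hC₁ n y) q1 (abs_nonneg _) (hCn n).1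
    have a4 : |χ₂ n y * (ξ τ y * ψ τ y)| ≤ C / (n + 1) * K y := by
      rw [abs_mul]; exact mul_le_mul (hC₂ n y) q0 (abs_nonneg _) (hCn n).1
    change |χ n y * (ξ τ y * ψ₂ τ y + S τ y) + 2 * χ₁ n y * (ξ τ y * ψ₁ τ y)
        + χ₂ n y * (ξ τ y * ψ τ y) - (ξ τ y * ψ₂ τ y + S τ y)| ≤ _
    rw [e]
    have b1 := abs_le.1 a1; have b2 := abs_le.1 a2
    have b3 := abs_le.1 a3; have b4 := abs_le.1 a4
    rw [abs_le]; constructor <;> linarith [b1.1, b1.2, b2.1, b2.2, b3.1, b3.2, b4.1, b4.2]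
  have hunif : TendstoUniformlyOn H H' atTop (Ioo 0 T) := by
    rw [Metric.tendstoUniformlyOn_iff]
    intro ε hε
    filter_upwards [herr0.eventually_lt_const hε] with n hn τ hτ
    rw [dist_comm, Real.dist_eq]
    exact (hdiff n τ hτ).trans_lt hn
  have hpt : ∀ τ ∈ Ioo 0 T, Tendsto (fun n => G n τ) atTop (𝓝 0) := by
    intro τ hτ
    rw [← horth τ hτ]
    refine tendsto_integral_of_dominated_convergence K
      (fun n => ((cχ n).mul ((cξ τ hτ).mul (cψ τ hτ))).aestronglyMeasurable) hK ?_ ?_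
    · intro n
      filter_upwards [hb τ hτ] with y hy
      rw [norm_mul, Real.norm_of_nonneg (h01 n y).1]
      exact (mul_le_of_le_one_left (norm_nonneg _) (h01 n y).2).trans hy
    · refine Eventually.of_forall fun y => ?_
      refine tendsto_const_nhds.congr' ?_
      filter_upwards [hone y] with n hn
      rw [hn, one_mul]
  intro τ hτ
  have h1 : HasDerivAt (fun _ : ℝ => (0 : ℝ)) (H' τ) τ :=
    hasDerivAt_of_tendstoUniformlyOn isOpen_Ioo hunif
      (Eventually.of_forall fun n s hs => hGH n s hs) hpt hτ
  exact h1.unique (hasDerivAt_const τ 0)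

/-! ### Gaussian majorants -/

/-- The integrable majorant `(1 + y²)^m e^{-y²/8}`; since `a = 2c - 1/2 ≥ 1/4` for `c ≥ 3/8`, it
controls every polynomially growing multiple of `e^{-a y²/2}` uniformly in `c`. -/
def gaussWeight (m : ℕ) (y : ℝ) : ℝ := (1 + y ^ 2) ^ m * Real.exp (-(y ^ 2 / 8))

theorem gaussWeight_nonneg (m : ℕ) (y : ℝ) : 0 ≤ gaussWeight m y := by
  unfold gaussWeight; positivity

theorem gaussWeight_mono {m n : ℕ} (h : m ≤ n) (y : ℝ) : gaussWeight m y ≤ gaussWeight n y := by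
  unfold gaussWeight
  gcongr
  nlinarith [sq_nonneg y]

theorem integrable_gaussWeight (m : ℕ) : Integrable (gaussWeight m) := by
  have h : Integrable fun y : ℝ =>
      (m.factorial : ℝ) * 16 ^ m * Real.exp (1 / 16) * Real.exp (-(1 / 16) * y ^ 2) :=
    (integrable_exp_neg_mul_sq (by norm_num)).const_mul _
  refine h.mono' ?_ (Eventually.of_forall fun y => ?_)
  · exact Continuous.aestronglyMeasurable (by unfold gaussWeight; fun_prop)
  · rw [Real.norm_of_nonneg (gaussWeight_nonneg m y)]
    have h1 := Real.pow_div_factorial_le_exp ((1 + y ^ 2) / 16) (by positivity) m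
    rw [div_le_iff₀ (by positivity), div_pow, div_le_iff₀ (by positivity)] at h1
    have h2 : Real.exp ((1 + y ^ 2) / 16) * Real.exp (-(y ^ 2 / 8))
        = Real.exp (1 / 16) * Real.exp (-(1 / 16) * y ^ 2) := by
      rw [← Real.exp_add, ← Real.exp_add]; congr 1; ring
    calc gaussWeight m y
        ≤ Real.exp ((1 + y ^ 2) / 16) * m.factorial * 16 ^ m * Real.exp (-(y ^ 2 / 8)) :=
          mul_le_mul_of_nonneg_right h1 (Real.exp_pos _).le
      _ = m.factorial * 16 ^ m * (Real.exp ((1 + y ^ 2) / 16) * Real.exp (-(y ^ 2 / 8))) := by ring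
      _ = _ := by rw [h2]; ring

theorem integrable_of_le_gaussWeight {g : ℝ → ℝ} {C : ℝ} {m : ℕ} (hg : AEMeasurable g)
    (h : ∀ᵐ y, |g y| ≤ C * gaussWeight m y) : Integrable g :=
  ((integrable_gaussWeight m).const_mul C).mono' hg.aestronglyMeasurable h

theorem abs_integral_le_gaussWeight {g : ℝ → ℝ} {C : ℝ} {m : ℕ}
    (h : ∀ᵐ y, |g y| ≤ C * gaussWeight m y) : |∫ y, g y| ≤ C * ∫ y, gaussWeight m y := by
  rw [← integral_const_mul, ← Real.norm_eq_abs]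
  exact norm_integral_le_of_norm_le ((integrable_gaussWeight m).const_mul C) h

theorem integral_gaussWeight_nonneg (m : ℕ) : 0 ≤ ∫ y, gaussWeight m y :=
  integral_nonneg (gaussWeight_nonneg m)

theorem pow_mul_gaussWeight_le (j m : ℕ) (y : ℝ) :
    (y ^ 2) ^ j * gaussWeight m y ≤ gaussWeight (j + m) y := by
  have h : (y ^ 2) ^ j ≤ (1 + y ^ 2) ^ j := by gcongr; linarith
  calc (y ^ 2) ^ j * gaussWeight m y ≤ (1 + y ^ 2) ^ j * gaussWeight m y :=
        mul_le_mul_of_nonneg_right h (gaussWeight_nonneg _ _)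
    _ = _ := by unfold gaussWeight; rw [pow_add]; ring

/-! ### The profile and its moments -/

/-- The profile `V(y) = (2c / (p - 1 + b y²))^{1/(p-1)}`, so that `v_{abc} = V e^{-a y²/4}`. -/
def profile (p b c y : ℝ) : ℝ := (2 * c / (p - 1 + b * y ^ 2)) ^ (1 / (p - 1))

/-- `Q(y) = y² / (p - 1 + b y²)`. -/
def quot (p b y : ℝ) : ℝ := y ^ 2 / (p - 1 + b * y ^ 2)

/-- The Gaussian density `e^{-a y²/2}`, with `a = 2c - 1/2`. -/
def density (c y : ℝ) : ℝ := Real.exp (-((2 * c - 1 / 2) * y ^ 2 / 2))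

section
variable {p b c : ℝ}

theorem denom_pos (hp : 1 < p) (hb : 0 ≤ b) (y : ℝ) : 0 < p - 1 + b * y ^ 2 := by
  have : 0 ≤ b * y ^ 2 := by positivity
  linarith

theorem profile_pos (hp : 1 < p) (hb : 0 ≤ b) (hc : 0 < c) (y : ℝ) : 0 < profile p b c y :=
  Real.rpow_pos_of_pos (div_pos (by linarith) (denom_pos hp hb y)) _

theorem profile_le (hp : 1 < p) (hb : 0 ≤ b) (hc : 0 ≤ c) (hc1 : c ≤ 1) (y : ℝ) :
    profile p b c y ≤ (2 / (p - 1)) ^ (1 / (p - 1)) := by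
  have hD := denom_pos hp hb y
  have : 0 ≤ b * y ^ 2 := by positivity
  have hp1 : 0 < p - 1 := by linarith
  refine Real.rpow_le_rpow (by positivity) ?_ (by positivity)
  exact div_le_div₀ (by norm_num) (by linarith) hp1 (by linarith)

theorem profile_ge (hp : 1 < p) (hb : 0 ≤ b) (hb1 : b ≤ 1) (hc : 3 / 8 ≤ c) (y : ℝ) :
    (3 / 4 / (p - 1 + y ^ 2)) ^ (1 / (p - 1)) ≤ profile p b c y := by
  have hD := denom_pos hp hb y
  have hp1 : 0 < p - 1 := by linarith
  have : b * y ^ 2 ≤ y ^ 2 := mul_le_of_le_one_left (sq_nonneg y) hb1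
  refine Real.rpow_le_rpow (by positivity) ?_ (by positivity)
  exact div_le_div₀ (by linarith) (by linarith) hD (by linarith)

theorem profile_rpow (hp : 1 < p) (hb : 0 ≤ b) (hc : 0 ≤ c) (y : ℝ) :
    profile p b c y ^ (p - 1) = 2 * c / (p - 1 + b * y ^ 2) := by
  have hD := denom_pos hp hb y
  unfold profile
  rw [← Real.rpow_mul (by positivity), one_div_mul_cancel (by linarith), Real.rpow_one]

theorem continuous_profile (hp : 1 < p) (hb : 0 ≤ b) : Continuous (profile p b c) := by
  have hp1 : 0 < p - 1 := by linarith
  unfold profile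
  refine Continuous.rpow_const ?_ fun y => Or.inr (by positivity)
  exact continuous_const.div (by fun_prop) fun y => (denom_pos hp hb y).ne'

theorem quot_nonneg (hp : 1 < p) (hb : 0 ≤ b) (y : ℝ) : 0 ≤ quot p b y :=
  div_nonneg (sq_nonneg y) (denom_pos hp hb y).le

theorem quot_le (hp : 1 < p) (hb : 0 ≤ b) (y : ℝ) : quot p b y ≤ y ^ 2 / (p - 1) := by
  have : 0 ≤ b * y ^ 2 := by positivity
  exact div_le_div_of_nonneg_left (sq_nonneg y) (by linarith) (by linarith)

theorem continuous_quot (hp : 1 < p) (hb : 0 ≤ b) : Continuous (quot p b) :=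
  (by fun_prop : Continuous fun y : ℝ => y ^ 2).div (by fun_prop)
    fun y => (denom_pos hp hb y).ne'

theorem density_pos (c y : ℝ) : 0 < density c y := Real.exp_pos _

theorem continuous_density : Continuous (density c) := by unfold density; fun_prop

theorem density_le (hc : 3 / 8 ≤ c) (y : ℝ) : density c y ≤ gaussWeight 0 y := by
  unfold density gaussWeight
  rw [pow_zero, one_mul]
  exact Real.exp_le_exp.2 (by nlinarith [mul_nonneg (sub_nonneg.2 hc) (sq_nonneg y)])

theorem density_ge (hc : c ≤ 1) (y : ℝ) : Real.exp (-(3 / 4 * y ^ 2)) ≤ density c y :=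
  Real.exp_le_exp.2 (by nlinarith [mul_nonneg (sub_nonneg.2 hc) (sq_nonneg y)])

end

/-- The moment `W j k = ∫ y^{2j} Q^k V e^{-a y²/2} dy` of the profile. -/
def moment (p b c : ℝ) (j k : ℕ) : ℝ :=
  ∫ y, (y ^ 2) ^ j * quot p b y ^ k * profile p b c y * density c y

theorem abs_moment_integrand_le {p b c : ℝ} (hp : 1 < p) (hb : 0 ≤ b) (hc : 3 / 8 ≤ c)
    (hc1 : c ≤ 1) (j k : ℕ) (y : ℝ) :
    |(y ^ 2) ^ j * quot p b y ^ k * profile p b c y * density c y| ≤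
      (1 / (p - 1)) ^ k * (2 / (p - 1)) ^ (1 / (p - 1)) * gaussWeight (j + k) y := by
  have hp1 : 0 < p - 1 := by linarith
  have hV := profile_pos hp hb (by linarith : 0 < c) y
  have hQ := quot_nonneg hp hb y
  have hρ := density_pos c y
  have hV1 := profile_le hp hb (by linarith : 0 ≤ c) hc1 y
  have hQ1 : quot p b y ^ k ≤ (1 / (p - 1)) ^ k * (y ^ 2) ^ k := by
    rw [← mul_pow]
    refine pow_le_pow_left₀ hQ ?_ k
    rw [one_div_mul_eq_div]
    exact quot_le hp hb y
  rw [abs_of_nonneg (by positivity)]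
  calc (y ^ 2) ^ j * quot p b y ^ k * profile p b c y * density c y
      ≤ (y ^ 2) ^ j * ((1 / (p - 1)) ^ k * (y ^ 2) ^ k) * (2 / (p - 1)) ^ (1 / (p - 1))
          * gaussWeight 0 y := by
        have := density_le hc y
        gcongr
    _ = (1 / (p - 1)) ^ k * (2 / (p - 1)) ^ (1 / (p - 1)) *
          ((y ^ 2) ^ (j + k) * gaussWeight 0 y) := by rw [pow_add]; ring
    _ ≤ _ := by
        gcongr
        exact pow_mul_gaussWeight_le (j + k) 0 y

theorem integrable_moment {p b c : ℝ} (hp : 1 < p) (hb : 0 ≤ b) (hc : 3 / 8 ≤ c)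
    (hc1 : c ≤ 1) (j k : ℕ) :
    Integrable fun y => (y ^ 2) ^ j * quot p b y ^ k * profile p b c y * density c y := by
  refine integrable_of_le_gaussWeight (Continuous.aemeasurable ?_)
    (Eventually.of_forall fun y => abs_moment_integrand_le hp hb hc hc1 j k y)
  have h1 := continuous_quot hp hb
  have h2 : Continuous (profile p b c) := continuous_profile hp hb
  have h3 : Continuous (density c) := continuous_density
  fun_prop

theorem exists_abs_moment_le {p : ℝ} (hp : 1 < p) (j k : ℕ) :
    ∃ C : ℝ, ∀ b c : ℝ, 0 ≤ b → 3 / 8 ≤ c → c ≤ 1 → |moment p b c j k| ≤ C :=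
  ⟨_, fun _ _ hb hc hc1 => abs_integral_le_gaussWeight
    (Eventually.of_forall fun y => abs_moment_integrand_le hp hb hc hc1 j k y)⟩

theorem moment_nonneg {p b c : ℝ} (hp : 1 < p) (hb : 0 ≤ b) (hc : 0 < c) (j k : ℕ) :
    0 ≤ moment p b c j k :=
  integral_nonneg fun y => by
    have hV := profile_pos hp hb hc y
    have hQ := quot_nonneg hp hb y
    have hρ := density_pos c y
    change 0 ≤ (y ^ 2) ^ j * quot p b y ^ k * profile p b c y * density c y
    positivity

/-- A lower bound for `V e^{-a y²/2}`, uniform in the parameters. -/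
def lowerWeight (p y : ℝ) : ℝ :=
  (3 / 4 / (p - 1 + y ^ 2)) ^ (1 / (p - 1)) * Real.exp (-(3 / 4 * y ^ 2))

theorem lowerWeight_pos {p : ℝ} (hp : 1 < p) (y : ℝ) : 0 < lowerWeight p y := by
  have : 0 < p - 1 := by linarith
  unfold lowerWeight
  positivity

theorem lowerWeight_le {p b c : ℝ} (hp : 1 < p) (hb : 0 ≤ b) (hb1 : b ≤ 1) (hc : 3 / 8 ≤ c)
    (hc1 : c ≤ 1) (y : ℝ) : lowerWeight p y ≤ profile p b c y * density c y :=
  mul_le_mul (profile_ge hp hb hb1 hc y) (density_ge hc1 y) (Real.exp_pos _).le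
    (profile_pos hp hb (by linarith) y).le

theorem continuous_lowerWeight {p : ℝ} (hp : 1 < p) : Continuous (lowerWeight p) := by
  have hp1 : 0 < p - 1 := by linarith
  unfold lowerWeight
  refine Continuous.mul (Continuous.rpow_const ?_ fun y => Or.inr (by positivity)) (by fun_prop)
  exact continuous_const.div (by fun_prop) fun y => by positivity

theorem integrable_sub_sub {f₁ f₂ f₃ f₄ : ℝ → ℝ} (h₁ : Integrable f₁) (h₂ : Integrable f₂)
    (h₃ : Integrable f₃) (h₄ : Integrable f₄) (s k : ℝ) :
    Integrable fun y => f₁ y - s * f₂ y - k * (f₃ y - s * f₄ y) :=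
  (h₁.sub (h₂.const_mul s)).sub ((h₃.sub (h₄.const_mul s)).const_mul k)

theorem integral_sub_sub {f₁ f₂ f₃ f₄ : ℝ → ℝ} (h₁ : Integrable f₁) (h₂ : Integrable f₂)
    (h₃ : Integrable f₃) (h₄ : Integrable f₄) (s k : ℝ) :
    ∫ y, (f₁ y - s * f₂ y - k * (f₃ y - s * f₄ y)) =
      (∫ y, f₁ y) - s * (∫ y, f₂ y) - k * ((∫ y, f₃ y) - s * ∫ y, f₄ y) := by
  have h₁₂ : Integrable fun y => f₁ y - s * f₂ y := h₁.sub (h₂.const_mul s)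
  have h₃₄ : Integrable fun y => f₃ y - s * f₄ y := h₃.sub (h₄.const_mul s)
  rw [integral_sub h₁₂ (h₃₄.const_mul k), integral_sub h₁ (h₂.const_mul s), integral_const_mul,
    integral_const_mul, integral_sub h₃ (h₄.const_mul s), integral_const_mul]

/-- The Gram type determinant `W₀₀ W₁₁ - W₀₁ W₁₀` is bounded below: with `s = W₁₀ / W₀₀` it equals
`W₀₀ ∫ (y² - s) (Q(y) - Q(√s)) V e^{-a y²/2}`, and `Q` is an increasing function of `y²`. -/
theorem exists_det_lower_bound {p : ℝ} (hp : 1 < p) :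
    ∃ δ : ℝ, 0 < δ ∧ ∀ b c : ℝ, 0 ≤ b → b ≤ 1 → 3 / 8 ≤ c → c ≤ 1 →
      δ ≤ moment p b c 0 0 * moment p b c 1 1 - moment p b c 0 1 * moment p b c 1 0 := by
  have hp1 : 0 < p - 1 := by linarith
  obtain ⟨C, hC⟩ := exists_abs_moment_le hp 1 0
  have hm_int : Integrable (lowerWeight p) := by
    refine (integrable_moment (b := 0) (c := 1) hp le_rfl (by norm_num) le_rfl 0 0).mono'
      (continuous_lowerWeight hp).aestronglyMeasurable (Eventually.of_forall fun y => ?_)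
    rw [Real.norm_of_nonneg (lowerWeight_pos hp y).le]
    simpa using lowerWeight_le hp le_rfl zero_le_one (by norm_num) le_rfl y
  set m := ∫ y, lowerWeight p y with hm
  have hm_pos : 0 < m := by
    exact integral_pos_of_integrable_nonneg_nonzero (continuous_lowerWeight hp) hm_int
      (fun y => (lowerWeight_pos hp y).le) (lowerWeight_pos hp 0).ne'
  set S := |C| / m with hS
  have hS0 : 0 ≤ S := by positivity
  clear_value S m
  -- the part of the integrand with `y² > S` suffices
  set g : ℝ → ℝ := fun y => max (y ^ 2 - S) 0 ^ 2 * ((p - 1) / ((p - 1 + y ^ 2) * (p - 1 + S)))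
    * lowerWeight p y with hg
  have hg0 : ∀ y, 0 ≤ g y := fun y => by
    have := lowerWeight_pos hp y
    positivity
  have hg_cont : Continuous g := by
    have h1 := continuous_lowerWeight hp
    refine Continuous.mul (Continuous.mul (by fun_prop) ?_) h1
    refine continuous_const.div (by fun_prop) fun y => ?_
    have : 0 < (p - 1 + y ^ 2) * (p - 1 + S) := by positivity
    exact this.ne'
  have hmain : ∀ b c : ℝ, 0 ≤ b → b ≤ 1 → 3 / 8 ≤ c → c ≤ 1 → ∃ h : ℝ → ℝ, Integrable h ∧
      (∀ y, g y ≤ h y) ∧ m ≤ moment p b c 0 0 ∧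
      moment p b c 0 0 * moment p b c 1 1 - moment p b c 0 1 * moment p b c 1 0
        = moment p b c 0 0 * ∫ y, h y := by
    intro b c hb hb1 hc hc1
    have hc0 : 0 < c := by linarith
    have hW : m ≤ moment p b c 0 0 := by
      rw [hm]
      refine integral_mono hm_int (integrable_moment hp hb hc hc1 0 0) fun y => ?_
      simpa using lowerWeight_le hp hb hb1 hc hc1 y
    have hWpos : 0 < moment p b c 0 0 := hm_pos.trans_le hW
    set s := moment p b c 1 0 / moment p b c 0 0 with hs
    have hs0 : 0 ≤ s := div_nonneg (moment_nonneg hp hb hc0 1 0) hWpos.le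
    have hsS : s ≤ S := by
      rw [hS]
      exact div_le_div₀ (abs_nonneg _)
        ((le_abs_self _).trans ((hC b c hb hc hc1).trans (le_abs_self _))) hm_pos hW
    have hDs : 0 < p - 1 + b * s := by positivity
    have hexp : ∀ y : ℝ, (y ^ 2 - s) ^ 2 * ((p - 1) / ((p - 1 + b * y ^ 2) * (p - 1 + b * s)))
        * (profile p b c y * density c y)
        = (y ^ 2) ^ 1 * quot p b y ^ 1 * profile p b c y * density c y
          - s * ((y ^ 2) ^ 0 * quot p b y ^ 1 * profile p b c y * density c y)
          - s / (p - 1 + b * s) *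
            ((y ^ 2) ^ 1 * quot p b y ^ 0 * profile p b c y * density c y
              - s * ((y ^ 2) ^ 0 * quot p b y ^ 0 * profile p b c y * density c y)) := by
      intro y
      have hD := (denom_pos hp hb y).ne'
      have hDs' := hDs.ne'
      simp only [pow_zero, pow_one, quot]
      field_simp
      ring
    have i00 := integrable_moment hp hb hc hc1 0 0
    have i01 := integrable_moment hp hb hc hc1 0 1
    have i10 := integrable_moment hp hb hc hc1 1 0
    have i11 := integrable_moment hp hb hc hc1 1 1
    refine ⟨fun y => (y ^ 2 - s) ^ 2 * ((p - 1) / ((p - 1 + b * y ^ 2) * (p - 1 + b * s)))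
      * (profile p b c y * density c y), ?_, fun y => ?_, hW, ?_⟩
    · rw [funext hexp]
      exact integrable_sub_sub i11 i01 i10 i00 s _
    · have hD := denom_pos hp hb y
      have h1 : max (y ^ 2 - S) 0 ^ 2 ≤ (y ^ 2 - s) ^ 2 := by
        rcases le_total (y ^ 2 - S) 0 with h | h
        · rw [max_eq_right h]; nlinarith [sq_nonneg (y ^ 2 - s)]
        · rw [max_eq_left h]; exact pow_le_pow_left₀ h (by linarith) 2
      have h2 : (p - 1 + b * y ^ 2) * (p - 1 + b * s) ≤ (p - 1 + y ^ 2) * (p - 1 + S) := by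
        have : b * y ^ 2 ≤ y ^ 2 := mul_le_of_le_one_left (sq_nonneg y) hb1
        have : b * s ≤ S := (mul_le_of_le_one_left hs0 hb1).trans hsS
        gcongr
      have h3 := lowerWeight_le hp hb hb1 hc hc1 y
      have h4 := (lowerWeight_pos hp y).le
      simp only [hg]
      gcongr
    · rw [integral_congr_ae (Eventually.of_forall hexp), integral_sub_sub i11 i01 i10 i00]
      change _ = moment p b c 0 0 * (moment p b c 1 1 - s * moment p b c 0 1
        - s / (p - 1 + b * s) * (moment p b c 1 0 - s * moment p b c 0 0))
      rw [hs, div_mul_cancel₀ _ hWpos.ne']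
      field_simp
      ring
  have hg_int : Integrable g := by
    obtain ⟨h, hi, hgh, -, -⟩ := hmain 0 1 le_rfl zero_le_one (by norm_num) le_rfl
    refine hi.mono' hg_cont.aestronglyMeasurable (Eventually.of_forall fun y => ?_)
    rw [Real.norm_of_nonneg (hg0 y)]
    exact hgh y
  have hg_pos : 0 < ∫ y, g y := by
    refine integral_pos_of_integrable_nonneg_nonzero (x := S + 1) hg_cont hg_int hg0 ?_
    have h1 := lowerWeight_pos hp (S + 1)
    have h2 : 0 < (S + 1) ^ 2 - S := by nlinarith
    have h3 : 0 < max ((S + 1) ^ 2 - S) 0 := lt_max_of_lt_left h2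
    have h4 : 0 < g (S + 1) := by
      have h5 : 0 < (p - 1 + (S + 1) ^ 2) * (p - 1 + S) := by positivity
      exact mul_pos (mul_pos (pow_pos h3 2) (div_pos hp1 h5)) h1
    exact h4.ne'
  refine ⟨m * ∫ y, g y, by positivity, fun b c hb hb1 hc hc1 => ?_⟩
  obtain ⟨h, hi, hgh, hmW, he⟩ := hmain b c hb hb1 hc hc1
  rw [he]
  exact mul_le_mul hmW (integral_mono hg_int hi hgh) hg_pos.le (hm_pos.le.trans hmW)

/-! ### The nonlinearity -/

/-- The increment `|V + x|^{p-1} (V + x) - V^p` of the nonlinearity. -/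
def nonlin (p V x : ℝ) : ℝ := |V + x| ^ (p - 1) * (V + x) - V ^ p

theorem exists_abs_rpow_sub_le {q : ℝ} :
    ∃ L : ℝ, 0 ≤ L ∧ ∀ t : ℝ, |t| ≤ 1 / 2 → |(1 + t) ^ q - 1| ≤ L * |t| := by
  obtain ⟨L, hL⟩ := (isCompact_Icc (a := (1 / 2 : ℝ)) (b := 3 / 2)).exists_bound_of_continuousOn
    (f := fun s => q * s ^ (q - 1)) (continuousOn_const.mul
      (ContinuousOn.rpow_const continuousOn_id fun s hs => Or.inl (by
        have : 1 / 2 ≤ s := hs.1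
        exact (by linarith : (0 : ℝ) < s).ne')))
  refine ⟨L, (norm_nonneg _).trans (hL 1 (by norm_num)), fun t ht => ?_⟩
  have ht' := abs_le.1 ht
  have := (convex_Icc (1 / 2 : ℝ) (3 / 2)).norm_image_sub_le_of_norm_hasDerivWithin_le
    (f := fun s : ℝ => s ^ q) (f' := fun s => q * s ^ (q - 1)) (C := L) (x := 1) (y := 1 + t)
    (fun s hs => (Real.hasDerivAt_rpow_const (Or.inl (by
        have : 1 / 2 ≤ s := hs.1
        exact (by linarith : (0 : ℝ) < s).ne'))).hasDerivWithinAt) hL (by norm_num)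
    ⟨by linarith [ht'.1], by linarith [ht'.2]⟩
  simpa using this

/-- The second order remainder at `V = 1`, for small increments. Both bounds are Bernoulli's
inequality: the convex function `s ^ p` lies above its tangents at `1` and at `1 + t`. -/
theorem exists_abs_rpow_remainder_le {p : ℝ} (hp : 1 < p) :
    ∃ L : ℝ, 0 ≤ L ∧ ∀ t : ℝ, |t| ≤ 1 / 2 → |(1 + t) ^ p - 1 - p * t| ≤ L * t ^ 2 := by
  obtain ⟨L, hL0, hL⟩ := exists_abs_rpow_sub_le (q := p - 1)
  refine ⟨p * L, by positivity, fun t ht => ?_⟩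
  have ht' := abs_le.1 ht
  have h1 : 0 < 1 + t := by linarith [ht'.1]
  have lower : 1 + p * t ≤ (1 + t) ^ p := one_add_mul_self_le_rpow_one_add (by linarith) hp.le
  have upper : (1 + t) ^ p - p * t * (1 + t) ^ (p - 1) ≤ 1 := by
    have h2 : -1 ≤ -t / (1 + t) := by rw [le_div_iff₀ h1]; linarith
    have h3 := one_add_mul_self_le_rpow_one_add h2 hp.le
    have h4 : 1 + -t / (1 + t) = (1 + t)⁻¹ := by field_simp; ring
    rw [h4, Real.inv_rpow h1.le] at h3
    have h5 : 0 < (1 + t) ^ p := Real.rpow_pos_of_pos h1 p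
    have h6 := mul_le_mul_of_nonneg_right h3 h5.le
    rw [inv_mul_cancel₀ h5.ne'] at h6
    have h7 : (1 + t) ^ (p - 1) = (1 + t) ^ p / (1 + t) := by rw [Real.rpow_sub_one h1.ne']
    rw [h7]
    calc _ = (1 + p * (-t / (1 + t))) * (1 + t) ^ p := by ring
      _ ≤ 1 := h6
  have h8 := hL t ht
  have h9 : t * ((1 + t) ^ (p - 1) - 1) ≤ L * t ^ 2 := by
    calc _ ≤ |t * ((1 + t) ^ (p - 1) - 1)| := le_abs_self _
      _ ≤ |t| * (L * |t|) := by rw [abs_mul]; gcongr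
      _ = L * t ^ 2 := by rw [← sq_abs t]; ring
  have h10 : p * (t * ((1 + t) ^ (p - 1) - 1)) ≤ p * (L * t ^ 2) := by gcongr
  rw [abs_of_nonneg (by linarith)]
  linarith

/-- The nonlinearity minus its linearization at `V > 0` is `O(x² + |x|^p)`, locally uniformly in
`V ≥ 0`; for `p < 2` the quadratic term is not needed, which compensates for `V` being small. -/
theorem exists_abs_nonlin_sub_le {p : ℝ} (hp : 1 < p) (Vm : ℝ) :
    ∃ C : ℝ, 0 ≤ C ∧ ∀ V x : ℝ, 0 < V → V ≤ Vm →
      |nonlin p V x - p * V ^ (p - 1) * x| ≤ C * (x ^ 2 + |x| ^ p) := by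
  obtain ⟨L, hL0, hL⟩ := exists_abs_rpow_remainder_le hp
  set C₁ : ℝ := 3 ^ p + 2 ^ p + p * 2 ^ (p - 1) with hC₁
  have hC₁0 : 0 ≤ C₁ := by positivity
  refine ⟨L * |Vm| ^ (p - 2) + L + C₁, by positivity, fun V x hV hVm => ?_⟩
  have hVm0 : |Vm| = Vm := abs_of_pos (hV.trans_le hVm)
  set t := x / V with ht
  have hx : x = V * t := by rw [ht]; field_simp
  have hVp : 0 < V ^ p := Real.rpow_pos_of_pos hV p
  have hVp1 : V ^ (p - 1) * V = V ^ p := by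
    rw [← Real.rpow_add_one hV.ne']; congr 1; ring
  have habs : |x| ^ p = V ^ p * |t| ^ p := by
    rw [hx, abs_mul, abs_of_pos hV, Real.mul_rpow hV.le (abs_nonneg t)]
  have hx2 : 0 ≤ x ^ 2 := sq_nonneg x
  have hxp : 0 ≤ |x| ^ p := by positivity
  have hfac : nonlin p V x - p * V ^ (p - 1) * x
      = V ^ p * (|1 + t| ^ (p - 1) * (1 + t) - 1 - p * t) := by
    have : V + x = V * (1 + t) := by rw [hx]; ring
    unfold nonlin
    rw [this, abs_mul, abs_of_pos hV, Real.mul_rpow hV.le (abs_nonneg _), hx]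
    calc _ = (V ^ (p - 1) * V) * (|1 + t| ^ (p - 1) * (1 + t)) - V ^ p
          - p * (V ^ (p - 1) * V) * t := by ring
      _ = _ := by rw [hVp1]; ring
  rw [hfac, abs_mul, abs_of_pos hVp]
  rcases le_total |t| (1 / 2) with h | h
  · have h1 : 0 < 1 + t := by linarith [(abs_le.1 h).1]
    have h2 : |1 + t| ^ (p - 1) * (1 + t) = (1 + t) ^ p := by
      rw [abs_of_pos h1, ← Real.rpow_add_one h1.ne']; congr 1; ring
    rw [h2]
    have h3 := mul_le_mul_of_nonneg_left (hL t h) hVp.le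
    refine h3.trans ?_
    rcases le_total 2 p with hp2 | hp2
    · have h4 : V ^ p * t ^ 2 ≤ |Vm| ^ (p - 2) * x ^ 2 := by
        have : V ^ p = V ^ (p - 2) * V ^ 2 := by
          rw [← Real.rpow_natCast V 2, ← Real.rpow_add hV]; congr 1; push_cast; ring
        calc V ^ p * t ^ 2 = V ^ (p - 2) * x ^ 2 := by rw [this, hx]; ring
          _ ≤ _ := by
            rw [hVm0]
            gcongr
      have h5 : L * (V ^ p * t ^ 2) ≤ L * (|Vm| ^ (p - 2) * x ^ 2) := by gcongr
      have h6 : 0 ≤ L * |Vm| ^ (p - 2) * |x| ^ p := by positivity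
      have h7 : 0 ≤ (L + C₁) * (x ^ 2 + |x| ^ p) := by positivity
      nlinarith
    · have h4 : V ^ p * t ^ 2 ≤ |x| ^ p := by
        rw [habs]
        gcongr
        rw [← sq_abs, ← Real.rpow_natCast |t| 2]
        rcases eq_or_lt_of_le (abs_nonneg t) with h0 | h0
        · rw [← h0, Real.zero_rpow (by norm_num), Real.zero_rpow (by linarith)]
        · exact Real.rpow_le_rpow_of_exponent_ge h0 (by linarith) (by push_cast; exact hp2)
      have h5 : L * (V ^ p * t ^ 2) ≤ L * |x| ^ p := by gcongr
      have h6 : 0 ≤ (L * |Vm| ^ (p - 2) + C₁) * (x ^ 2 + |x| ^ p) := by positivity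
      have h7 : 0 ≤ L * x ^ 2 := by positivity
      nlinarith
  · have ht0 : 0 < |t| := by linarith
    have h1 : |(|1 + t| ^ (p - 1) * (1 + t) - 1 - p * t)| ≤ C₁ * |t| ^ p := by
      have e1 : |(|1 + t| ^ (p - 1) * (1 + t))| ≤ 3 ^ p * |t| ^ p := by
        have e2 : |1 + t| ≤ 3 * |t| := (abs_add_le 1 t).trans (by rw [abs_one]; linarith)
        rw [← Real.mul_rpow (by norm_num) (abs_nonneg t), abs_mul,
          abs_of_nonneg (Real.rpow_nonneg (abs_nonneg _) _)]
        calc |1 + t| ^ (p - 1) * |1 + t| ≤ (3 * |t|) ^ (p - 1) * (3 * |t|) := by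
              gcongr
          _ = (3 * |t|) ^ p := by
              rw [← Real.rpow_add_one (by positivity)]; congr 1; ring
      have e3 : (1 : ℝ) ≤ 2 ^ p * |t| ^ p := by
        rw [← Real.mul_rpow (by norm_num) (abs_nonneg t)]
        exact Real.one_le_rpow (by linarith) (by linarith)
      have e4 : |p * t| ≤ p * 2 ^ (p - 1) * |t| ^ p := by
        have e5 : (1 : ℝ) ≤ 2 ^ (p - 1) * |t| ^ (p - 1) := by
          rw [← Real.mul_rpow (by norm_num) (abs_nonneg t)]
          exact Real.one_le_rpow (by linarith) (by linarith)
        have e6 : |t| ^ p = |t| ^ (p - 1) * |t| := by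
          rw [← Real.rpow_add_one ht0.ne']; congr 1; ring
        rw [abs_mul, abs_of_pos (by linarith : 0 < p), e6]
        have e7 : p * |t| * 1 ≤ p * |t| * (2 ^ (p - 1) * |t| ^ (p - 1)) := by gcongr
        linarith
      have := abs_le.1 e1
      have := abs_le.1 e4
      rw [abs_le, hC₁]
      constructor <;> nlinarith
    calc _ ≤ V ^ p * (C₁ * |t| ^ p) := by gcongr
      _ = C₁ * |x| ^ p := by rw [habs]; ring
      _ ≤ _ := by
        have h6 : 0 ≤ (L * |Vm| ^ (p - 2) + L) * (x ^ 2 + |x| ^ p) := by positivity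
        have h7 : 0 ≤ C₁ * x ^ 2 := by positivity
        nlinarith

/-! ### The remainder functionals -/

/-- The Gaussian moments `∫ y^{2j} (|V+η|^{p-1}(V+η) - V^p) e^{-a y²/2} dy` of the increment of
the nonlinearity, where `η = e^{a y²/4} f` and `a = 2c - 1/2`. -/
def nonlinMoment (p : ℝ) (f : ℝ → ℝ) (b c : ℝ) (j : ℕ) : ℝ :=
  ∫ y, (y ^ 2) ^ j *
    nonlin p (profile p b c y) (Real.exp ((2 * c - 1 / 2) / 4 * y ^ 2) * f y) * density c y

/-- `∫ y⁴ f e^{-a y²/4} dy` with `a = 2c - 1/2`: it enters because the test function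
`y² e^{-a y²/4}` moves with `a`. -/
def quarticMoment (f : ℝ → ℝ) (c : ℝ) : ℝ := ∫ y, y ^ 4 * (f y * phi0 (2 * c - 1 / 2) y)

/-- Right-hand side of the equation obtained by projecting on `e^{-a y²/4}`. -/
def sysRhs₀ (p : ℝ) (f : ℝ → ℝ) (b c : ℝ) : ℝ :=
  (p - 1) * nonlinMoment p f b c 0 - 4 * p / (p - 1) ^ 2 * b ^ 3 * moment p b c 0 2

/-- Right-hand side of the equation obtained by projecting on `y² e^{-a y²/4}`. -/
def sysRhs₁ (p : ℝ) (f : ℝ → ℝ) (b c : ℝ) : ℝ :=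
  (p - 1) * nonlinMoment p f b c 1 - 4 * p / (p - 1) ^ 2 * b ^ 3 * moment p b c 1 2
    + (p - 1) * c * (2 * c - 1 + 2 * b / (p - 1)) * quarticMoment f c

/-- Determinant of the linear system
`W₀₀ X - W₀₁ Y = sysRhs₀`, `(W₁₀ + (p-1) c h) X - W₁₁ Y = sysRhs₁`, `h = quarticMoment f c`,
which the remainders `X = R_c` and `Y = R_b` have to satisfy. -/
def sysDet (p : ℝ) (f : ℝ → ℝ) (b c : ℝ) : ℝ :=
  moment p b c 0 1 * (moment p b c 1 0 + (p - 1) * c * quarticMoment f c)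
    - moment p b c 0 0 * moment p b c 1 1

/-- The remainder `R_b(f, b, c)`, by Cramer's rule. The Gaussian moments make sense only for
`a = 2c - 1/2 > 0` and are not uniformly bounded as `a → 0`, so they are used for `c ≥ 3/8`;
along the solutions considered `c` is close to `1/2`. -/
def remainderB (p : ℝ) (f : ℝ → ℝ) (b c : ℝ) : ℝ :=
  if 3 / 8 ≤ c then
    (moment p b c 0 0 * sysRhs₁ p f b c
      - (moment p b c 1 0 + (p - 1) * c * quarticMoment f c) * sysRhs₀ p f b c) / sysDet p f b c
  else 0

/-- The remainder `R_c(f, b, c)`, by Cramer's rule; see `remainderB`. -/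
def remainderC (p : ℝ) (f : ℝ → ℝ) (b c : ℝ) : ℝ :=
  if 3 / 8 ≤ c then
    (moment p b c 0 1 * sysRhs₁ p f b c - moment p b c 1 1 * sysRhs₀ p f b c) / sysDet p f b c
  else 0

theorem eq_remainder_of_system {p : ℝ} {f : ℝ → ℝ} {b c X Y : ℝ} (hc : 3 / 8 ≤ c)
    (hdet : sysDet p f b c ≠ 0)
    (h₀ : moment p b c 0 0 * X - moment p b c 0 1 * Y = sysRhs₀ p f b c)
    (h₁ : (moment p b c 1 0 + (p - 1) * c * quarticMoment f c) * X - moment p b c 1 1 * Y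
      = sysRhs₁ p f b c) :
    X = remainderC p f b c ∧ Y = remainderB p f b c := by
  unfold remainderB remainderC
  rw [if_pos hc, if_pos hc, eq_div_iff hdet, eq_div_iff hdet, ← h₀, ← h₁]
  unfold sysDet
  constructor <;> ring

/-- `f` is a perturbation of weighted size `M`: `|e^{a y²/4} f| ≤ M (1 + y²)²` with
`a = 2c - 1/2`. -/
structure IsPerturbation (c M : ℝ) (f : ℝ → ℝ) : Prop where
  aemeasurable : AEMeasurable f
  bound : ∀ᵐ y, |Real.exp ((2 * c - 1 / 2) / 4 * y ^ 2) * f y| ≤ M * (1 + y ^ 2) ^ 2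

theorem mul_phi0_eq (c y z : ℝ) :
    z * phi0 (2 * c - 1 / 2) y = Real.exp ((2 * c - 1 / 2) / 4 * y ^ 2) * z * density c y := by
  have : phi0 (2 * c - 1 / 2) y = Real.exp ((2 * c - 1 / 2) / 4 * y ^ 2) * density c y := by
    unfold phi0 density
    rw [← Real.exp_add]; congr 1; ring
  rw [this]; ring

section
variable {p b c M : ℝ} {f : ℝ → ℝ}

theorem IsPerturbation.abs_mul_phi0_le (hf : IsPerturbation c M f) (hc : 3 / 8 ≤ c) (j : ℕ) :
    ∀ᵐ y, |(y ^ 2) ^ j * (f y * phi0 (2 * c - 1 / 2) y)| ≤ M * gaussWeight (j + 2) y := by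
  filter_upwards [hf.bound] with y hy
  have hM : 0 ≤ M * (1 + y ^ 2) ^ 2 := (abs_nonneg _).trans hy
  rw [mul_phi0_eq, abs_mul, abs_mul _ (density c y), abs_of_pos (density_pos c y),
    abs_of_nonneg (by positivity : 0 ≤ (y ^ 2) ^ j)]
  have h2 := pow_mul_gaussWeight_le j 2 y
  have hM0 : 0 ≤ M := nonneg_of_mul_nonneg_left hM (by positivity)
  calc _ ≤ (y ^ 2) ^ j * (M * (1 + y ^ 2) ^ 2 * gaussWeight 0 y) := by
        have := density_le hc y
        have := (density_pos c y).le
        gcongr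
    _ = M * ((y ^ 2) ^ j * gaussWeight 2 y) := by unfold gaussWeight; ring
    _ ≤ _ := by gcongr

theorem IsPerturbation.aemeasurable_mul_phi0 (hf : IsPerturbation c M f) (j : ℕ) :
    AEMeasurable fun y => (y ^ 2) ^ j * (f y * phi0 (2 * c - 1 / 2) y) := by
  have h := hf.aemeasurable
  have : Measurable (phi0 (2 * c - 1 / 2)) :=
    Continuous.measurable (by unfold phi0; fun_prop)
  fun_prop

theorem IsPerturbation.integrable_mul_phi0 (hf : IsPerturbation c M f) (hc : 3 / 8 ≤ c) (j : ℕ) :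
    Integrable fun y => (y ^ 2) ^ j * (f y * phi0 (2 * c - 1 / 2) y) :=
  integrable_of_le_gaussWeight (hf.aemeasurable_mul_phi0 j) (hf.abs_mul_phi0_le hc j)

theorem IsPerturbation.nonneg (hf : IsPerturbation c M f) : 0 ≤ M := by
  obtain ⟨y, hy⟩ := hf.bound.exists
  exact nonneg_of_mul_nonneg_left ((abs_nonneg _).trans hy) (by positivity)

theorem exists_abs_quarticMoment_le : ∃ C : ℝ, 0 ≤ C ∧ ∀ (c M : ℝ) (f : ℝ → ℝ), 3 / 8 ≤ c →
    IsPerturbation c M f → |quarticMoment f c| ≤ C * M := by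
  refine ⟨_, integral_gaussWeight_nonneg (2 + 2), fun c M f hc hf => ?_⟩
  rw [mul_comm]
  refine abs_integral_le_gaussWeight ?_
  filter_upwards [hf.abs_mul_phi0_le hc 2] with y hy
  rwa [← pow_mul] at hy

theorem aemeasurable_nonlinMoment_integrand (hp : 1 < p) (hb : 0 ≤ b)
    (hf : AEMeasurable f) (j : ℕ) :
    AEMeasurable fun y => (y ^ 2) ^ j *
      nonlin p (profile p b c y) (Real.exp ((2 * c - 1 / 2) / 4 * y ^ 2) * f y) * density c y := by
  have h1 : Measurable (profile p b c) := (continuous_profile hp hb).measurable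
  have h2 : Measurable (density c) := continuous_density.measurable
  unfold nonlin
  fun_prop

/-- The linear part `p V^{p-1} η` of the increment contributes only `O(b M)` to the moments, as
`V^{p-1} = 2c/(p-1) (1 - b Q)` and `η` is orthogonal to `1` and `y²`. -/
theorem exists_abs_nonlinMoment_le (hp : 1 < p) (j : ℕ) :
    ∃ C : ℝ, 0 ≤ C ∧ ∀ (b c M : ℝ) (f : ℝ → ℝ), 0 ≤ b → 3 / 8 ≤ c → c ≤ 1 →
      IsPerturbation c M f →
      ∫ y, (y ^ 2) ^ j * (f y * phi0 (2 * c - 1 / 2) y) = 0 →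
      (Integrable fun y => (y ^ 2) ^ j * nonlin p (profile p b c y)
        (Real.exp ((2 * c - 1 / 2) / 4 * y ^ 2) * f y) * density c y) ∧
      |nonlinMoment p f b c j| ≤ C * (b * M + M ^ 2 + M ^ p) := by
  have hp1 : 0 < p - 1 := by linarith
  obtain ⟨C₁, hC₁, hN⟩ := exists_abs_nonlin_sub_le hp ((2 / (p - 1)) ^ (1 / (p - 1)))
  obtain ⟨n, hn⟩ := exists_nat_ge (2 * p)
  set m := j + (n + 4) with hm
  set C₂ : ℝ := p * 2 / (p - 1) ^ 2 with hC₂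
  have hC₂0 : 0 ≤ C₂ := by positivity
  refine ⟨(C₁ + C₂) * ∫ y, gaussWeight m y,
    mul_nonneg (by positivity) (integral_gaussWeight_nonneg m),
    fun b c M f hb hc hc1 hf horth => ?_⟩
  have hM := hf.nonneg
  have hMp : 0 ≤ M ^ p := Real.rpow_nonneg hM p
  set g : ℝ → ℝ := fun y => (y ^ 2) ^ j * nonlin p (profile p b c y)
    (Real.exp ((2 * c - 1 / 2) / 4 * y ^ 2) * f y) * density c y with hg
  have hgm : AEMeasurable g := aemeasurable_nonlinMoment_integrand hp hb hf.aemeasurable j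
  -- subtracting the part of the linear term that integrates to zero
  set k : ℝ := p * (2 * c) / (p - 1) with hk
  have hbound : ∀ᵐ y, |g y - k * ((y ^ 2) ^ j * (f y * phi0 (2 * c - 1 / 2) y))| ≤
      (C₁ + C₂) * (b * M + M ^ 2 + M ^ p) * gaussWeight m y := by
    filter_upwards [hf.bound] with y hy
    set x := Real.exp ((2 * c - 1 / 2) / 4 * y ^ 2) * f y with hx
    set V := profile p b c y with hV
    have hVpos : 0 < V := profile_pos hp hb (by linarith) y
    have hVle := profile_le hp hb (by linarith : 0 ≤ c) hc1 y
    have hD := denom_pos hp hb y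
    have hρ := density_pos c y
    have hVp : V ^ (p - 1) = 2 * c / (p - 1) - 2 * c / (p - 1) * b * quot p b y := by
      rw [hV, profile_rpow hp hb (by linarith)]
      unfold quot
      field_simp
      ring
    have e : g y - k * ((y ^ 2) ^ j * (f y * phi0 (2 * c - 1 / 2) y))
        = (y ^ 2) ^ j * ((nonlin p V x - p * V ^ (p - 1) * x)
            - p * (2 * c / (p - 1)) * b * quot p b y * x) * density c y := by
      rw [mul_phi0_eq, hVp, hk]
      simp only [hg]
      ring
    have hy1 : (1 : ℝ) ≤ 1 + y ^ 2 := by nlinarith [sq_nonneg y]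
    have b1 : |nonlin p V x - p * V ^ (p - 1) * x| ≤
        C₁ * ((M ^ 2 + M ^ p) * (1 + y ^ 2) ^ (n + 4)) := by
      refine (hN V x hVpos hVle).trans (mul_le_mul_of_nonneg_left ?_ hC₁)
      have s1 : x ^ 2 ≤ M ^ 2 * (1 + y ^ 2) ^ (n + 4) := by
        calc x ^ 2 = |x| ^ 2 := (sq_abs x).symm
          _ ≤ (M * (1 + y ^ 2) ^ 2) ^ 2 := by gcongr
          _ = M ^ 2 * (1 + y ^ 2) ^ 4 := by ring
          _ ≤ _ := by gcongr; omega
      have s2 : |x| ^ p ≤ M ^ p * (1 + y ^ 2) ^ (n + 4) := by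
        calc |x| ^ p ≤ (M * (1 + y ^ 2) ^ 2) ^ p := by gcongr
          _ = M ^ p * (1 + y ^ 2) ^ (2 * p) := by
            rw [Real.mul_rpow hM (by positivity), ← Real.rpow_natCast (1 + y ^ 2) 2,
              ← Real.rpow_mul (by positivity)]
            norm_num
          _ ≤ M ^ p * (1 + y ^ 2) ^ ((n + 4 : ℕ) : ℝ) := by
            gcongr
            push_cast; linarith
          _ = _ := by rw [Real.rpow_natCast]
      linarith
    have b2 : |p * (2 * c / (p - 1)) * b * quot p b y * x| ≤
        C₂ * (b * M * (1 + y ^ 2) ^ (n + 4)) := by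
      have hQ := quot_nonneg hp hb y
      have hQ1 := quot_le hp hb y
      rw [abs_mul, abs_of_nonneg (by positivity)]
      calc p * (2 * c / (p - 1)) * b * quot p b y * |x|
          ≤ p * (2 * 1 / (p - 1)) * b * ((1 + y ^ 2) / (p - 1)) * (M * (1 + y ^ 2) ^ 2) := by
            have : quot p b y ≤ (1 + y ^ 2) / (p - 1) :=
              hQ1.trans (div_le_div_of_nonneg_right (by linarith) hp1.le)
            gcongr
        _ = C₂ * (b * M * (1 + y ^ 2) ^ 3) := by rw [hC₂]; field_simp
        _ ≤ _ := by gcongr; omega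
    have b3 : |(nonlin p V x - p * V ^ (p - 1) * x)
            - p * (2 * c / (p - 1)) * b * quot p b y * x| ≤
        (C₁ + C₂) * (b * M + M ^ 2 + M ^ p) * (1 + y ^ 2) ^ (n + 4) := by
      refine (abs_sub _ _).trans ((add_le_add b1 b2).trans ?_)
      have q1 : 0 ≤ C₁ * (b * M) * (1 + y ^ 2) ^ (n + 4) := by positivity
      have q2 : 0 ≤ C₂ * (M ^ 2 + M ^ p) * (1 + y ^ 2) ^ (n + 4) := by positivity
      nlinarith
    rw [e, abs_mul, abs_of_pos hρ, abs_mul, abs_of_nonneg (by positivity : 0 ≤ (y ^ 2) ^ j)]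
    calc _ ≤ (y ^ 2) ^ j * ((C₁ + C₂) * (b * M + M ^ 2 + M ^ p) * (1 + y ^ 2) ^ (n + 4))
          * gaussWeight 0 y := by
          have := density_le hc y
          gcongr
      _ = (C₁ + C₂) * (b * M + M ^ 2 + M ^ p) * ((y ^ 2) ^ j * gaussWeight (n + 4) y) := by
          unfold gaussWeight; ring
      _ ≤ _ := by
          gcongr
          exact pow_mul_gaussWeight_le j (n + 4) y
  have i0 := hf.integrable_mul_phi0 hc j
  have i1 : Integrable fun y => g y - k * ((y ^ 2) ^ j * (f y * phi0 (2 * c - 1 / 2) y)) :=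
    integrable_of_le_gaussWeight (hgm.sub (i0.aemeasurable.const_mul k)) hbound
  have i2 : Integrable g := by
    refine (i1.add (i0.const_mul k)).congr (Eventually.of_forall fun y => ?_)
    simp
  refine ⟨i2, ?_⟩
  have e : nonlinMoment p f b c j
      = ∫ y, (g y - k * ((y ^ 2) ^ j * (f y * phi0 (2 * c - 1 / 2) y))) := by
    rw [integral_sub i2 (i0.const_mul k), integral_const_mul, horth, mul_zero, sub_zero]
    rfl
  rw [e]
  refine (abs_integral_le_gaussWeight hbound).trans (le_of_eq ?_)
  ring

/-- The size of the remainders in terms of the size `M` of the perturbation. -/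
theorem exists_abs_remainder_le (hp : 1 < p) :
    ∃ M₀ C : ℝ, 0 < M₀ ∧ 0 ≤ C ∧ ∀ (b c M : ℝ) (f : ℝ → ℝ), 0 ≤ b → b ≤ 1 → 3 / 8 ≤ c → c ≤ 1 →
      IsPerturbation c M f → M ≤ M₀ →
      ∫ y, f y * phi0 (2 * c - 1 / 2) y = 0 →
      ∫ y, y ^ 2 * (f y * phi0 (2 * c - 1 / 2) y) = 0 →
      sysDet p f b c ≠ 0 ∧
      |remainderB p f b c| ≤
        C * (b ^ 3 + b * M + M ^ 2 + M ^ p + |2 * c - 1 + 2 * b / (p - 1)| * M) ∧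
      |remainderC p f b c| ≤
        C * (b ^ 3 + b * M + M ^ 2 + M ^ p + |2 * c - 1 + 2 * b / (p - 1)| * M) := by
  have hp1 : 0 < p - 1 := by linarith
  obtain ⟨δ, hδ, hdet⟩ := exists_det_lower_bound hp
  obtain ⟨A₀₀, h00⟩ := exists_abs_moment_le hp 0 0
  obtain ⟨A₀₁, h01⟩ := exists_abs_moment_le hp 0 1
  obtain ⟨A₁₀, h10⟩ := exists_abs_moment_le hp 1 0
  obtain ⟨A₁₁, h11⟩ := exists_abs_moment_le hp 1 1
  obtain ⟨A₀₂, h02⟩ := exists_abs_moment_le hp 0 2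
  obtain ⟨A₁₂, h12⟩ := exists_abs_moment_le hp 1 2
  obtain ⟨H, hH0, hH⟩ := exists_abs_quarticMoment_le
  obtain ⟨N₀, hN₀0, hN₀⟩ := exists_abs_nonlinMoment_le hp 0
  obtain ⟨N₁, hN₁0, hN₁⟩ := exists_abs_nonlinMoment_le hp 1
  -- one constant for all the moments
  set A : ℝ := |A₀₀| + |A₀₁| + |A₁₀| + |A₁₁| + |A₀₂| + |A₁₂| with hA
  have hA0 : 0 ≤ A := by positivity
  set B : ℝ := (p - 1) * (N₀ + N₁ + H) + 4 * p / (p - 1) ^ 2 * A with hB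
  have hB0 : 0 ≤ B := by positivity
  set M₀ : ℝ := δ / (2 * ((p - 1) * A * H + 1)) with hM₀
  have hden : 0 < 2 * ((p - 1) * A * H + 1) := by positivity
  set K : ℝ := A + (p - 1) * H * M₀ with hK
  have hM₀0 : 0 < M₀ := by positivity
  have hK0 : 0 ≤ K := by positivity
  refine ⟨M₀, (A + K) * B * (2 / δ), hM₀0, by positivity, ?_⟩
  intro b c M f hb hb1 hc hc1 hf hMM h0 h2
  have hM := hf.nonneg
  have hMp : 0 ≤ M ^ p := Real.rpow_nonneg hM p
  have hc0 : 0 ≤ c := by linarith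
  have w00 : |moment p b c 0 0| ≤ A := (h00 b c hb hc hc1).trans (by
    rw [hA]; linarith [le_abs_self A₀₀, abs_nonneg A₀₁, abs_nonneg A₁₀, abs_nonneg A₁₁,
      abs_nonneg A₀₂, abs_nonneg A₁₂])
  have w01 : |moment p b c 0 1| ≤ A := (h01 b c hb hc hc1).trans (by
    rw [hA]; linarith [le_abs_self A₀₁, abs_nonneg A₀₀, abs_nonneg A₁₀, abs_nonneg A₁₁,
      abs_nonneg A₀₂, abs_nonneg A₁₂])
  have w10 : |moment p b c 1 0| ≤ A := (h10 b c hb hc hc1).trans (by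
    rw [hA]; linarith [le_abs_self A₁₀, abs_nonneg A₀₀, abs_nonneg A₀₁, abs_nonneg A₁₁,
      abs_nonneg A₀₂, abs_nonneg A₁₂])
  have w11 : |moment p b c 1 1| ≤ A := (h11 b c hb hc hc1).trans (by
    rw [hA]; linarith [le_abs_self A₁₁, abs_nonneg A₀₀, abs_nonneg A₀₁, abs_nonneg A₁₀,
      abs_nonneg A₀₂, abs_nonneg A₁₂])
  have w02 : |moment p b c 0 2| ≤ A := (h02 b c hb hc hc1).trans (by
    rw [hA]; linarith [le_abs_self A₀₂, abs_nonneg A₀₀, abs_nonneg A₀₁, abs_nonneg A₁₀,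
      abs_nonneg A₁₁, abs_nonneg A₁₂])
  have w12 : |moment p b c 1 2| ≤ A := (h12 b c hb hc hc1).trans (by
    rw [hA]; linarith [le_abs_self A₁₂, abs_nonneg A₀₀, abs_nonneg A₀₁, abs_nonneg A₁₀,
      abs_nonneg A₁₁, abs_nonneg A₀₂])
  have hq := hH c M f hc hf
  have n0 := (hN₀ b c M f hb hc hc1 hf (by simpa using h0)).2
  have n1 := (hN₁ b c M f hb hc hc1 hf (by simpa using h2)).2
  set ω := |2 * c - 1 + 2 * b / (p - 1)| with hω
  have hω0 : 0 ≤ ω := abs_nonneg _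
  set E := b ^ 3 + b * M + M ^ 2 + M ^ p + ω * M with hE
  have hE1 : b * M + M ^ 2 + M ^ p ≤ E := by
    have : 0 ≤ b ^ 3 := by positivity
    have : 0 ≤ ω * M := by positivity
    linarith
  have hE0 : 0 ≤ E := by positivity
  have hbE : b ^ 3 ≤ E := by
    have : 0 ≤ b * M + M ^ 2 + M ^ p + ω * M := by positivity
    linarith
  have hωE : ω * M ≤ E := by
    have : 0 ≤ b ^ 3 + b * M + M ^ 2 + M ^ p := by positivity
    linarith
  -- the quartic moment is a small perturbation of the entry `W₁₀`
  have hch : |(p - 1) * c * quarticMoment f c| ≤ (p - 1) * H * M := by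
    rw [abs_mul, abs_of_nonneg (by positivity)]
    calc (p - 1) * c * |quarticMoment f c| ≤ (p - 1) * 1 * (H * M) := by gcongr
      _ = _ := by ring
  have hdet' : δ / 2 ≤ |sysDet p f b c| := by
    have e1 : |moment p b c 0 1 * ((p - 1) * c * quarticMoment f c)| ≤ δ / 2 := by
      rw [abs_mul]
      calc _ ≤ A * ((p - 1) * H * M₀) := by
            refine mul_le_mul w01 (hch.trans ?_) (abs_nonneg _) hA0
            gcongr
        _ = (p - 1) * A * H * M₀ := by ring
        _ ≤ ((p - 1) * A * H + 1) * M₀ := by gcongr; linarith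
        _ = δ / 2 := by rw [hM₀]; field_simp
    have e2 := hdet b c hb hb1 hc hc1
    have e3 := (abs_le.1 e1).2
    have e4 : sysDet p f b c = -(moment p b c 0 0 * moment p b c 1 1
        - moment p b c 0 1 * moment p b c 1 0)
        + moment p b c 0 1 * ((p - 1) * c * quarticMoment f c) := by unfold sysDet; ring
    rw [abs_of_nonpos (by rw [e4]; linarith), e4]
    linarith
  have r0 : |sysRhs₀ p f b c| ≤ B * E := by
    unfold sysRhs₀
    have t1 : |(p - 1) * nonlinMoment p f b c 0| ≤ (p - 1) * (N₀ * E) := by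
      rw [abs_mul, abs_of_pos hp1]
      exact mul_le_mul_of_nonneg_left
        (n0.trans (mul_le_mul_of_nonneg_left hE1 hN₀0)) hp1.le
    have t2 : |4 * p / (p - 1) ^ 2 * b ^ 3 * moment p b c 0 2| ≤ 4 * p / (p - 1) ^ 2 * E * A := by
      rw [abs_mul, abs_of_nonneg (by positivity)]
      gcongr
    refine (abs_sub _ _).trans ((add_le_add t1 t2).trans ?_)
    have : 0 ≤ (p - 1) * (N₁ + H) * E := by positivity
    rw [hB]; linarith
  have r1 : |sysRhs₁ p f b c| ≤ B * E := by
    unfold sysRhs₁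
    have t1 : |(p - 1) * nonlinMoment p f b c 1| ≤ (p - 1) * (N₁ * E) := by
      rw [abs_mul, abs_of_pos hp1]
      exact mul_le_mul_of_nonneg_left
        (n1.trans (mul_le_mul_of_nonneg_left hE1 hN₁0)) hp1.le
    have t2 : |4 * p / (p - 1) ^ 2 * b ^ 3 * moment p b c 1 2| ≤ 4 * p / (p - 1) ^ 2 * E * A := by
      rw [abs_mul, abs_of_nonneg (by positivity)]
      gcongr
    have t3 : |(p - 1) * c * (2 * c - 1 + 2 * b / (p - 1)) * quarticMoment f c| ≤
        (p - 1) * H * E := by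
      rw [abs_mul, abs_mul, abs_of_nonneg (by positivity : 0 ≤ (p - 1) * c), ← hω]
      calc (p - 1) * c * ω * |quarticMoment f c| ≤ (p - 1) * 1 * ω * (H * M) := by gcongr
        _ = (p - 1) * H * (ω * M) := by ring
        _ ≤ _ := by gcongr
    refine (abs_add_le _ _).trans
      ((add_le_add ((abs_sub _ _).trans (add_le_add t1 t2)) t3).trans ?_)
    have : 0 ≤ (p - 1) * N₀ * E := by positivity
    rw [hB]; linarith
  have hK1 : |moment p b c 1 0 + (p - 1) * c * quarticMoment f c| ≤ K := by
    refine (abs_add_le _ _).trans (add_le_add w10 (hch.trans ?_))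
    gcongr
  have hAK : A ≤ K := by rw [hK]; linarith [(by positivity : 0 ≤ (p - 1) * H * M₀)]
  clear_value K B E
  have cramer : ∀ u v : ℝ, |u| ≤ A → |v| ≤ K →
      |(u * sysRhs₁ p f b c - v * sysRhs₀ p f b c) / sysDet p f b c| ≤
        (A + K) * B * (2 / δ) * E := by
    intro u v hu hv
    rw [abs_div, div_le_iff₀ (lt_of_lt_of_le (by positivity) hdet')]
    calc _ ≤ |u| * |sysRhs₁ p f b c| + |v| * |sysRhs₀ p f b c| := by
          rw [← abs_mul, ← abs_mul]; exact abs_sub _ _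
      _ ≤ A * (B * E) + K * (B * E) := by gcongr
      _ = (A + K) * B * (2 / δ) * E * (δ / 2) := by field_simp
      _ ≤ _ := by gcongr
  refine ⟨fun h => ?_, ?_, ?_⟩
  · rw [h, abs_zero] at hdet'; linarith
  · unfold remainderB
    rw [if_pos hc]
    exact cramer _ _ w00 hK1
  · unfold remainderC
    rw [if_pos hc]
    exact cramer _ _ w01 (w11.trans hAK)

end

/-! ### The profile as an approximate solution -/

/-- `b_τ + 2(3p-1)/(p-1)² b² - 2b(c-a)` with `a = 2c - 1/2`, where `b'` stands for `b_τ`. -/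
def defectB (p b c b' : ℝ) : ℝ :=
  b' + 2 * (3 * p - 1) / (p - 1) ^ 2 * b ^ 2 - 2 * b * (c - (2 * c - 1 / 2))

/-- `c_τ / c - 2(c-a) + 2b/(p-1)` with `a = 2c - 1/2`, where `c'` stands for `c_τ`. -/
def defectC (p b c c' : ℝ) : ℝ := c' / c - 2 * (c - (2 * c - 1 / 2)) + 2 / (p - 1) * b

/-- `e^{a y²/4}` times the error made by `v_{abc}` in the gauged equation. -/
def residual (p b c b' c' y : ℝ) : ℝ :=
  1 / (p - 1) * (defectC p b c c' * profile p b c y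
    - defectB p b c b' * (quot p b y * profile p b c y)
    + 4 * p / (p - 1) ^ 2 * b ^ 3 * (quot p b y ^ 2 * profile p b c y))

theorem phi0_pos (a y : ℝ) : 0 < phi0 a y := Real.exp_pos _

theorem exp_mul_phi0 (a y : ℝ) : Real.exp (a / 4 * y ^ 2) * phi0 a y = 1 := by
  unfold phi0
  rw [← Real.exp_add, ← Real.exp_zero]; congr 1; ring

theorem phi0_mul_phi0 (c y : ℝ) :
    phi0 (2 * c - 1 / 2) y * phi0 (2 * c - 1 / 2) y = density c y := by
  unfold phi0 density
  rw [← Real.exp_add]; congr 1; ring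

theorem exp_mul_abs_rpow_mul (p a y u : ℝ) :
    Real.exp (a / 4 * (p - 1) * y ^ 2) * |phi0 a y * u| ^ (p - 1) * (phi0 a y * u) =
      phi0 a y * (|u| ^ (p - 1) * u) := by
  have h : Real.exp (a / 4 * (p - 1) * y ^ 2) * phi0 a y ^ (p - 1) = 1 := by
    unfold phi0
    rw [← Real.exp_mul, ← Real.exp_add, ← Real.exp_zero]; congr 1; ring
  rw [abs_mul, abs_of_pos (phi0_pos a y), Real.mul_rpow (phi0_pos a y).le (abs_nonneg u)]
  calc _ = (Real.exp (a / 4 * (p - 1) * y ^ 2) * phi0 a y ^ (p - 1)) *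
        (phi0 a y * (|u| ^ (p - 1) * u)) := by ring
    _ = _ := by rw [h, one_mul]

theorem hasDerivAt_rpow_log {f : ℝ → ℝ} {f' x q : ℝ} (hf : HasDerivAt f f' x) (hx : 0 < f x) :
    HasDerivAt (fun s => f s ^ q) (f x ^ q * (q * (f' / f x))) x := by
  convert hf.rpow_const (p := q) (Or.inl hx.ne') using 1
  rw [Real.rpow_sub_one hx.ne']
  field_simp

theorem hasDerivAt_phi0 (a y : ℝ) : HasDerivAt (phi0 a) (phi0 a y * (-(a * y / 2))) y := by
  have h : HasDerivAt (fun y : ℝ => -(a * y ^ 2 / 4)) (-(a * y / 2)) y := by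
    have := (((hasDerivAt_pow 2 y).const_mul a).div_const 4).neg
    exact this.congr_deriv (by push_cast; ring)
  exact h.exp

theorem hasDerivAt_phi0_time {a : ℝ → ℝ} {a' τ : ℝ} (ha : HasDerivAt a a' τ) (y : ℝ) :
    HasDerivAt (fun s => phi0 (a s) y) (phi0 (a τ) y * (-(a' * y ^ 2 / 4))) τ :=
  (((ha.mul_const (y ^ 2)).div_const 4).neg).exp

section
variable {p b c : ℝ}

/-- Logarithmic derivative of `v_{abc}` in `y`. -/
def vLog (p a b y : ℝ) : ℝ := -(2 * b * y / ((p - 1) * (p - 1 + b * y ^ 2))) - a * y / 2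

/-- Derivative of `vLog` in `y`. -/
def vLogDeriv (p a b y : ℝ) : ℝ :=
  -(2 * b / ((p - 1) * (p - 1 + b * y ^ 2))) + 4 * b ^ 2 * y ^ 2 /
    ((p - 1) * (p - 1 + b * y ^ 2) ^ 2) - a / 2

theorem hasDerivAt_vabc (hp : 1 < p) (hb : 0 ≤ b) (hc : 0 < c) (a y : ℝ) :
    HasDerivAt (vabc p a b c) (vabc p a b c y * vLog p a b y) y := by
  have hp1 : p - 1 ≠ 0 := by linarith
  have hD := denom_pos hp hb y
  have hDne := hD.ne'
  have h1 : HasDerivAt (fun y : ℝ => p - 1 + b * y ^ 2) (b * (2 * y)) y := by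
    have := ((hasDerivAt_pow 2 y).const_mul b).const_add (p - 1)
    exact this.congr_deriv (by push_cast; ring)
  have h2 : HasDerivAt (fun y : ℝ => 2 * c / (p - 1 + b * y ^ 2))
      (-(2 * c * (b * (2 * y))) / (p - 1 + b * y ^ 2) ^ 2) y := by
    have := (hasDerivAt_const y (2 * c)).div h1 hD.ne'
    exact this.congr_deriv (by ring)
  have h3 := (hasDerivAt_rpow_log (q := 1 / (p - 1)) h2 (by positivity)).mul (hasDerivAt_phi0 a y)
  refine h3.congr_deriv ?_
  unfold vabc vLog
  have : Real.exp (-(a * y ^ 2 / 4)) = phi0 a y := rfl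
  rw [this]
  field_simp
  ring

theorem hasDerivAt_vLog (hp : 1 < p) (hb : 0 ≤ b) (a y : ℝ) :
    HasDerivAt (vLog p a b) (vLogDeriv p a b y) y := by
  have hp1 : p - 1 ≠ 0 := by linarith
  have hD := (denom_pos hp hb y).ne'
  have h1 : HasDerivAt (fun y : ℝ => (p - 1) * (p - 1 + b * y ^ 2))
      ((p - 1) * (b * (2 * y))) y := by
    have := (((hasDerivAt_pow 2 y).const_mul b).const_add (p - 1)).const_mul (p - 1)
    exact this.congr_deriv (by push_cast; ring)
  have h2 := (((hasDerivAt_id y).const_mul (2 * b)).div h1 (mul_ne_zero hp1 hD)).neg.sub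
    (((hasDerivAt_id y).const_mul a).div_const 2)
  refine h2.congr_deriv ?_
  unfold vLogDeriv
  simp only [id]
  field_simp
  ring

theorem hasDerivAt_vabc_mul_vLog (hp : 1 < p) (hb : 0 ≤ b) (hc : 0 < c) (a y : ℝ) :
    HasDerivAt (fun y => vabc p a b c y * vLog p a b y)
      (vabc p a b c y * (vLog p a b y ^ 2 + vLogDeriv p a b y)) y := by
  exact ((hasDerivAt_vabc hp hb hc a y).mul (hasDerivAt_vLog hp hb a y)).congr_deriv (by ring)

theorem hasDerivAt_vabc_time {a b c : ℝ → ℝ} {a' b' c' τ : ℝ} (hp : 1 < p)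
    (ha : HasDerivAt a a' τ) (hb : HasDerivAt b b' τ) (hc : HasDerivAt c c' τ)
    (hb0 : 0 ≤ b τ) (hc0 : 0 < c τ) (y : ℝ) :
    HasDerivAt (fun s => vabc p (a s) (b s) (c s) y)
      (vabc p (a τ) (b τ) (c τ) y *
        (1 / (p - 1) * (c' / c τ - b' * quot p (b τ) y) - a' * y ^ 2 / 4)) τ := by
  have hp1 : p - 1 ≠ 0 := by linarith
  have hD := denom_pos hp hb0 y
  have hDne := hD.ne'
  have h1 : HasDerivAt (fun s => p - 1 + b s * y ^ 2) (b' * y ^ 2) τ :=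
    (hb.mul_const (y ^ 2)).const_add (p - 1)
  have h2 := (hc.const_mul 2).div h1 hD.ne'
  have h3 := (hasDerivAt_rpow_log (q := 1 / (p - 1)) h2
    (by simp only [Pi.div_apply]; positivity)).mul (hasDerivAt_phi0_time ha y)
  refine h3.congr_deriv ?_
  simp only [vabc, quot, Pi.div_apply]
  have : Real.exp (-(a τ * y ^ 2 / 4)) = phi0 (a τ) y := rfl
  rw [this]
  field_simp
  ring

/-- `residual` is the error of `v_{abc}` in the gauged equation: its three terms are the
coefficients of `1`, `Q` and `Q²` after `1/D` is expanded as `(1 - b Q)/(p - 1)`. -/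
theorem vabc_residual (hp : 1 < p) (hb : 0 ≤ b) (hc : 0 < c) (b' c' y : ℝ) :
    vabc p (2 * c - 1 / 2) b c y *
        (1 / (p - 1) * (c' / c - b' * quot p b y) - 2 * c' * y ^ 2 / 4)
      - (vabc p (2 * c - 1 / 2) b c y *
          (vLog p (2 * c - 1 / 2) b y ^ 2 + vLogDeriv p (2 * c - 1 / 2) b y)
        - 1 / 4 * ((2 * c - 1 / 2) ^ 2 + 2 * c') * y ^ 2 * vabc p (2 * c - 1 / 2) b c y
        - (2 / (p - 1) - 1 / 2) * (2 * c - 1 / 2) * vabc p (2 * c - 1 / 2) b c y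
        + phi0 (2 * c - 1 / 2) y * profile p b c y ^ p)
      = phi0 (2 * c - 1 / 2) y * residual p b c b' c' y := by
  have hp1 : p - 1 ≠ 0 := by linarith
  have hD := denom_pos hp hb y
  have hDne := hD.ne'
  have hV := profile_pos hp hb hc y
  have hVp : profile p b c y ^ p = 2 * c / (p - 1 + b * y ^ 2) * profile p b c y := by
    rw [← profile_rpow hp hb hc.le, ← Real.rpow_add_one hV.ne']; congr 1; ring
  have hv : vabc p (2 * c - 1 / 2) b c y = profile p b c y * phi0 (2 * c - 1 / 2) y := rfl
  rw [hVp, hv]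
  simp only [residual, defectB, defectC, vLog, vLogDeriv, quot]
  clear hVp hv
  obtain ⟨P, rfl⟩ : ∃ P, p = P + 1 := ⟨p - 1, by ring⟩
  rw [add_sub_cancel_right] at *
  generalize profile (P + 1) b c y = V
  generalize phi0 (2 * c - 1 / 2) y = φ
  obtain ⟨D, hDD⟩ : ∃ D, D = P + b * y ^ 2 := ⟨_, rfl⟩
  rw [← hDD] at hDne ⊢
  have hc0 := hc.ne'
  field_simp
  rw [hDD]
  ring

end

/-! ### The equation for the perturbation, tested with `g e^{-a y²/4}` -/

/-- The terms of `∂_τ (ξ ψ) - ξ_yy ψ` for the test function `ψ = g e^{-a y²/4}`, where `ξ` solves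
the equation obtained from the gauged one by subtracting `v_{abc}`; `x` and `g` stand for the
values of `ξ` and `g` at `y`. -/
def source (p b c b' c' x g y : ℝ) : ℝ :=
  g * (x * phi0 (2 * c - 1 / 2) y) *
      (-(1 / 4 * ((2 * c - 1 / 2) ^ 2 + 2 * c') * y ^ 2)
        - (2 / (p - 1) - 1 / 2) * (2 * c - 1 / 2) - 2 * c' * y ^ 2 / 4)
    + g * (nonlin p (profile p b c y) (Real.exp ((2 * c - 1 / 2) / 4 * y ^ 2) * x)
        - residual p b c b' c' y) * density c y

/-- First derivative of `g e^{-a y²/4}`, in terms of the values of `g` and `g'`. -/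
def testDeriv₁ (c g g₁ y : ℝ) : ℝ := (g₁ - (2 * c - 1 / 2) * y / 2 * g) * phi0 (2 * c - 1 / 2) y

/-- Second derivative of `g e^{-a y²/4}`, in terms of the values of `g`, `g'` and `g''`. -/
def testDeriv₂ (c g g₁ g₂ y : ℝ) : ℝ :=
  (g₂ - (2 * c - 1 / 2) * y * g₁ + ((2 * c - 1 / 2) ^ 2 * y ^ 2 / 4 - (2 * c - 1 / 2) / 2) * g)
    * phi0 (2 * c - 1 / 2) y

theorem hasDerivAt_test {g g₁ : ℝ → ℝ} (c : ℝ) {y : ℝ} (hg : HasDerivAt g (g₁ y) y) :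
    HasDerivAt (fun y => g y * phi0 (2 * c - 1 / 2) y) (testDeriv₁ c (g y) (g₁ y) y) y := by
  refine (hg.mul (hasDerivAt_phi0 (2 * c - 1 / 2) y)).congr_deriv ?_
  unfold testDeriv₁; ring

theorem hasDerivAt_testDeriv₁ {g g₁ g₂ : ℝ → ℝ} (c : ℝ) {y : ℝ} (hg : HasDerivAt g (g₁ y) y)
    (hg₁ : HasDerivAt g₁ (g₂ y) y) :
    HasDerivAt (fun y => testDeriv₁ c (g y) (g₁ y) y) (testDeriv₂ c (g y) (g₁ y) (g₂ y) y) y := by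
  have h1 := (((hasDerivAt_id y).const_mul (2 * c - 1 / 2)).div_const 2).mul hg
  refine ((hg₁.sub h1).mul (hasDerivAt_phi0 (2 * c - 1 / 2) y)).congr_deriv ?_
  unfold testDeriv₂
  simp only [id, Pi.sub_apply, Pi.mul_apply]; ring

/-- The time derivative of `ξ ψ` for `ξ = w - v_{abc}` and `ψ = g e^{-a y²/4}`. -/
theorem hasDerivAt_perturbation_mul_test {p : ℝ} {b c : ℝ → ℝ} {b' c' τ y : ℝ} {w : ℝ → ℝ → ℝ}
    (hp : 1 < p) (hb : HasDerivAt b b' τ) (hc : HasDerivAt c c' τ)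
    (hb0 : 0 ≤ b τ) (hc0 : 0 < c τ)
    (hw : HasDerivAt (fun s => w s y) (gaugedRHS p (2 * c τ - 1 / 2) (2 * c') (w τ) y) τ)
    (g : ℝ) :
    HasDerivAt
      (fun s => (w s y - vabc p (2 * c s - 1 / 2) (b s) (c s) y) * (g * phi0 (2 * c s - 1 / 2) y))
      ((iteratedDeriv 2 (w τ) y - vabc p (2 * c τ - 1 / 2) (b τ) (c τ) y *
          (vLog p (2 * c τ - 1 / 2) (b τ) y ^ 2 + vLogDeriv p (2 * c τ - 1 / 2) (b τ) y))
          * (g * phi0 (2 * c τ - 1 / 2) y)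
        + source p (b τ) (c τ) b' c' (w τ y - vabc p (2 * c τ - 1 / 2) (b τ) (c τ) y) g y) τ := by
  have ha : HasDerivAt (fun s => 2 * c s - 1 / 2) (2 * c') τ := (hc.const_mul 2).sub_const _
  have h := (hw.sub (hasDerivAt_vabc_time hp ha hb hc hb0 hc0 y)).mul
    ((hasDerivAt_phi0_time ha y).const_mul g)
  refine h.congr_deriv ?_
  have hres := vabc_residual hp hb0 hc0 b' c' y
  set v := vabc p (2 * c τ - 1 / 2) (b τ) (c τ) y with hv
  set φ := phi0 (2 * c τ - 1 / 2) y with hφ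
  set V := profile p (b τ) (c τ) y with hV
  have hv' : v = V * φ := rfl
  have hexp : Real.exp ((2 * c τ - 1 / 2) / 4 * y ^ 2) * φ = 1 := exp_mul_phi0 _ _
  have hu : w τ y = φ * (V + Real.exp ((2 * c τ - 1 / 2) / 4 * y ^ 2) * (w τ y - v)) := by
    linear_combination hv' - (w τ y - v) * hexp
  have hnl : Real.exp ((2 * c τ - 1 / 2) / 4 * (p - 1) * y ^ 2) * |w τ y| ^ (p - 1) * w τ y
      = φ * (nonlin p V (Real.exp ((2 * c τ - 1 / 2) / 4 * y ^ 2) * (w τ y - v)) + V ^ p) := by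
    unfold nonlin
    rw [sub_add_cancel]
    have := exp_mul_abs_rpow_mul p (2 * c τ - 1 / 2) y
      (V + Real.exp ((2 * c τ - 1 / 2) / 4 * y ^ 2) * (w τ y - v))
    rwa [← hφ, ← hu] at this
  unfold source gaugedRHS
  simp only [Pi.sub_apply]
  rw [hnl, ← phi0_mul_phi0, ← hv, ← hφ, ← hV]
  linear_combination (-(g * φ)) * hres

/-! ### Bounds and continuity of the tested equation -/

section
variable {p b c : ℝ}

theorem exists_abs_residual_le (hp : 1 < p) (R : ℝ) :
    ∃ K : ℝ, 0 ≤ K ∧ ∀ b c b' c' y : ℝ, 0 ≤ b → b ≤ 1 → 3 / 8 ≤ c → c ≤ 1 → |b'| ≤ R → |c'| ≤ R →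
      |residual p b c b' c' y| ≤ K * (1 + y ^ 2) ^ 2 := by
  have hp1 : 0 < p - 1 := by linarith
  set Vm : ℝ := (2 / (p - 1)) ^ (1 / (p - 1)) with hVm
  have hVm0 : 0 ≤ Vm := by positivity
  set KC : ℝ := 3 * |R| + 1 + 2 / (p - 1) with hKC
  set KB : ℝ := |R| + |2 * (3 * p - 1) / (p - 1) ^ 2| + 1 with hKB
  have hKC0 : 0 ≤ KC := by positivity
  have hKB0 : 0 ≤ KB := by positivity
  refine ⟨1 / (p - 1) * (KC * Vm + KB * (1 / (p - 1) * Vm)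
    + 4 * p / (p - 1) ^ 2 * ((1 / (p - 1)) ^ 2 * Vm)), by positivity, ?_⟩
  intro b c b' c' y hb hb1 hc hc1 hb' hc'
  have hc0 : 0 < c := by linarith
  have hV := profile_pos hp hb hc0 y
  have hV1 : profile p b c y ≤ Vm := profile_le hp hb hc0.le hc1 y
  have hQ := quot_nonneg hp hb y
  have hQ1 : quot p b y ≤ 1 / (p - 1) * (1 + y ^ 2) := by
    rw [one_div_mul_eq_div]
    exact (quot_le hp hb y).trans (div_le_div_of_nonneg_right (by linarith) hp1.le)
  have hY : (1 : ℝ) ≤ 1 + y ^ 2 := by nlinarith [sq_nonneg y]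
  have hdc : |defectC p b c c'| ≤ KC := by
    have e1 : |c' / c| ≤ 3 * |R| := by
      rw [abs_div, abs_of_pos hc0, div_le_iff₀ hc0]
      have := hc'.trans (le_abs_self R)
      nlinarith [abs_nonneg R]
    have e2 : |2 * (c - (2 * c - 1 / 2))| ≤ 1 := by rw [abs_le]; constructor <;> linarith
    have e3 : |2 / (p - 1) * b| ≤ 2 / (p - 1) := by
      rw [abs_of_nonneg (by positivity)]
      exact mul_le_of_le_one_right (by positivity) hb1
    unfold defectC
    exact (abs_add_le _ _).trans (add_le_add ((abs_sub _ _).trans (add_le_add e1 e2)) e3)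
  have hdb : |defectB p b c b'| ≤ KB := by
    have e1 : |b'| ≤ |R| := hb'.trans (le_abs_self R)
    have e2 : |2 * (3 * p - 1) / (p - 1) ^ 2 * b ^ 2| ≤ |2 * (3 * p - 1) / (p - 1) ^ 2| := by
      rw [abs_mul, abs_of_nonneg (by positivity : 0 ≤ b ^ 2)]
      exact mul_le_of_le_one_right (abs_nonneg _) (pow_le_one₀ hb hb1)
    have e3 : |2 * b * (c - (2 * c - 1 / 2))| ≤ 1 := by
      rw [abs_mul, abs_of_nonneg (by positivity)]
      have : |c - (2 * c - 1 / 2)| ≤ 1 / 2 := by rw [abs_le]; constructor <;> linarith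
      nlinarith [abs_nonneg (c - (2 * c - 1 / 2))]
    unfold defectB
    exact (abs_sub _ _).trans (add_le_add ((abs_add_le _ _).trans (add_le_add e1 e2)) e3)
  have t1 : |defectC p b c c' * profile p b c y| ≤ KC * Vm * (1 + y ^ 2) ^ 2 := by
    rw [abs_mul, abs_of_pos hV]
    calc _ ≤ KC * Vm * 1 := by rw [mul_one]; gcongr
      _ ≤ _ := by gcongr; exact one_le_pow₀ hY
  have t2 : |defectB p b c b' * (quot p b y * profile p b c y)| ≤
      KB * (1 / (p - 1) * Vm) * (1 + y ^ 2) ^ 2 := by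
    rw [abs_mul, abs_of_nonneg (by positivity : 0 ≤ quot p b y * profile p b c y)]
    calc _ ≤ KB * ((1 / (p - 1) * (1 + y ^ 2)) * Vm) := by gcongr
      _ = KB * (1 / (p - 1) * Vm) * (1 + y ^ 2) ^ 1 := by ring
      _ ≤ _ := by gcongr; norm_num
  have t3 : |4 * p / (p - 1) ^ 2 * b ^ 3 * (quot p b y ^ 2 * profile p b c y)| ≤
      4 * p / (p - 1) ^ 2 * ((1 / (p - 1)) ^ 2 * Vm) * (1 + y ^ 2) ^ 2 := by
    have h0 : 0 ≤ 4 * p / (p - 1) ^ 2 * b ^ 3 * (quot p b y ^ 2 * profile p b c y) := by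
      positivity
    rw [abs_of_nonneg h0]
    calc 4 * p / (p - 1) ^ 2 * b ^ 3 * (quot p b y ^ 2 * profile p b c y)
        ≤ 4 * p / (p - 1) ^ 2 * 1 * ((1 / (p - 1) * (1 + y ^ 2)) ^ 2 * Vm) := by
          have : b ^ 3 ≤ 1 := pow_le_one₀ hb hb1
          gcongr
      _ = _ := by ring
  unfold residual
  rw [abs_mul, abs_of_pos (by positivity : 0 < 1 / (p - 1)),
    mul_assoc (1 / (p - 1)) _ ((1 + y ^ 2) ^ 2)]
  refine mul_le_mul_of_nonneg_left ?_ (by positivity : (0 : ℝ) ≤ 1 / (p - 1))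
  refine (abs_add_le _ _).trans ((add_le_add ((abs_sub _ _).trans (add_le_add t1 t2)) t3).trans ?_)
  exact le_of_eq (by ring)

theorem abs_mul_phi0_le {x y : ℝ} (hc : 3 / 8 ≤ c)
    (hx : |Real.exp ((2 * c - 1 / 2) / 4 * y ^ 2) * x| ≤ (1 + y ^ 2) ^ 2) :
    |x * phi0 (2 * c - 1 / 2) y| ≤ gaussWeight 2 y := by
  rw [mul_phi0_eq, abs_mul, abs_of_pos (density_pos c y)]
  calc _ ≤ (1 + y ^ 2) ^ 2 * gaussWeight 0 y :=
        mul_le_mul hx (density_le hc y) (density_pos c y).le (by positivity)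
    _ = _ := by unfold gaussWeight; ring

theorem exists_abs_source_le (hp : 1 < p) (R : ℝ) :
    ∃ (K : ℝ) (m : ℕ), 0 ≤ K ∧ 4 ≤ m ∧ ∀ b c b' c' x g y : ℝ,
      0 ≤ b → b ≤ 1 → 3 / 8 ≤ c → c ≤ 1 → |b'| ≤ R → |c'| ≤ R →
      |Real.exp ((2 * c - 1 / 2) / 4 * y ^ 2) * x| ≤ (1 + y ^ 2) ^ 2 → |g| ≤ 1 + y ^ 2 →
      |source p b c b' c' x g y| ≤ K * gaussWeight m y := by
  have hp1 : 0 < p - 1 := by linarith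
  obtain ⟨K₂, hK₂, hres⟩ := exists_abs_residual_le hp R
  obtain ⟨n, hn⟩ := exists_nat_ge (2 * p)
  set Vm : ℝ := (2 / (p - 1)) ^ (1 / (p - 1)) with hVm
  have hVm0 : 0 ≤ Vm := by positivity
  set K₁ : ℝ := 1 + 2 * |R| + (2 / (p - 1) + 1) * 2 with hK₁
  have hK₁0 : 0 ≤ K₁ := by positivity
  refine ⟨K₁ + (2 * (Vm + 1) ^ p + K₂), n + 4, by positivity, by omega, ?_⟩
  intro b c b' c' x g y hb hb1 hc hc1 hb' hc' hx hg
  have hc0 : 0 < c := by linarith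
  have hV := profile_pos hp hb hc0 y
  have hV1 : profile p b c y ≤ Vm := profile_le hp hb hc0.le hc1 y
  have hY : (1 : ℝ) ≤ 1 + y ^ 2 := by nlinarith [sq_nonneg y]
  have hY2 : (1 : ℝ) ≤ (1 + y ^ 2) ^ 2 := one_le_pow₀ hY
  have hcR : |c'| ≤ |R| := hc'.trans (le_abs_self R)
  have s1 : |g * (x * phi0 (2 * c - 1 / 2) y) *
      (-(1 / 4 * ((2 * c - 1 / 2) ^ 2 + 2 * c') * y ^ 2)
        - (2 / (p - 1) - 1 / 2) * (2 * c - 1 / 2) - 2 * c' * y ^ 2 / 4)| ≤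
      K₁ * gaussWeight (n + 4) y := by
    have e1 : |-(1 / 4 * ((2 * c - 1 / 2) ^ 2 + 2 * c') * y ^ 2)
        - (2 / (p - 1) - 1 / 2) * (2 * c - 1 / 2) - 2 * c' * y ^ 2 / 4| ≤ K₁ * (1 + y ^ 2) := by
      have u1 : |1 / 4 * ((2 * c - 1 / 2) ^ 2 + 2 * c') * y ^ 2| ≤ (1 + |R|) * (1 + y ^ 2) := by
        rw [abs_mul, abs_of_nonneg (sq_nonneg y)]
        have : |1 / 4 * ((2 * c - 1 / 2) ^ 2 + 2 * c')| ≤ 1 + |R| := by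
          have := abs_le.1 hcR
          rw [abs_le]; constructor <;> nlinarith [sq_nonneg (2 * c - 1 / 2)]
        exact mul_le_mul this (by linarith) (sq_nonneg y) (by positivity)
      have u2 : |(2 / (p - 1) - 1 / 2) * (2 * c - 1 / 2)| ≤
          (2 / (p - 1) + 1) * 2 * (1 + y ^ 2) := by
        rw [abs_mul]
        have v1 : |2 / (p - 1) - 1 / 2| ≤ 2 / (p - 1) + 1 := by
          have : 0 < 2 / (p - 1) := by positivity
          rw [abs_le]; constructor <;> linarith
        have v2 : |2 * c - 1 / 2| ≤ 2 := by rw [abs_le]; constructor <;> linarith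
        calc _ ≤ (2 / (p - 1) + 1) * 2 * 1 := by rw [mul_one]; gcongr
          _ ≤ _ := by gcongr
      have u3 : |2 * c' * y ^ 2 / 4| ≤ |R| * (1 + y ^ 2) := by
        have : 2 * c' * y ^ 2 / 4 = c' * (y ^ 2 / 2) := by ring
        rw [this, abs_mul, abs_of_nonneg (by positivity : 0 ≤ y ^ 2 / 2)]
        exact mul_le_mul hcR (by nlinarith [sq_nonneg y]) (by positivity) (abs_nonneg R)
      refine (abs_sub _ _).trans ((add_le_add (abs_sub _ _) le_rfl).trans ?_)
      rw [abs_neg, hK₁]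
      linarith
    rw [abs_mul, abs_mul]
    calc _ ≤ (1 + y ^ 2) * gaussWeight 2 y * (K₁ * (1 + y ^ 2)) := by
          have := abs_mul_phi0_le hc hx
          have := gaussWeight_nonneg 2 y
          gcongr
      _ = K₁ * gaussWeight 4 y := by unfold gaussWeight; ring
      _ ≤ _ := by gcongr; exact gaussWeight_mono (by omega) y
  set z := Real.exp ((2 * c - 1 / 2) / 4 * y ^ 2) * x with hz
  have s2 : |nonlin p (profile p b c y) z| ≤ 2 * (Vm + 1) ^ p * (1 + y ^ 2) ^ (n + 2) := by
    have e1 : |profile p b c y + z| ≤ (Vm + 1) * (1 + y ^ 2) ^ 2 := by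
      refine (abs_add_le _ _).trans ?_
      rw [abs_of_pos hV]
      nlinarith
    have e2 : ((Vm + 1) * (1 + y ^ 2) ^ 2) ^ p ≤ (Vm + 1) ^ p * (1 + y ^ 2) ^ (n + 2) := by
      rw [Real.mul_rpow (by positivity) (by positivity), ← Real.rpow_natCast (1 + y ^ 2) 2,
        ← Real.rpow_mul (by positivity), ← Real.rpow_natCast (1 + y ^ 2) (n + 2)]
      gcongr
      push_cast
      linarith
    have e3 : |(|profile p b c y + z| ^ (p - 1) * (profile p b c y + z))| ≤
        (Vm + 1) ^ p * (1 + y ^ 2) ^ (n + 2) := by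
      rw [abs_mul, abs_of_nonneg (Real.rpow_nonneg (abs_nonneg _) _)]
      refine le_trans ?_ e2
      calc _ ≤ ((Vm + 1) * (1 + y ^ 2) ^ 2) ^ (p - 1) * ((Vm + 1) * (1 + y ^ 2) ^ 2) := by gcongr
        _ = _ := by rw [← Real.rpow_add_one (by positivity)]; congr 1; ring
    have e4 : |profile p b c y ^ p| ≤ (Vm + 1) ^ p * (1 + y ^ 2) ^ (n + 2) := by
      rw [abs_of_nonneg (by positivity)]
      refine le_trans ?_ e2
      gcongr
      nlinarith
    unfold nonlin
    refine (abs_sub _ _).trans ((add_le_add e3 e4).trans (le_of_eq ?_))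
    ring
  have s3 : |g * (nonlin p (profile p b c y) z - residual p b c b' c' y) * density c y| ≤
      (2 * (Vm + 1) ^ p + K₂) * gaussWeight (n + 4) y := by
    have e1 : |nonlin p (profile p b c y) z - residual p b c b' c' y| ≤
        (2 * (Vm + 1) ^ p + K₂) * (1 + y ^ 2) ^ (n + 2) := by
      refine (abs_sub _ _).trans ((add_le_add s2 (hres b c b' c' y hb hb1 hc hc1 hb' hc')).trans ?_)
      have : (1 + y ^ 2) ^ 2 ≤ (1 + y ^ 2) ^ (n + 2) := pow_le_pow_right₀ hY (by omega)
      nlinarith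
    rw [abs_mul, abs_mul, abs_of_pos (density_pos c y)]
    calc _ ≤ (1 + y ^ 2) * ((2 * (Vm + 1) ^ p + K₂) * (1 + y ^ 2) ^ (n + 2)) * gaussWeight 0 y := by
          have := density_le hc y
          have := (density_pos c y).le
          gcongr
      _ = (2 * (Vm + 1) ^ p + K₂) * gaussWeight (n + 3) y := by unfold gaussWeight; ring
      _ ≤ _ := by gcongr; exact gaussWeight_mono (by omega) y
  unfold source
  refine (abs_add_le _ _).trans ((add_le_add s1 s3).trans (le_of_eq ?_))
  ring

theorem abs_mul_testDeriv_le {x y g g₁ g₂ : ℝ} (hc : 3 / 8 ≤ c) (hc1 : c ≤ 1)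
    (hx : |Real.exp ((2 * c - 1 / 2) / 4 * y ^ 2) * x| ≤ (1 + y ^ 2) ^ 2)
    (hg : |g| ≤ 1 + y ^ 2) (hg₁ : |g₁| ≤ 2 * (1 + y ^ 2)) (hg₂ : |g₂| ≤ 2) :
    |x * (g * phi0 (2 * c - 1 / 2) y)| ≤ 7 * gaussWeight 4 y ∧
    |x * testDeriv₁ c g g₁ y| ≤ 7 * gaussWeight 4 y ∧
    |x * testDeriv₂ c g g₁ g₂ y| ≤ 7 * gaussWeight 4 y := by
  have hφ := abs_mul_phi0_le hc hx
  have hY : (1 : ℝ) ≤ 1 + y ^ 2 := by nlinarith [sq_nonneg y]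
  have hY2 : 1 + y ^ 2 ≤ (1 + y ^ 2) ^ 2 := by nlinarith
  have hyY : |y| ≤ (1 + y ^ 2) / 2 := by
    rw [abs_le]; constructor <;> nlinarith [sq_nonneg (y - 1), sq_nonneg (y + 1)]
  have key : ∀ u : ℝ, |u| ≤ 7 * (1 + y ^ 2) ^ 2 →
      |u * (x * phi0 (2 * c - 1 / 2) y)| ≤ 7 * gaussWeight 4 y := by
    intro u hu
    rw [abs_mul]
    calc _ ≤ 7 * (1 + y ^ 2) ^ 2 * gaussWeight 2 y := by gcongr
      _ = _ := by unfold gaussWeight; ring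
  have ha : |2 * c - 1 / 2| ≤ 3 / 2 := by rw [abs_le]; constructor <;> linarith
  have h1 : |(2 * c - 1 / 2) * y / 2 * g| ≤ (1 + y ^ 2) ^ 2 := by
    rw [abs_mul, abs_div, abs_mul, abs_two]
    calc _ ≤ 3 / 2 * ((1 + y ^ 2) / 2) / 2 * (1 + y ^ 2) := by gcongr
      _ ≤ _ := by nlinarith
  have h2 : |(2 * c - 1 / 2) * y * g₁| ≤ 2 * (1 + y ^ 2) ^ 2 := by
    rw [abs_mul, abs_mul]
    calc _ ≤ 3 / 2 * ((1 + y ^ 2) / 2) * (2 * (1 + y ^ 2)) := by gcongr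
      _ ≤ _ := by nlinarith
  have h3 : |((2 * c - 1 / 2) ^ 2 * y ^ 2 / 4 - (2 * c - 1 / 2) / 2) * g| ≤
      2 * (1 + y ^ 2) ^ 2 := by
    rw [abs_mul]
    have : |(2 * c - 1 / 2) ^ 2 * y ^ 2 / 4 - (2 * c - 1 / 2) / 2| ≤ 2 * (1 + y ^ 2) := by
      have e1 : (2 * c - 1 / 2) ^ 2 ≤ 4 := by nlinarith
      have e2 : 0 ≤ (2 * c - 1 / 2) ^ 2 * y ^ 2 := by positivity
      have e3 : (2 * c - 1 / 2) ^ 2 * y ^ 2 ≤ 4 * y ^ 2 := by gcongr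
      rw [abs_le]; constructor <;> nlinarith [sq_nonneg y]
    calc _ ≤ 2 * (1 + y ^ 2) * (1 + y ^ 2) := by gcongr
      _ = _ := by ring
  refine ⟨?_, ?_, ?_⟩
  · rw [show x * (g * phi0 (2 * c - 1 / 2) y) = g * (x * phi0 (2 * c - 1 / 2) y) by ring]
    exact key _ (by linarith)
  · rw [show x * testDeriv₁ c g g₁ y = (g₁ - (2 * c - 1 / 2) * y / 2 * g) *
      (x * phi0 (2 * c - 1 / 2) y) by unfold testDeriv₁; ring]
    exact key _ ((abs_sub _ _).trans (by linarith))
  · rw [show x * testDeriv₂ c g g₁ g₂ y = (g₂ - (2 * c - 1 / 2) * y * g₁ +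
      ((2 * c - 1 / 2) ^ 2 * y ^ 2 / 4 - (2 * c - 1 / 2) / 2) * g) *
      (x * phi0 (2 * c - 1 / 2) y) by unfold testDeriv₂; ring]
    exact key _ ((abs_add_le _ _).trans ((add_le_add (abs_sub _ _) le_rfl).trans (by linarith)))

end

section
variable {X : Type*} [TopologicalSpace X] {s : Set X} {z : X} {p : ℝ}
  {B C B' C' A U G Y : X → ℝ}

theorem continuousWithinAt_phi0 (hA : ContinuousWithinAt A s z) (hY : ContinuousWithinAt Y s z) :
    ContinuousWithinAt (fun q => phi0 (A q) (Y q)) s z :=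
  Real.continuous_exp.continuousAt.comp_continuousWithinAt
    ((hA.mul (hY.pow 2)).div_const 4).neg

theorem continuousWithinAt_denom (hB : ContinuousWithinAt B s z) (hY : ContinuousWithinAt Y s z) :
    ContinuousWithinAt (fun q => p - 1 + B q * Y q ^ 2) s z :=
  continuousWithinAt_const.add (hB.mul (hY.pow 2))

theorem continuousWithinAt_profile (hp : 1 < p) (hB : ContinuousWithinAt B s z)
    (hC : ContinuousWithinAt C s z) (hY : ContinuousWithinAt Y s z) (hB0 : 0 ≤ B z) :
    ContinuousWithinAt (fun q => profile p (B q) (C q) (Y q)) s z := by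
  have hp1 : 0 < p - 1 := by linarith
  exact ((hC.const_mul 2).div (continuousWithinAt_denom hB hY)
    (denom_pos hp hB0 _).ne').rpow_const (Or.inr (by positivity))

theorem continuousWithinAt_quot (hp : 1 < p) (hB : ContinuousWithinAt B s z)
    (hY : ContinuousWithinAt Y s z) (hB0 : 0 ≤ B z) :
    ContinuousWithinAt (fun q => quot p (B q) (Y q)) s z :=
  (hY.pow 2).div (continuousWithinAt_denom hB hY) (denom_pos hp hB0 _).ne'

theorem continuousWithinAt_source (hp : 1 < p) (hB : ContinuousWithinAt B s z)
    (hC : ContinuousWithinAt C s z) (hB' : ContinuousWithinAt B' s z)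
    (hC' : ContinuousWithinAt C' s z) (hU : ContinuousWithinAt U s z)
    (hG : ContinuousWithinAt G s z) (hY : ContinuousWithinAt Y s z) (hB0 : 0 ≤ B z)
    (hC0 : 0 < C z) :
    ContinuousWithinAt (fun q => source p (B q) (C q) (B' q) (C' q) (U q) (G q) (Y q)) s z := by
  have hA : ContinuousWithinAt (fun q => 2 * C q - 1 / 2) s z :=
    (hC.const_mul 2).sub continuousWithinAt_const
  have hφ := continuousWithinAt_phi0 hA hY
  have hV := continuousWithinAt_profile hp hB hC hY hB0
  have hQ := continuousWithinAt_quot hp hB hY hB0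
  have hρ : ContinuousWithinAt (fun q => density (C q) (Y q)) s z :=
    Real.continuous_exp.continuousAt.comp_continuousWithinAt
      ((hA.mul (hY.pow 2)).div_const 2).neg
  have he : ContinuousWithinAt (fun q => Real.exp ((2 * C q - 1 / 2) / 4 * Y q ^ 2) * U q) s z :=
    (Real.continuous_exp.continuousAt.comp_continuousWithinAt
      ((hA.div_const 4).mul (hY.pow 2))).mul hU
  have hN : ContinuousWithinAt (fun q => nonlin p (profile p (B q) (C q) (Y q))
      (Real.exp ((2 * C q - 1 / 2) / 4 * Y q ^ 2) * U q)) s z := by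
    have h := hV.add he
    exact ((h.abs.rpow_const (Or.inr (by linarith))).mul h).sub
      (hV.rpow_const (Or.inr (by linarith)))
  have hdB : ContinuousWithinAt (fun q => defectB p (B q) (C q) (B' q)) s z :=
    (hB'.add ((hB.pow 2).const_mul _)).sub ((hB.const_mul 2).mul (hC.sub hA))
  have hdC : ContinuousWithinAt (fun q => defectC p (B q) (C q) (C' q)) s z :=
    ((hC'.div hC hC0.ne').sub ((hC.sub hA).const_mul 2)).add (hB.const_mul _)
  have hR : ContinuousWithinAt
      (fun q => residual p (B q) (C q) (B' q) (C' q) (Y q)) s z :=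
    (((hdC.mul hV).sub (hdB.mul (hQ.mul hV))).add
      (((hB.pow 3).const_mul _).mul ((hQ.pow 2).mul hV))).const_mul _
  have hcoef : ContinuousWithinAt (fun q => -(1 / 4 * ((2 * C q - 1 / 2) ^ 2 + 2 * C' q) * Y q ^ 2)
      - (2 / (p - 1) - 1 / 2) * (2 * C q - 1 / 2) - 2 * C' q * Y q ^ 2 / 4) s z :=
    ((((((hA.pow 2).add (hC'.const_mul 2)).const_mul _).mul (hY.pow 2)).neg).sub
      (hA.const_mul _)).sub (((hC'.const_mul 2).mul (hY.pow 2)).div_const 4)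
  exact ((hG.mul (hU.mul hφ)).mul hcoef).add ((hG.mul (hN.sub hR)).mul hρ)

end

/-! ### Projecting the equation along a solution -/

section
variable {p T : ℝ} {b c : ℝ → ℝ} {w : ℝ → ℝ → ℝ}

theorem IsGaugedSolution.continuousWithinAt {a : ℝ → ℝ} (hw : IsGaugedSolution p T a w) {τ : ℝ}
    (hτ : τ ∈ Ioc 0 T) (y : ℝ) : ContinuousWithinAt (fun s => w s y) (Icc 0 T) τ :=
  (hw.equation τ hτ y).continuousWithinAt

theorem IsGaugedSolution.aemeasurable {a : ℝ → ℝ} (hT : 0 < T) (hw : IsGaugedSolution p T a w)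
    {τ : ℝ} (hτ : τ ∈ Icc 0 T) : AEMeasurable (w τ) := by
  rcases eq_or_lt_of_le hτ.1 with h | h
  · subst h
    have hmem : ∀ n : ℕ, T / (n + 1) ∈ Ioc 0 T := fun n =>
      ⟨by positivity, div_le_self hT.le (by linarith [(Nat.cast_nonneg n : (0 : ℝ) ≤ n)])⟩
    have hlim : Tendsto (fun n : ℕ => T / ((n : ℝ) + 1)) atTop (𝓝[Icc 0 T] 0) := by
      refine tendsto_nhdsWithin_iff.2
        ⟨?_, Eventually.of_forall fun n => Ioc_subset_Icc_self (hmem n)⟩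
      have := (tendsto_one_div_add_atTop_nhds_zero_nat (𝕜 := ℝ)).const_mul T
      simpa only [mul_one_div, mul_zero] using this
    refine aemeasurable_of_tendsto_metrizable_ae atTop (f := fun (n : ℕ) => w (T / (n + 1)))
      (fun n => (hw.contDiff _ (hmem n)).continuous.aemeasurable) ?_
    filter_upwards [hw.initial] with y hy
    exact Tendsto.comp (f := fun n : ℕ => T / ((n : ℝ) + 1)) hy hlim
  · exact (hw.contDiff τ ⟨h, hτ.2⟩).continuous.aemeasurable

theorem aemeasurable_source (hp : 1 < p) {B C B' C' : ℝ} (hB : 0 ≤ B) {u g : ℝ → ℝ}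
    (hu : AEMeasurable u) (hg : Measurable g) :
    AEMeasurable fun y => source p B C B' C' (u y) (g y) y := by
  have h1 : Measurable (profile p B C) := (continuous_profile hp hB).measurable
  have h2 : Measurable (quot p B) := (continuous_quot hp hB).measurable
  have h3 : Measurable (density C) := continuous_density.measurable
  have h4 : Measurable (phi0 (2 * C - 1 / 2)) := Continuous.measurable (by unfold phi0; fun_prop)
  unfold source nonlin residual
  fun_prop

/-- The equation for `ζ = w - v_{abc}`, tested with `g e^{-a y²/4}` to which `ζ` stays
orthogonal, at all times including the end points. -/
theorem projection_identity (hp : 1 < p) (hT : 0 < T)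
    (hb : ContDiffOn ℝ 1 b (Icc 0 T)) (hc : ContDiffOn ℝ 1 c (Icc 0 T))
    (hb0 : ∀ τ ∈ Icc 0 T, 0 ≤ b τ) (hb1 : ∀ τ ∈ Icc 0 T, b τ ≤ 1)
    (hc0 : ∀ τ ∈ Icc 0 T, 3 / 8 ≤ c τ) (hc1 : ∀ τ ∈ Icc 0 T, c τ ≤ 1)
    (hw : IsGaugedSolution p T (fun τ => 2 * c τ - 1 / 2) w) {ζ : ℝ → ℝ → ℝ}
    (hζ : ∀ τ y, ζ τ y = w τ y - vabc p (2 * c τ - 1 / 2) (b τ) (c τ) y)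
    (hpert : ∀ τ ∈ Icc 0 T, IsPerturbation (c τ) 1 (ζ τ))
    {g g₁ g₂ : ℝ → ℝ} (hg : ∀ y, HasDerivAt g (g₁ y) y) (hg₁ : ∀ y, HasDerivAt g₁ (g₂ y) y)
    (hg₂ : Continuous g₂) (hgb : ∀ y, |g y| ≤ 1 + y ^ 2) (hgb₁ : ∀ y, |g₁ y| ≤ 2 * (1 + y ^ 2))
    (hgb₂ : ∀ y, |g₂ y| ≤ 2)
    (horth : ∀ τ ∈ Icc 0 T, ∫ y, ζ τ y * (g y * phi0 (2 * c τ - 1 / 2) y) = 0) :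
    ∀ τ ∈ Icc 0 T,
      ∫ y, (ζ τ y * testDeriv₂ (c τ) (g y) (g₁ y) (g₂ y) y
        + source p (b τ) (c τ) (derivWithin b (Icc 0 T) τ) (derivWithin c (Icc 0 T) τ)
          (ζ τ y) (g y) y) = 0 := by
  set b' := derivWithin b (Icc 0 T) with hb'
  set c' := derivWithin c (Icc 0 T) with hc'
  have hud : UniqueDiffOn ℝ (Icc 0 T) := uniqueDiffOn_Icc hT
  have cb : ContinuousOn b (Icc 0 T) := hb.continuousOn
  have cc : ContinuousOn c (Icc 0 T) := hc.continuousOn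
  have cb' : ContinuousOn b' (Icc 0 T) := hb.continuousOn_derivWithin hud le_rfl
  have cc' : ContinuousOn c' (Icc 0 T) := hc.continuousOn_derivWithin hud le_rfl
  have hcpos : ∀ τ ∈ Icc 0 T, 0 < c τ := fun τ hτ => by linarith [hc0 τ hτ]
  have hsub : Ioo 0 T ⊆ Icc 0 T := Ioo_subset_Icc_self
  have hcg : Continuous g := continuous_iff_continuousAt.2 fun y => (hg y).continuousAt
  have hcg₁ : Continuous g₁ := continuous_iff_continuousAt.2 fun y => (hg₁ y).continuousAt
  obtain ⟨R₁, hR₁⟩ := isCompact_Icc.exists_bound_of_continuousOn cb'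
  obtain ⟨R₂, hR₂⟩ := isCompact_Icc.exists_bound_of_continuousOn cc'
  obtain ⟨K, m, hK0, hm, hS⟩ := exists_abs_source_le hp (max R₁ R₂)
  set Kf : ℝ → ℝ := fun y => (K + 7) * gaussWeight m y with hKf
  have hKint : Integrable Kf := (integrable_gaussWeight m).const_mul _
  have hKS : ∀ y, K * gaussWeight m y ≤ Kf y := fun y => by
    have := gaussWeight_nonneg m y
    simp only [hKf]; nlinarith
  have hK7 : ∀ y, 7 * gaussWeight 4 y ≤ Kf y := fun y => by
    have h1 := gaussWeight_nonneg m y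
    have h2 := gaussWeight_mono hm y
    simp only [hKf]; nlinarith
  have hbS : ∀ τ ∈ Icc 0 T, ∀ᵐ y,
      |source p (b τ) (c τ) (b' τ) (c' τ) (ζ τ y) (g y) y| ≤ K * gaussWeight m y := by
    intro τ hτ
    filter_upwards [(hpert τ hτ).bound] with y hy
    rw [one_mul] at hy
    exact hS _ _ _ _ _ _ _ (hb0 τ hτ) (hb1 τ hτ) (hc0 τ hτ) (hc1 τ hτ)
      ((hR₁ τ hτ).trans (le_max_left _ _)) ((hR₂ τ hτ).trans (le_max_right _ _)) hy (hgb y)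
  have hbT : ∀ τ ∈ Icc 0 T, ∀ᵐ y,
      |ζ τ y * (g y * phi0 (2 * c τ - 1 / 2) y)| ≤ 7 * gaussWeight 4 y ∧
      |ζ τ y * testDeriv₁ (c τ) (g y) (g₁ y) y| ≤ 7 * gaussWeight 4 y ∧
      |ζ τ y * testDeriv₂ (c τ) (g y) (g₁ y) (g₂ y) y| ≤ 7 * gaussWeight 4 y := by
    intro τ hτ
    filter_upwards [(hpert τ hτ).bound] with y hy
    rw [one_mul] at hy
    exact abs_mul_testDeriv_le (hc0 τ hτ) (hc1 τ hτ) hy (hgb y) (hgb₁ y) (hgb₂ y)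
  set Φ : ℝ → ℝ → ℝ := fun τ y => ζ τ y * testDeriv₂ (c τ) (g y) (g₁ y) (g₂ y) y
        + source p (b τ) (c τ) (b' τ) (c' τ) (ζ τ y) (g y) y with hΦ
  have hΦm : ∀ τ ∈ Icc 0 T, AEMeasurable (Φ τ) := by
    intro τ hτ
    have h1 : Measurable fun y => testDeriv₂ (c τ) (g y) (g₁ y) (g₂ y) y := by
      have e1 := hcg.measurable; have e2 := hcg₁.measurable; have e3 := hg₂.measurable
      have e4 : Measurable (phi0 (2 * c τ - 1 / 2)) :=
        Continuous.measurable (by unfold phi0; fun_prop)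
      unfold testDeriv₂
      fun_prop
    exact ((hpert τ hτ).aemeasurable.mul h1.aemeasurable).add
      (aemeasurable_source hp (hb0 τ hτ) (hpert τ hτ).aemeasurable hcg.measurable)
  have hΦb : ∀ τ ∈ Icc 0 T, ∀ᵐ y, ‖Φ τ y‖ ≤ Kf y := by
    intro τ hτ
    filter_upwards [hbS τ hτ, hbT τ hτ] with y h1 h2
    refine (abs_add_le _ _).trans ((add_le_add h2.2.2 h1).trans ?_)
    have h3 := gaussWeight_mono hm y
    simp only [hKf]; linarith
  -- the identity at interior times
  have hint : ∀ τ ∈ Ioo 0 T, ∫ y, Φ τ y = 0 := by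
    have hIoc : ∀ τ ∈ Ioo 0 T, τ ∈ Ioc 0 T := fun τ hτ => Ioo_subset_Ioc_self hτ
    have hwc : ∀ τ ∈ Ioo 0 T, ContDiff ℝ 1 (deriv (w τ)) ∧ Differentiable ℝ (w τ) := by
      intro τ hτ
      have : ContDiff ℝ (1 + 1) (w τ) := by
        simpa [one_add_one_eq_two] using hw.contDiff τ (hIoc τ hτ)
      exact ⟨(contDiff_succ_iff_deriv.1 this).2.2, (contDiff_succ_iff_deriv.1 this).1⟩
    have hit : ∀ τ, iteratedDeriv 2 (w τ) = deriv (deriv (w τ)) := fun τ => by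
      rw [iteratedDeriv_succ, iteratedDeriv_one]
    have hζfun : ∀ τ, ζ τ = fun y => w τ y - vabc p (2 * c τ - 1 / 2) (b τ) (c τ) y :=
      fun τ => funext (hζ τ)
    have cvy : ∀ {X : Type} [TopologicalSpace X] {s : Set X} {z : X} {B C Y : X → ℝ},
        ContinuousWithinAt B s z → ContinuousWithinAt C s z → ContinuousWithinAt Y s z →
        0 ≤ B z → ContinuousWithinAt (fun q => vabc p (2 * C q - 1 / 2) (B q) (C q) (Y q) *
          (vLog p (2 * C q - 1 / 2) (B q) (Y q) ^ 2 +
            vLogDeriv p (2 * C q - 1 / 2) (B q) (Y q))) s z := by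
      intro X _ s z B C Y hB hC hY hB0
      have hp1 : p - 1 ≠ 0 := by linarith
      have hD := (denom_pos hp hB0 (Y z)).ne'
      have hA : ContinuousWithinAt (fun q => 2 * C q - 1 / 2) s z :=
        (hC.const_mul 2).sub continuousWithinAt_const
      have hDc := continuousWithinAt_denom (p := p) hB hY
      have h1 : ContinuousWithinAt (fun q => vabc p (2 * C q - 1 / 2) (B q) (C q) (Y q)) s z :=
        (continuousWithinAt_profile hp hB hC hY hB0).mul (continuousWithinAt_phi0 hA hY)
      have h2 : ContinuousWithinAt (fun q => vLog p (2 * C q - 1 / 2) (B q) (Y q)) s z :=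
        ((((hB.const_mul 2).mul hY).div (hDc.const_mul (p - 1)) (mul_ne_zero hp1 hD)).neg).sub
          ((hA.mul hY).div_const 2)
      have h3 : ContinuousWithinAt (fun q => vLogDeriv p (2 * C q - 1 / 2) (B q) (Y q)) s z :=
        ((((hB.const_mul 2).div (hDc.const_mul (p - 1)) (mul_ne_zero hp1 hD)).neg).add
          ((((hB.pow 2).const_mul 4).mul (hY.pow 2)).div ((hDc.pow 2).const_mul (p - 1))
            (mul_ne_zero hp1 (pow_ne_zero 2 hD)))).sub (hA.div_const 2)
      exact h1.mul ((h2.pow 2).add h3)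
    have cψ₂ : ∀ τ, Continuous fun y => testDeriv₂ (c τ) (g y) (g₁ y) (g₂ y) y := fun τ => by
      unfold testDeriv₂ phi0
      fun_prop
    refine integral_eq_zero_of_orthogonal (ξ := ζ)
      (ξ₁ := fun τ y => deriv (w τ) y - vabc p (2 * c τ - 1 / 2) (b τ) (c τ) y *
        vLog p (2 * c τ - 1 / 2) (b τ) y)
      (ξ₂ := fun τ y => iteratedDeriv 2 (w τ) y - vabc p (2 * c τ - 1 / 2) (b τ) (c τ) y *
        (vLog p (2 * c τ - 1 / 2) (b τ) y ^ 2 + vLogDeriv p (2 * c τ - 1 / 2) (b τ) y))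
      (ψ := fun τ y => g y * phi0 (2 * c τ - 1 / 2) y)
      (ψ₁ := fun τ y => testDeriv₁ (c τ) (g y) (g₁ y) y)
      (S := fun τ y => source p (b τ) (c τ) (b' τ) (c' τ) (ζ τ y) (g y) y) (K := Kf)
      ?_ ?_ ?_ ?_ ?_ ?_ ?_ ?_ hKint ?_ ?_ ?_ ?_ ?_
    · intro τ hτ y
      rw [hζfun]
      exact ((hwc τ hτ).2 y).hasDerivAt.sub
        (hasDerivAt_vabc hp (hb0 τ (hsub hτ)) (hcpos τ (hsub hτ)) _ y)
    · intro τ hτ y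
      simp only [hit]
      exact ((hwc τ hτ).1.differentiable one_ne_zero y).hasDerivAt.sub
        (hasDerivAt_vabc_mul_vLog hp (hb0 τ (hsub hτ)) (hcpos τ (hsub hτ)) _ y)
    · intro τ hτ
      rw [← continuousOn_univ]
      intro y _
      refine ContinuousWithinAt.sub ?_ (cvy continuousWithinAt_const continuousWithinAt_const
        continuousWithinAt_id (hb0 τ (hsub hτ)))
      simp only [hit]
      exact ((hwc τ hτ).1.continuous_deriv le_rfl).continuousWithinAt
    · exact fun τ hτ y => hasDerivAt_test (c τ) (hg y)
    · exact fun τ hτ y => hasDerivAt_testDeriv₁ (c τ) (hg y) (hg₁ y)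
    · exact fun τ hτ => cψ₂ τ
    · intro q hq
      have hq1 : q.1 ∈ Icc 0 T := hsub hq.1
      have maps : MapsTo (Prod.fst : ℝ × ℝ → ℝ) (Ioo 0 T ×ˢ univ) (Icc 0 T) :=
        fun z hz => hsub hz.1
      have lift : ∀ {f : ℝ → ℝ}, ContinuousOn f (Icc 0 T) →
          ContinuousWithinAt (fun z : ℝ × ℝ => f z.1) (Ioo 0 T ×ˢ univ) q := fun hf =>
        ContinuousWithinAt.comp (t := Icc 0 T) (hf q.1 hq1) continuousWithinAt_fst maps
      have hY : ContinuousWithinAt (fun z : ℝ × ℝ => z.2) (Ioo 0 T ×ˢ univ) q :=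
        continuousWithinAt_snd
      have hincl : Ioo 0 T ×ˢ (univ : Set ℝ) ⊆ Ioc 0 T ×ˢ univ :=
        prod_mono Ioo_subset_Ioc_self le_rfl
      have hA : ContinuousWithinAt (fun z : ℝ × ℝ => 2 * c z.1 - 1 / 2) (Ioo 0 T ×ˢ univ) q :=
        ((lift cc).const_mul 2).sub continuousWithinAt_const
      have hG : ContinuousWithinAt (fun z : ℝ × ℝ => g z.2) (Ioo 0 T ×ˢ univ) q :=
        (hcg.comp continuous_snd).continuousWithinAt
      have hφ := continuousWithinAt_phi0 hA hY
      have hξc : ContinuousWithinAt (fun z : ℝ × ℝ => ζ z.1 z.2) (Ioo 0 T ×ˢ univ) q := by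
        simp only [hζ]
        exact ((hw.continuousOn.mono hincl) q hq).sub
          ((continuousWithinAt_profile hp (lift cb) (lift cc) hY (hb0 _ hq1)).mul hφ)
      exact ((((hw.continuousOn_yy.mono hincl) q hq).sub
        (cvy (lift cb) (lift cc) hY (hb0 _ hq1))).mul (hG.mul hφ)).add
        (continuousWithinAt_source hp (lift cb) (lift cc) (lift cb') (lift cc') hξc hG hY
          (hb0 _ hq1) (hcpos _ hq1))
    · intro τ hτ y
      have hnhds : Icc 0 T ∈ 𝓝 τ := Icc_mem_nhds hτ.1 hτ.2
      have db : HasDerivAt b (b' τ) τ :=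
        ((hb.differentiableOn one_ne_zero τ (hsub hτ)).hasDerivWithinAt).hasDerivAt hnhds
      have dc : HasDerivAt c (c' τ) τ :=
        ((hc.differentiableOn one_ne_zero τ (hsub hτ)).hasDerivWithinAt).hasDerivAt hnhds
      have da : derivWithin (fun τ => 2 * c τ - 1 / 2) (Icc 0 T) τ = 2 * c' τ :=
        (((dc.const_mul 2).sub_const (1 / 2)).hasDerivWithinAt).derivWithin (hud τ (hsub hτ))
      have dw := (hw.equation τ (hIoc τ hτ) y).hasDerivAt hnhds
      rw [da] at dw
      simp only [hζ]
      exact hasDerivAt_perturbation_mul_test hp db dc (hb0 τ (hsub hτ)) (hcpos τ (hsub hτ)) dw (g y)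
    · intro τ hτ
      filter_upwards [hbT τ (hsub hτ)] with y hy using hy.1.trans (hK7 y)
    · intro τ hτ
      filter_upwards [hbT τ (hsub hτ)] with y hy using hy.2.1.trans (hK7 y)
    · intro τ hτ
      filter_upwards [hbT τ (hsub hτ)] with y hy using hy.2.2.trans (hK7 y)
    · intro τ hτ
      filter_upwards [hbS τ (hsub hτ)] with y hy using hy.trans (hKS y)
    · exact fun τ hτ => horth τ (hsub hτ)
  -- passage to the end points, by dominated convergence
  have hcont : ContinuousOn (fun τ => ∫ y, Φ τ y) (Icc 0 T) := by
    intro τ hτ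
    refine continuousWithinAt_of_dominated (bound := Kf)
      (eventually_mem_nhdsWithin.mono fun s hs => (hΦm s hs).aestronglyMeasurable)
      (eventually_mem_nhdsWithin.mono fun s hs => hΦb s hs) hKint ?_
    have hwt : ∀ᵐ y, ContinuousWithinAt (fun s => w s y) (Icc 0 T) τ := by
      rcases eq_or_lt_of_le hτ.1 with h | h
      · rw [← h]; exact hw.initial
      · exact Eventually.of_forall fun y => hw.continuousWithinAt ⟨h, hτ.2⟩ y
    filter_upwards [hwt] with y hy
    have hA : ContinuousWithinAt (fun s => 2 * c s - 1 / 2) (Icc 0 T) τ :=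
      ((cc τ hτ).const_mul 2).sub continuousWithinAt_const
    have hφ := continuousWithinAt_phi0 (Y := fun _ => y) hA continuousWithinAt_const
    have hξc : ContinuousWithinAt (fun s => ζ s y) (Icc 0 T) τ := by
      simp only [hζ]
      exact hy.sub ((continuousWithinAt_profile hp (cb τ hτ) (cc τ hτ)
        (continuousWithinAt_const (b := y)) (hb0 _ hτ)).mul hφ)
    have ht2 : ContinuousWithinAt (fun s => testDeriv₂ (c s) (g y) (g₁ y) (g₂ y) y)
        (Icc 0 T) τ := by
      unfold testDeriv₂
      refine ContinuousWithinAt.mul ?_ hφ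
      exact (continuousWithinAt_const.sub ((hA.mul continuousWithinAt_const).mul
        continuousWithinAt_const)).add (((((hA.pow 2).mul continuousWithinAt_const).div_const 4).sub
          (hA.div_const 2)).mul continuousWithinAt_const)
    exact (hξc.mul ht2).add (continuousWithinAt_source hp (cb τ hτ) (cc τ hτ) (cb' τ hτ)
      (cc' τ hτ) hξc (continuousWithinAt_const (b := g y)) (continuousWithinAt_const (b := y))
      (hb0 _ hτ) (hcpos _ hτ))
  have heq : EqOn (fun τ => ∫ y, Φ τ y) (fun _ => 0) (Icc 0 T) :=
    EqOn.of_subset_closure (s := Ioo 0 T) hint hcont continuousOn_const hsub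
      (closure_Ioo hT.ne).ge
  exact fun τ hτ => heq hτ

theorem integral_linear_combination {f₀ f₁ f₂ n m₀ m₁ m₂ : ℝ → ℝ} (h₀ : Integrable f₀)
    (h₁ : Integrable f₁) (h₂ : Integrable f₂) (hn : Integrable n) (k₀ : Integrable m₀)
    (k₁ : Integrable m₁) (k₂ : Integrable m₂) (α β γ k s t r : ℝ) :
    ∫ y, (α * f₀ y + β * f₁ y + γ * f₂ y + n y - k * (s * m₀ y - t * m₁ y + r * m₂ y)) =
      α * (∫ y, f₀ y) + β * (∫ y, f₁ y) + γ * (∫ y, f₂ y) + (∫ y, n y)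
        - k * (s * (∫ y, m₀ y) - t * (∫ y, m₁ y) + r * ∫ y, m₂ y) := by
  have e₁ : Integrable fun y => α * f₀ y + β * f₁ y := (h₀.const_mul α).add (h₁.const_mul β)
  have e₂ : Integrable fun y => α * f₀ y + β * f₁ y + γ * f₂ y := e₁.add (h₂.const_mul γ)
  have e₃ : Integrable fun y => α * f₀ y + β * f₁ y + γ * f₂ y + n y := e₂.add hn
  have e₄ : Integrable fun y => s * m₀ y - t * m₁ y := (k₀.const_mul s).sub (k₁.const_mul t)
  have e₅ : Integrable fun y => s * m₀ y - t * m₁ y + r * m₂ y := e₄.add (k₂.const_mul r)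
  rw [integral_sub e₃ (e₅.const_mul k), integral_add e₂ hn, integral_add e₁ (h₂.const_mul γ),
    integral_add (h₀.const_mul α) (h₁.const_mul β), integral_const_mul, integral_const_mul,
    integral_const_mul, integral_const_mul, integral_add e₄ (k₂.const_mul r),
    integral_sub (k₀.const_mul s) (k₁.const_mul t), integral_const_mul, integral_const_mul,
    integral_const_mul]

/-- Along a solution the defects of `b` and `c` solve the linear system that defines
`remainderB` and `remainderC`. -/
theorem system_of_solution (hp : 1 < p) (hT : 0 < T)
    (hb : ContDiffOn ℝ 1 b (Icc 0 T)) (hc : ContDiffOn ℝ 1 c (Icc 0 T))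
    (hb0 : ∀ τ ∈ Icc 0 T, 0 ≤ b τ) (hb1 : ∀ τ ∈ Icc 0 T, b τ ≤ 1)
    (hc0 : ∀ τ ∈ Icc 0 T, 3 / 8 ≤ c τ) (hc1 : ∀ τ ∈ Icc 0 T, c τ ≤ 1)
    (hw : IsGaugedSolution p T (fun τ => 2 * c τ - 1 / 2) w) {ζ : ℝ → ℝ → ℝ}
    (hζ : ∀ τ y, ζ τ y = w τ y - vabc p (2 * c τ - 1 / 2) (b τ) (c τ) y)
    (hpert : ∀ τ ∈ Icc 0 T, IsPerturbation (c τ) 1 (ζ τ))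
    (horth₀ : ∀ τ ∈ Icc 0 T, ∫ y, ζ τ y * phi0 (2 * c τ - 1 / 2) y = 0)
    (horth₁ : ∀ τ ∈ Icc 0 T, ∫ y, y ^ 2 * (ζ τ y * phi0 (2 * c τ - 1 / 2) y) = 0)
    {τ : ℝ} (hτ : τ ∈ Icc 0 T) :
    moment p (b τ) (c τ) 0 0 * defectC p (b τ) (c τ) (derivWithin c (Icc 0 T) τ)
      - moment p (b τ) (c τ) 0 1 * defectB p (b τ) (c τ) (derivWithin b (Icc 0 T) τ)
      = sysRhs₀ p (ζ τ) (b τ) (c τ) ∧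
    (moment p (b τ) (c τ) 1 0 + (p - 1) * c τ * quarticMoment (ζ τ) (c τ))
        * defectC p (b τ) (c τ) (derivWithin c (Icc 0 T) τ)
      - moment p (b τ) (c τ) 1 1 * defectB p (b τ) (c τ) (derivWithin b (Icc 0 T) τ)
      = sysRhs₁ p (ζ τ) (b τ) (c τ) := by
  have hp1 : p - 1 ≠ 0 := by linarith
  have P₀ := (projection_identity hp hT hb hc hb0 hb1 hc0 hc1 hw hζ hpert (g := fun _ => 1)
    (g₁ := fun _ => 0) (g₂ := fun _ => 0) (fun y => hasDerivAt_const y 1)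
    (fun y => hasDerivAt_const y 0) continuous_const
    (fun y => by rw [abs_one]; nlinarith [sq_nonneg y])
    (fun y => by rw [abs_zero]; positivity) (fun y => by rw [abs_zero]; norm_num)
    (fun s hs => by simpa using horth₀ s hs) τ hτ)
  have P₁ := (projection_identity hp hT hb hc hb0 hb1 hc0 hc1 hw hζ hpert (g := fun y => y ^ 2)
    (g₁ := fun y => 2 * y) (g₂ := fun _ => 2)
    (fun y => by simpa using hasDerivAt_pow 2 y)
    (fun y => by simpa using (hasDerivAt_id y).const_mul 2) continuous_const
    (fun y => by rw [abs_of_nonneg (sq_nonneg y)]; linarith)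
    (fun y => by
      rw [abs_le]; constructor <;> nlinarith [sq_nonneg (y - 1), sq_nonneg (y + 1)])
    (fun y => by rw [abs_two])
    (fun s hs => by
      rw [← horth₁ s hs]
      congr 1; ext y; ring) τ hτ)
  set b' := derivWithin b (Icc 0 T) τ with hb'
  set c' := derivWithin c (Icc 0 T) τ with hc'
  have hB0 := hb0 τ hτ
  have hC0 := hc0 τ hτ
  have hC1 := hc1 τ hτ
  have hpt := hpert τ hτ
  have o₀ := horth₀ τ hτ
  have o₁ := horth₁ τ hτ
  have hcne : c τ ≠ 0 := by linarith
  generalize b τ = B at *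
  generalize c τ = C at *
  generalize ζ τ = f at *
  have i₀ := hpt.integrable_mul_phi0 hC0 0
  have i₁ := hpt.integrable_mul_phi0 hC0 1
  have i₂ := hpt.integrable_mul_phi0 hC0 2
  obtain ⟨_, _, n₀⟩ := exists_abs_nonlinMoment_le hp 0
  obtain ⟨_, _, n₁⟩ := exists_abs_nonlinMoment_le hp 1
  have N₀ := (n₀ B C 1 f hB0 hC0 hC1 hpt (by simpa using o₀)).1
  have N₁ := (n₁ B C 1 f hB0 hC0 hC1 hpt (by simpa using o₁)).1
  have q : ∫ y, (y ^ 2) ^ 2 * (f y * phi0 (2 * C - 1 / 2) y) = quarticMoment f C := by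
    unfold quarticMoment
    congr 1; ext y; ring
  have o₀' : ∫ y, (y ^ 2) ^ 0 * (f y * phi0 (2 * C - 1 / 2) y) = 0 := by simpa using o₀
  have o₁' : ∫ y, (y ^ 2) ^ 1 * (f y * phi0 (2 * C - 1 / 2) y) = 0 := by simpa using o₁
  have E₀ := integral_linear_combination i₀ i₁ i₂ N₀ (integrable_moment hp hB0 hC0 hC1 0 0)
    (integrable_moment hp hB0 hC0 hC1 0 1) (integrable_moment hp hB0 hC0 hC1 0 2)
    (-(2 / (p - 1)) * (2 * C - 1 / 2)) (-c') 0 (1 / (p - 1)) (defectC p B C c')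
    (defectB p B C b') (4 * p / (p - 1) ^ 2 * B ^ 3)
  have E₁ := integral_linear_combination i₀ i₁ i₂ N₁ (integrable_moment hp hB0 hC0 hC1 1 0)
    (integrable_moment hp hB0 hC0 hC1 1 1) (integrable_moment hp hB0 hC0 hC1 1 2)
    2 (-(2 + 2 / (p - 1)) * (2 * C - 1 / 2)) (-c') (1 / (p - 1)) (defectC p B C c')
    (defectB p B C b') (4 * p / (p - 1) ^ 2 * B ^ 3)
  rw [o₀', o₁', q] at E₀ E₁
  have F₀ : 0 = nonlinMoment p f B C 0 - 1 / (p - 1) * (defectC p B C c' * moment p B C 0 0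
      - defectB p B C b' * moment p B C 0 1 + 4 * p / (p - 1) ^ 2 * B ^ 3 * moment p B C 0 2) := by
    rw [← P₀]
    unfold nonlinMoment moment
    refine Eq.trans ?_ (E₀.trans (by ring))
    congr 1; ext y
    unfold testDeriv₂ source residual
    ring
  have F₁ : 0 = -c' * quarticMoment f C + nonlinMoment p f B C 1
      - 1 / (p - 1) * (defectC p B C c' * moment p B C 1 0
      - defectB p B C b' * moment p B C 1 1 + 4 * p / (p - 1) ^ 2 * B ^ 3 * moment p B C 1 2) := by
    rw [← P₁]
    unfold nonlinMoment moment
    refine Eq.trans ?_ (E₁.trans (by ring))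
    congr 1; ext y
    unfold testDeriv₂ source residual
    ring
  have hc'eq : c' = C * (defectC p B C c' - (2 * C - 1 + 2 * B / (p - 1))) := by
    unfold defectC
    field_simp
    ring
  have G₀ : (p - 1) * nonlinMoment p f B C 0 = defectC p B C c' * moment p B C 0 0
      - defectB p B C b' * moment p B C 0 1
      + 4 * p / (p - 1) ^ 2 * B ^ 3 * moment p B C 0 2 := by
    have : (p - 1) * (1 / (p - 1)) = 1 := mul_one_div_cancel hp1
    linear_combination (-(p - 1)) * F₀ + (defectC p B C c' * moment p B C 0 0
      - defectB p B C b' * moment p B C 0 1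
      + 4 * p / (p - 1) ^ 2 * B ^ 3 * moment p B C 0 2) * this
  have G₁ : (p - 1) * nonlinMoment p f B C 1 = (p - 1) * c' * quarticMoment f C
      + (defectC p B C c' * moment p B C 1 0 - defectB p B C b' * moment p B C 1 1
      + 4 * p / (p - 1) ^ 2 * B ^ 3 * moment p B C 1 2) := by
    have : (p - 1) * (1 / (p - 1)) = 1 := mul_one_div_cancel hp1
    linear_combination (-(p - 1)) * F₁ + (defectC p B C c' * moment p B C 1 0
      - defectB p B C b' * moment p B C 1 1
      + 4 * p / (p - 1) ^ 2 * B ^ 3 * moment p B C 1 2) * this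
  unfold sysRhs₀ sysRhs₁
  constructor
  · rw [G₀]; ring
  · rw [G₁]
    linear_combination (-(p - 1) * quarticMoment f C) * hc'eq
end

/-! ### Consequences of the bounds on the majorants -/

theorem beta_pos {p b₀ τ : ℝ} (hp : 1 < p) (hb₀ : 0 < b₀) (hτ : 0 ≤ τ) : 0 < beta p b₀ τ := by
  have : 0 < p - 1 := by linarith
  unfold beta; positivity

theorem beta_le {p b₀ τ : ℝ} (hp : 1 < p) (hb₀ : 0 < b₀) (hτ : 0 ≤ τ) : beta p b₀ τ ≤ b₀ := by
  have hp1 : 0 < p - 1 := by linarith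
  have h : 0 ≤ 4 * p / (p - 1) ^ 2 * τ := by positivity
  unfold beta
  rw [div_le_iff₀ (by positivity), mul_add, mul_one_div_cancel hb₀.ne']
  have : 0 ≤ b₀ * (4 * p / (p - 1) ^ 2 * τ) := by positivity
  linarith

theorem kappa_pos {p : ℝ} (hp : 1 < p) : 0 < kappa p := by
  unfold kappa
  exact lt_min (by norm_num) (by linarith)

theorem kappa_le (p : ℝ) : kappa p ≤ 1 / 2 := min_le_left _ _

theorem sq_mul_le_of_le_rpow {p β x : ℝ} (hβ : 0 < β) (hβ1 : β ≤ 1)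
    (hx : x ≤ β ^ (-(kappa p / 2))) : β ^ 2 * x ≤ β := by
  calc β ^ 2 * x ≤ β ^ 2 * β ^ (-(kappa p / 2)) := by gcongr
    _ = β ^ (2 - kappa p / 2) := by
      rw [← Real.rpow_natCast β 2, ← Real.rpow_add hβ]; congr 1
    _ ≤ β ^ (1 : ℝ) := Real.rpow_le_rpow_of_exponent_ge hβ hβ1 (by linarith [kappa_le p])
    _ = β := Real.rpow_one β

theorem rpow_mul_le_half_of_le_rpow {p β ε x : ℝ} (hp : 1 < p) (hβ : 0 < β) (hβε : β ≤ ε)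
    (hε : ε ≤ (1 / 2) ^ (2 / kappa p)) (hx : x ≤ β ^ (-(kappa p / 2))) :
    β ^ (1 + kappa p) * x ≤ β / 2 := by
  have hκ := kappa_pos hp
  have h : β ^ (kappa p / 2) ≤ 1 / 2 := by
    calc β ^ (kappa p / 2) ≤ ((1 / 2) ^ (2 / kappa p)) ^ (kappa p / 2) := by
          gcongr; exact hβε.trans hε
      _ = 1 / 2 := by
          rw [← Real.rpow_mul (by norm_num), div_mul_div_comm, mul_comm (kappa p) 2,
            div_self (by positivity), Real.rpow_one]
  calc β ^ (1 + kappa p) * x ≤ β ^ (1 + kappa p) * β ^ (-(kappa p / 2)) := by gcongr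
    _ = β ^ (kappa p / 2) * β := by
      rw [← Real.rpow_add hβ, ← Real.rpow_add_one hβ.ne']; congr 1; ring
    _ ≤ 1 / 2 * β := by gcongr
    _ = β / 2 := by ring

theorem toReal_le_rpow {m : ℝ≥0∞} {r : ℝ} (hr : 0 ≤ r) (h : m ≤ ENNReal.ofReal r) :
    m ≠ ∞ ∧ m.toReal ≤ r :=
  ⟨(h.trans_lt ENNReal.ofReal_lt_top).ne, ENNReal.toReal_le_of_le_ofReal hr h⟩

theorem abs_le_majA {p : ℝ} {a b : ℝ → ℝ} {τ : ℝ} (hβ : 0 < beta p (b 0) τ) (hτ : 0 ≤ τ)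
    (h : majA p a b τ ≠ ∞) :
    |a τ - 1 / 2 + 2 * b τ / (p - 1)| ≤ beta p (b 0) τ ^ 2 * (majA p a b τ).toReal := by
  have h1 : ENNReal.ofReal ((beta p (b 0) τ ^ 2)⁻¹ * |a τ - 1 / 2 + 2 * b τ / (p - 1)|) ≤
      majA p a b τ :=
    le_iSup₂_of_le (f := fun s (_ : s ∈ Icc 0 τ) =>
      ENNReal.ofReal ((beta p (b 0) s ^ 2)⁻¹ * |a s - 1 / 2 + 2 * b s / (p - 1)|))
      τ (right_mem_Icc.2 hτ) le_rfl
  have h2 := (ENNReal.ofReal_le_iff_le_toReal h).1 h1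
  rwa [inv_mul_le_iff₀ (by positivity)] at h2

theorem abs_le_majB {p : ℝ} {b : ℝ → ℝ} {τ : ℝ} (hβ : 0 < beta p (b 0) τ) (hτ : 0 ≤ τ)
    (h : majB p b τ ≠ ∞) :
    |b τ - beta p (b 0) τ| ≤ beta p (b 0) τ ^ (1 + kappa p) * (majB p b τ).toReal := by
  have h1 : ENNReal.ofReal (beta p (b 0) τ ^ (-(1 + kappa p)) * |b τ - beta p (b 0) τ|) ≤
      majB p b τ :=
    le_iSup₂_of_le (f := fun s (_ : s ∈ Icc 0 τ) =>
      ENNReal.ofReal (beta p (b 0) s ^ (-(1 + kappa p)) * |b s - beta p (b 0) s|))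
      τ (right_mem_Icc.2 hτ) le_rfl
  have h2 := (ENNReal.ofReal_le_iff_le_toReal h).1 h1
  rwa [Real.rpow_neg hβ.le, inv_mul_le_iff₀ (by positivity)] at h2

theorem ae_abs_le_majM1 {p : ℝ} {a b : ℝ → ℝ} {ξ : ℝ → ℝ → ℝ} {τ : ℝ}
    (hβ : 0 < beta p (b 0) τ) (hτ : 0 ≤ τ) (h : majM1 p a b ξ τ ≠ ∞) :
    ∀ᵐ y, |Real.exp (a τ / 4 * y ^ 2) * ξ τ y| ≤
      beta p (b 0) τ ^ 2 * (majM1 p a b ξ τ).toReal * (1 + y ^ 2) ^ 2 := by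
  have h1 : ENNReal.ofReal ((beta p (b 0) τ ^ 2)⁻¹) * weightedNorm (a τ) (ξ τ) ≤
      majM1 p a b ξ τ :=
    le_iSup₂_of_le (f := fun s (_ : s ∈ Icc 0 τ) =>
      ENNReal.ofReal ((beta p (b 0) s ^ 2)⁻¹) * weightedNorm (a s) (ξ s))
      τ (right_mem_Icc.2 hτ) le_rfl
  have hae := enorm_ae_le_eLpNormEssSup
    (fun y : ℝ => (Real.sqrt (1 + y ^ 2) ^ 3)⁻¹ * Real.exp (a τ / 4 * y ^ 2) * ξ τ y) volume
  filter_upwards [hae] with y hy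
  rw [← eLpNorm_exponent_top] at hy
  have h2 := (mul_le_mul_right hy (ENNReal.ofReal ((beta p (b 0) τ ^ 2)⁻¹))).trans h1
  rw [Real.enorm_eq_ofReal_abs, ← ENNReal.ofReal_mul (by positivity)] at h2
  have h3 := (ENNReal.ofReal_le_iff_le_toReal h).1 h2
  have hs : 0 < Real.sqrt (1 + y ^ 2) := Real.sqrt_pos.2 (by positivity)
  rw [inv_mul_le_iff₀ (by positivity), mul_assoc, abs_mul, abs_of_pos (by positivity),
    inv_mul_le_iff₀ (by positivity)] at h3
  have h4 : Real.sqrt (1 + y ^ 2) ^ 3 ≤ (1 + y ^ 2) ^ 2 := by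
    have e : (1 + y ^ 2) ^ 2 = Real.sqrt (1 + y ^ 2) ^ 4 := by
      rw [show (4 : ℕ) = 2 * 2 from rfl, pow_mul, Real.sq_sqrt (by positivity)]
    rw [e]
    refine pow_le_pow_right₀ ?_ (by norm_num)
    rw [Real.one_le_sqrt]
    nlinarith [sq_nonneg y]
  have h5 : 0 ≤ (majM1 p a b ξ τ).toReal := ENNReal.toReal_nonneg
  calc _ ≤ _ := h3
    _ ≤ (1 + y ^ 2) ^ 2 * (beta p (b 0) τ ^ 2 * (majM1 p a b ξ τ).toReal) := by gcongr
    _ = _ := by ring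

theorem IsGaugedSolution.congr {p T : ℝ} {a a₁ : ℝ → ℝ} {w : ℝ → ℝ → ℝ}
    (hw : IsGaugedSolution p T a w) (h : EqOn a a₁ (Icc 0 T)) : IsGaugedSolution p T a₁ w where
  initial := hw.initial
  continuousOn := hw.continuousOn
  contDiff := hw.contDiff
  continuousOn_yy := hw.continuousOn_yy
  equation τ hτ y := by
    have hτ' := Ioc_subset_Icc_self hτ
    rw [← h hτ', ← derivWithin_congr h (h hτ')]
    exact hw.equation τ hτ y

theorem IsPerturbation.mono {c M M' : ℝ} {f : ℝ → ℝ} (hf : IsPerturbation c M f) (h : M ≤ M') :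
    IsPerturbation c M' f :=
  ⟨hf.aemeasurable, hf.bound.mono fun y hy => hy.trans (by gcongr)⟩

theorem IsPerturbation.integral_sq_mul_phi0 {c M : ℝ} {f : ℝ → ℝ} (hf : IsPerturbation c M f)
    (hc : 3 / 8 ≤ c) (h₀ : ∫ y, f y * phi0 (2 * c - 1 / 2) y = 0)
    (h₂ : ∫ y, f y * phi2 (2 * c - 1 / 2) y = 0) :
    ∫ y, y ^ 2 * (f y * phi0 (2 * c - 1 / 2) y) = 0 := by
  have i₀ : Integrable fun y => f y * phi0 (2 * c - 1 / 2) y := by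
    simpa using hf.integrable_mul_phi0 hc 0
  have i₁ : Integrable fun y => y ^ 2 * (f y * phi0 (2 * c - 1 / 2) y) := by
    simpa using hf.integrable_mul_phi0 hc 1
  have e : ∫ y, f y * phi2 (2 * c - 1 / 2) y =
      (∫ y, f y * phi0 (2 * c - 1 / 2) y)
        - (2 * c - 1 / 2) * ∫ y, y ^ 2 * (f y * phi0 (2 * c - 1 / 2) y) := by
    rw [← integral_const_mul, ← integral_sub i₀ (i₁.const_mul _)]
    congr 1; ext y
    unfold phi2 phi0
    ring
  rw [h₂, h₀, zero_sub] at e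
  have ha : 2 * c - 1 / 2 ≠ 0 := by linarith
  have := neg_eq_zero.1 e.symm
  exact (mul_eq_zero.1 this).resolve_left ha

end GaugedHeat

end

theorem proposition7p2 (p : ℝ) (hp : 1 < p) :
    ∃ ε : ℝ, 0 < ε ∧ ∃ C : ℝ, 0 < C ∧ ∃ Rb Rc : (ℝ → ℝ) → ℝ → ℝ → ℝ,
      (∀ (T : ℝ) (a b c : ℝ → ℝ) (w ξ : ℝ → ℝ → ℝ),
        0 < T →
        ContDiffOn ℝ 1 b (Icc 0 T) →
        ContDiffOn ℝ 1 c (Icc 0 T) →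
        (∀ τ ∈ Icc 0 T, a τ = 2 * c τ - 1 / 2) →
        0 < b 0 → b 0 ≤ ε →
        1 / 4 ≤ c 0 → c 0 ≤ 1 →
        GaugedHeat.IsGaugedSolution p T a w →
        (∀ τ ∈ Icc 0 T, ∀ y : ℝ,
          w τ y = GaugedHeat.vabc p (a τ) (b τ) (c τ) y + ξ τ y) →
        (∀ τ ∈ Icc 0 T, ∫ y : ℝ, ξ τ y * GaugedHeat.phi0 (a τ) y = 0) →
        (∀ τ ∈ Icc 0 T, ∫ y : ℝ, ξ τ y * GaugedHeat.phi2 (a τ) y = 0) →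
        (∀ τ ∈ Icc 0 T, GaugedHeat.majA p a b τ ≤
          ENNReal.ofReal (GaugedHeat.beta p (b 0) τ ^ (-(GaugedHeat.kappa p / 2)))) →
        (∀ τ ∈ Icc 0 T, GaugedHeat.majB p b τ ≤
          ENNReal.ofReal (GaugedHeat.beta p (b 0) τ ^ (-(GaugedHeat.kappa p / 2)))) →
        (∀ τ ∈ Icc 0 T, GaugedHeat.majM1 p a b ξ τ ≤
          ENNReal.ofReal (GaugedHeat.beta p (b 0) τ ^ (-(GaugedHeat.kappa p / 2)))) →
        ∀ τ ∈ Icc 0 T,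
          derivWithin b (Icc 0 T) τ =
              -(2 * (3 * p - 1) / (p - 1) ^ 2) * b τ ^ 2 + 2 * b τ * (c τ - a τ)
                + Rb (ξ τ) (b τ) (c τ) ∧
          derivWithin c (Icc 0 T) τ / c τ =
              2 * (c τ - a τ) - 2 / (p - 1) * b τ + Rc (ξ τ) (b τ) (c τ) ∧
          |Rb (ξ τ) (b τ) (c τ)| ≤ C * GaugedHeat.remainderOrder p a b ξ τ ∧
          |Rc (ξ τ) (b τ) (c τ)| ≤ C * GaugedHeat.remainderOrder p a b ξ τ) ∧
      (∀ b c : ℝ, 0 < b → b ≤ ε → 1 / 4 ≤ c → c ≤ 1 →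
        |Rb 0 b c| ≤ C * b ^ 3 ∧ |Rc 0 b c| ≤ C * b ^ 3) := by
  open GaugedHeat in
  have hp1 : 0 < p - 1 := by linarith
  obtain ⟨M₀, C, hM₀, hC, hstat⟩ := exists_abs_remainder_le hp
  -- `ε` makes `b ≤ 2β ≤ 1`, `β² M₁ ≤ β ≤ M₀` and `|a - 1/2| ≤ (4/(p-1) + 1) β ≤ 1/4`
  set ε : ℝ := min (min (1 / 2) M₀)
    (min ((1 / 2) ^ (2 / kappa p)) (1 / (4 * (4 / (p - 1) + 1)))) with hε
  have hε1 : ε ≤ 1 / 2 := (min_le_left _ _).trans (min_le_left _ _)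
  have hε2 : ε ≤ M₀ := (min_le_left _ _).trans (min_le_right _ _)
  have hε3 : ε ≤ (1 / 2) ^ (2 / kappa p) := (min_le_right _ _).trans (min_le_left _ _)
  have hε4 : (4 / (p - 1) + 1) * ε ≤ 1 / 4 := by
    have h : ε ≤ 1 / (4 * (4 / (p - 1) + 1)) := (min_le_right _ _).trans (min_le_right _ _)
    calc _ ≤ (4 / (p - 1) + 1) * (1 / (4 * (4 / (p - 1) + 1))) := by gcongr
      _ = 1 / 4 := by field_simp
  have hε0 : 0 < ε := by
    have : 0 < (1 / 2 : ℝ) ^ (2 / kappa p) := Real.rpow_pos_of_pos (by norm_num) _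
    exact lt_min (lt_min (by norm_num) hM₀) (lt_min this (by positivity))
  clear_value ε
  refine ⟨ε, hε0, 8 * C + 1, by positivity, remainderB p, remainderC p, ?_, ?_⟩
  · intro T a b c w ξ hT hb hc ha hb0 hbε _ _ hw hdec horth₀ horth₂ hA hB hM
    -- the quantitative information at each time
    have hβ : ∀ τ ∈ Icc 0 T, 0 < beta p (b 0) τ := fun τ hτ => beta_pos hp hb0 hτ.1
    have hβε : ∀ τ ∈ Icc 0 T, beta p (b 0) τ ≤ ε := fun τ hτ => (beta_le hp hb0 hτ.1).trans hbε
    have hbβ : ∀ τ ∈ Icc 0 T, |b τ - beta p (b 0) τ| ≤ beta p (b 0) τ / 2 := by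
      intro τ hτ
      have hr := toReal_le_rpow (Real.rpow_nonneg (hβ τ hτ).le _) (hB τ hτ)
      exact (abs_le_majB (hβ τ hτ) hτ.1 hr.1).trans
        (rpow_mul_le_half_of_le_rpow hp (hβ τ hτ) (hβε τ hτ) hε3 hr.2)
    have hbpos : ∀ τ ∈ Icc 0 T, 0 ≤ b τ := fun τ hτ => by
      linarith [(abs_le.1 (hbβ τ hτ)).1, hβ τ hτ]
    have hb2 : ∀ τ ∈ Icc 0 T, b τ ≤ 2 * beta p (b 0) τ := fun τ hτ => by
      linarith [(abs_le.1 (hbβ τ hτ)).2, hβ τ hτ]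
    have hb1 : ∀ τ ∈ Icc 0 T, b τ ≤ 1 := fun τ hτ => by linarith [hb2 τ hτ, hβε τ hτ]
    have hA' : ∀ τ ∈ Icc 0 T, |a τ - 1 / 2 + 2 * b τ / (p - 1)| ≤
        beta p (b 0) τ ^ 2 * (majA p a b τ).toReal ∧
        beta p (b 0) τ ^ 2 * (majA p a b τ).toReal ≤ beta p (b 0) τ := by
      intro τ hτ
      have hr := toReal_le_rpow (Real.rpow_nonneg (hβ τ hτ).le _) (hA τ hτ)
      exact ⟨abs_le_majA (hβ τ hτ) hτ.1 hr.1,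
        sq_mul_le_of_le_rpow (hβ τ hτ) (by linarith [hβε τ hτ]) hr.2⟩
    have hcbd : ∀ τ ∈ Icc 0 T, |2 * c τ - 1| ≤ 1 / 4 := by
      intro τ hτ
      have h1 := abs_le.1 ((hA' τ hτ).1.trans (hA' τ hτ).2)
      have h2 : 2 * b τ / (p - 1) ≤ 4 / (p - 1) * beta p (b 0) τ := by
        rw [div_mul_eq_mul_div]
        exact div_le_div_of_nonneg_right (by linarith [hb2 τ hτ]) hp1.le
      have h3 : 0 ≤ 2 * b τ / (p - 1) := by have := hbpos τ hτ; positivity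
      have h4 : (4 / (p - 1) + 1) * beta p (b 0) τ ≤ 1 / 4 :=
        le_trans (by have := hβε τ hτ; gcongr) hε4
      have h5 := ha τ hτ
      have h6 := hβ τ hτ
      have h7 : 0 ≤ 4 / (p - 1) * beta p (b 0) τ := by positivity
      rw [abs_le]; constructor <;> linarith [h1.1, h1.2]
    have hc0 : ∀ τ ∈ Icc 0 T, 3 / 8 ≤ c τ := fun τ hτ => by linarith [(abs_le.1 (hcbd τ hτ)).1]
    have hc1 : ∀ τ ∈ Icc 0 T, c τ ≤ 1 := fun τ hτ => by linarith [(abs_le.1 (hcbd τ hτ)).2]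
    have hM' : ∀ τ ∈ Icc 0 T,
        beta p (b 0) τ ^ 2 * (majM1 p a b ξ τ).toReal ≤ beta p (b 0) τ := fun τ hτ =>
      sq_mul_le_of_le_rpow (hβ τ hτ) (by linarith [hβε τ hτ])
        (toReal_le_rpow (Real.rpow_nonneg (hβ τ hτ).le _) (hM τ hτ)).2
    have hwc : IsGaugedSolution p T (fun τ => 2 * c τ - 1 / 2) w := hw.congr ha
    have hξm : ∀ τ ∈ Icc 0 T, AEMeasurable (ξ τ) := by
      intro τ hτ
      have h1 : Measurable (vabc p (a τ) (b τ) (c τ)) :=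
        ((continuous_profile hp (hbpos τ hτ)).mul
          (by unfold phi0; fun_prop : Continuous (phi0 (a τ)))).measurable
      refine ((hw.aemeasurable hT hτ).sub h1.aemeasurable).congr (Eventually.of_forall fun y => ?_)
      simp [hdec τ hτ y]
    have hpert : ∀ τ ∈ Icc 0 T,
        IsPerturbation (c τ) (beta p (b 0) τ ^ 2 * (majM1 p a b ξ τ).toReal) (ξ τ) := by
      intro τ hτ
      refine ⟨hξm τ hτ, ?_⟩
      have h := ae_abs_le_majM1 (hβ τ hτ) hτ.1
        (toReal_le_rpow (Real.rpow_nonneg (hβ τ hτ).le _) (hM τ hτ)).1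
      rwa [ha τ hτ] at h
    have ho₀ : ∀ τ ∈ Icc 0 T, ∫ y, ξ τ y * phi0 (2 * c τ - 1 / 2) y = 0 := fun τ hτ => by
      rw [← ha τ hτ]; exact horth₀ τ hτ
    have ho₁ : ∀ τ ∈ Icc 0 T, ∫ y, y ^ 2 * (ξ τ y * phi0 (2 * c τ - 1 / 2) y) = 0 := by
      intro τ hτ
      refine (hpert τ hτ).integral_sq_mul_phi0 (hc0 τ hτ) (ho₀ τ hτ) ?_
      rw [← ha τ hτ]; exact horth₂ τ hτ
    intro τ hτ
    -- `ξ` agrees on `[0, T]` with the globally defined difference `w - v_{abc}`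
    set ζ : ℝ → ℝ → ℝ := fun τ y => w τ y - vabc p (2 * c τ - 1 / 2) (b τ) (c τ) y with hζ
    have hζξ : ∀ τ ∈ Icc 0 T, ζ τ = ξ τ := by
      intro s hs
      ext y
      simp only [hζ]
      rw [hdec s hs y, ha s hs]; ring
    have hsys := system_of_solution hp hT hb hc hbpos hb1 hc0 hc1 hwc (ζ := ζ) (fun _ _ => rfl)
      (fun s hs => by
        rw [hζξ s hs]
        exact (hpert s hs).mono (by linarith [hM' s hs, hβε s hs]))
      (fun s hs => by rw [hζξ s hs]; exact ho₀ s hs)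
      (fun s hs => by rw [hζξ s hs]; exact ho₁ s hs) hτ
    rw [hζξ τ hτ] at hsys
    obtain ⟨hdet, hRb, hRc⟩ := hstat (b τ) (c τ) _ (ξ τ) (hbpos τ hτ) (hb1 τ hτ) (hc0 τ hτ)
      (hc1 τ hτ) (hpert τ hτ) ((hM' τ hτ).trans ((hβε τ hτ).trans hε2)) (ho₀ τ hτ) (ho₁ τ hτ)
    obtain ⟨hX, hY⟩ := eq_remainder_of_system (hc0 τ hτ) hdet hsys.1 hsys.2
    have hord : C * (b τ ^ 3 + b τ * (beta p (b 0) τ ^ 2 * (majM1 p a b ξ τ).toReal)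
        + (beta p (b 0) τ ^ 2 * (majM1 p a b ξ τ).toReal) ^ 2
        + (beta p (b 0) τ ^ 2 * (majM1 p a b ξ τ).toReal) ^ p
        + |2 * c τ - 1 + 2 * b τ / (p - 1)| *
          (beta p (b 0) τ ^ 2 * (majM1 p a b ξ τ).toReal)) ≤
        (8 * C + 1) * remainderOrder p a b ξ τ := by
      have hAτ := (hA' τ hτ).1
      have e0 : a τ - 1 / 2 + 2 * b τ / (p - 1) = 2 * c τ - 1 + 2 * b τ / (p - 1) := by
        rw [ha τ hτ]; ring
      rw [e0] at hAτ
      have hβτ := hβ τ hτ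
      have hβ1 : beta p (b 0) τ ≤ 1 := by linarith [hβε τ hτ]
      have hbτ := hb2 τ hτ
      have hb0τ := hbpos τ hτ
      have hm : 0 ≤ (majM1 p a b ξ τ).toReal := ENNReal.toReal_nonneg
      have hα : 0 ≤ (majA p a b τ).toReal := ENNReal.toReal_nonneg
      unfold remainderOrder
      generalize beta p (b 0) τ = β at *
      generalize (majM1 p a b ξ τ).toReal = m at *
      generalize (majA p a b τ).toReal = α at *
      have t1 : b τ ^ 3 ≤ 8 * β ^ 3 := by
        calc b τ ^ 3 ≤ (2 * β) ^ 3 := by gcongr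
          _ = _ := by ring
      have t2 : b τ * (β ^ 2 * m) ≤ 2 * (β ^ 3 * m) := by
        calc b τ * (β ^ 2 * m) ≤ 2 * β * (β ^ 2 * m) := by gcongr
          _ = _ := by ring
      have t3 : (β ^ 2 * m) ^ p = β ^ (2 * p) * m ^ p := by
        rw [Real.mul_rpow (by positivity) hm, ← Real.rpow_natCast β 2, ← Real.rpow_mul hβτ.le]
        norm_num
      have t4 : |2 * c τ - 1 + 2 * b τ / (p - 1)| * (β ^ 2 * m) ≤ β ^ 3 * m * α := by
        calc _ ≤ β ^ 2 * α * (β ^ 2 * m) := by gcongr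
          _ = β * (β ^ 3 * m * α) := by ring
          _ ≤ 1 * (β ^ 3 * m * α) := by gcongr
          _ = _ := one_mul _
      have q1 : 0 ≤ β ^ 3 := by positivity
      have q2 : 0 ≤ β ^ 3 * m := by positivity
      have q3 : 0 ≤ β ^ 3 * m * α := by positivity
      have q4 : 0 ≤ β ^ 4 * m ^ 2 := by positivity
      have q5 : 0 ≤ β ^ (2 * p) * m ^ p := by positivity
      have hsum : b τ ^ 3 + b τ * (β ^ 2 * m) + (β ^ 2 * m) ^ 2 + (β ^ 2 * m) ^ p
          + |2 * c τ - 1 + 2 * b τ / (p - 1)| * (β ^ 2 * m) ≤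
          8 * (β ^ 3 + β ^ 3 * m * (1 + α) + β ^ 4 * m ^ 2 + β ^ (2 * p) * m ^ p) := by
        rw [t3]; linarith
      have hpos : 0 ≤ β ^ 3 + β ^ 3 * m * (1 + α) + β ^ 4 * m ^ 2 + β ^ (2 * p) * m ^ p := by
        positivity
      calc _ ≤ C * (8 * (β ^ 3 + β ^ 3 * m * (1 + α) + β ^ 4 * m ^ 2 + β ^ (2 * p) * m ^ p)) := by
            gcongr
        _ ≤ _ := by linarith
    refine ⟨?_, ?_, hRb.trans hord, hRc.trans hord⟩
    · rw [← hY, ha τ hτ]; unfold defectB; ring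
    · rw [← hX, ha τ hτ]; unfold defectC; ring
  · intro b c hb hbε _ hc1
    rcases le_or_gt (3 / 8) c with hc | hc
    · have hpert : IsPerturbation c 0 (0 : ℝ → ℝ) := ⟨aemeasurable_const, by simp⟩
      obtain ⟨-, h1, h2⟩ := hstat b c 0 0 hb.le (by linarith) hc hc1 hpert hM₀.le
        (by simp) (by simp)
      have hz : C * (b ^ 3 + b * 0 + 0 ^ 2 + 0 ^ p + |2 * c - 1 + 2 * b / (p - 1)| * 0) ≤
          (8 * C + 1) * b ^ 3 := by
        rw [Real.zero_rpow (by linarith)]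
        have : 0 < b ^ 3 := by positivity
        nlinarith
      exact ⟨h1.trans hz, h2.trans hz⟩
    · unfold remainderB remainderC
      rw [if_neg hc.not_ge, if_neg hc.not_ge, abs_zero]
      exact ⟨by positivity, by positivity⟩
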